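/- There are an algorithm and a constant $C$ with the following property. The input consists of - a finite digraph $H$ without loops and without parallel arcs, with $k$ vertices and $\ell$ arcs, given by the list of its arcs; - a nonempty semi-complete digraph $T$ (no loops, no parallel arcs, and between any two distinct vertices at least one arc), given by its adjacency matrix with constant-time access; - a path decomposition $(W_1,\dots,W_r)$ of $T$ of width $p=\max_i(|W_i|-1)$, given by the list of its bags. That is: $\bigcup_i W_i=V(T)$; $W_i\cap W_m\subseteq W_j$ whenever $i<j<m$; and for every arc $(u,v)$ of $T$, either $u,v\in W_i$ for some $i$, or $u\in W_i$ and $v\in W_j$ for some $i>j$. The algorithm correctly decides whether $H$ is topologically contained in $T$, i.e. whether the vertices of $H$ can be mapped injectively to vertices of $T$, and every arc $(u,v)$ of $H$ to a directed path of $T$ from the image of $u$ to the image of $v$, so that no internal vertex of one of these paths is the image of a vertex of $H$ or an internal vertex of another of the paths. If no two consecutive bags are equal, its running time is at most $$C\cdot 2^{C(p+k+\ell)\log_2(p+2)}\cdot|V(T)|,$$ i.e. $O\bigl(2^{O((p+k+\ell)\log (p+2))}\,|V(T)|\bigr)$. For an arbitrary path decomposition with $r$ bags the same bound holds with $|V(T)|+r$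 in place of $|V(T)|$. Running time is the number of steps of a unit-cost word RAM (registers, finitely many randomly accessible arrays that are zero outside the input, operations $+$, truncated $-$, $\times$, integer division and remainder, comparison, load, store, branching and loops) with words of at most $C\bigl((p+k+\ell)\log_2(p+2)+\log_2(|V(T)|+r)+1\bigr)$ bits; no value exceeding a word occurs in the computation. -/

import Mathlib

/-! Digraphs, topological containment, path decompositions. -/

namespace TopDP

/-- A simple digraph: no loops (a `Digraph` has no parallel arcs by construction). -/
def Simple {V : Type*} (G : Digraph V) : Prop :=
  ∀ v, ¬ G.Adj v v

/-- A semi-complete digraph: simple, and any two distinct vertices are joined by at least one arc. -/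
def SemiComplete {V : Type*} (G : Digraph V) : Prop :=
  Simple G ∧ ∀ u v, u ≠ v → G.Adj u v ∨ G.Adj v u

/-- `P` is the vertex sequence of a directed path of `G` leading from `a` to `b`
(no vertex is repeated). -/
structure IsDirPath {V : Type*} (G : Digraph V) (a b : V) (P : List V) : Prop where
  chain : P.IsChain G.Adj
  nodup : P.Nodup
  first : P.head? = some a
  last : P.getLast? = some b

/-- The internal vertices of a path: all but the first and the last one. -/
def internalVertices {V : Type*} (P : List V) : List V :=
  P.tail.dropLast

/-- An expansion of `H` in `G`: vertices are mapped injectively to vertices, every arc `(u, v)` to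
a directed path from the image of `u` to the image of `v`, and the paths are internally
vertex-disjoint: an internal vertex of a path is neither the image of a vertex of `H` nor an
internal vertex of the path of another arc. (`path u v` is irrelevant if `(u, v)` is no arc.) -/
structure Expansion {U V : Type*} (H : Digraph U) (G : Digraph V) where
  vert : U → V
  path : U → U → List V
  vert_injective : Function.Injective vert
  isDirPath : ∀ u v, H.Adj u v → IsDirPath G (vert u) (vert v) (path u v)
  internal_not_vert : ∀ u v, H.Adj u v → ∀ x ∈ internalVertices (path u v), ∀ z, vert z ≠ x
  internal_disjoint : ∀ u v u' v', H.Adj u v → H.Adj u' v' → (u, v) ≠ (u', v') →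
    ∀ x ∈ internalVertices (path u v), x ∉ internalVertices (path u' v')

/-- `H` is topologically contained in `G`. -/
def TopologicallyContained {U V : Type*} (H : Digraph U) (G : Digraph V) : Prop :=
  Nonempty (Expansion H G)

/-- `W 0, ..., W (r - 1)` are the bags of a path decomposition of the digraph `G`. -/
structure IsPathDecomposition {V : Type*} (G : Digraph V) {r : ℕ} (W : Fin r → Finset V) :
    Prop where
  cover : ∀ v, ∃ i, v ∈ W i
  interval : ∀ i j l, i < j → j < l → ∀ v, v ∈ W i → v ∈ W l → v ∈ W j
  arc : ∀ u v, G.Adj u v → (∃ i, u ∈ W i ∧ v ∈ W i) ∨ ∃ i j, j < i ∧ u ∈ W i ∧ v ∈ W j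

/-- The width of a family of bags, `max (|W i| - 1)`. (The truncation of the subtraction is
harmless as soon as some bag is nonempty.) -/
def width {V : Type*} {r : ℕ} (W : Fin r → Finset V) : ℕ :=
  Finset.univ.sup fun i => (W i).card - 1

/-- No two consecutive bags are equal. -/
def ConsecutiveDistinct {V : Type*} {r : ℕ} (W : Fin r → Finset V) : Prop :=
  ∀ i j : Fin r, (i : ℕ) + 1 = j → W i ≠ W j

/-- The family of bags that is described by a list of lists of vertices. -/
def bagFamily {n : ℕ} (bags : List (List (Fin n))) : Fin bags.length → Finset (Fin n) :=
  fun i => (bags.get i).toFinset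

end TopDP

/-! A word RAM with unit cost. Memory consists of registers and of one-dimensional arrays with
random access; a program names only finitely many of them. Every value that is computed has to fit
into a word of `w` bits: a computation with an overflow is stuck. -/

namespace WordRAM

structure State where
  /-- contents of the registers -/
  reg : ℕ → ℕ
  /-- `mem a i` is entry `i` of array `a` -/
  mem : ℕ → ℕ → ℕ

def State.setReg (s : State) (d x : ℕ) : State :=
  { s with reg := Function.update s.reg d x }

def State.setMem (s : State) (a i x : ℕ) : State :=
  { s with mem := Function.update s.mem a (Function.update (s.mem a) i x) }

/-- All registers and all array entries are words of `w` bits. -/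
def State.Fits (w : ℕ) (s : State) : Prop :=
  (∀ i, s.reg i < 2 ^ w) ∧ ∀ a i, s.mem a i < 2 ^ w

/-- The arithmetic operations: addition, truncated subtraction, multiplication, integer division
(with `x / 0 = 0`), remainder, comparison. -/
inductive Op where
  | add | sub | mul | div | mod | lt

def Op.eval : Op → ℕ → ℕ → ℕ
  | .add, x, y => x + y
  | .sub, x, y => x - y
  | .mul, x, y => x * y
  | .div, x, y => x / y
  | .mod, x, y => x % y
  | .lt, x, y => if x < y then 1 else 0

/-- Programs. -/
inductive Prog where
  /-- do nothing -/
  | skip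
  /-- `reg d := c` -/
  | const (d c : ℕ)
  /-- `reg d := reg x o reg y` -/
  | arith (o : Op) (d x y : ℕ)
  /-- `reg d := mem a [reg x]` -/
  | load (d a x : ℕ)
  /-- `mem a [reg x] := reg y` -/
  | store (a x y : ℕ)
  /-- first `P`, then `Q` -/
  | seq (P Q : Prog)
  /-- if `reg x ≠ 0` then `P` else `Q` -/
  | cond (x : ℕ) (P Q : Prog)
  /-- while `reg x ≠ 0` do `P` -/
  | loop (x : ℕ) (P : Prog)

/-- `Exec w P s s' t`: with words of `w` bits, the program `P` started in state `s` halts in state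
`s'` after exactly `t` steps. Every elementary instruction and every test takes one step. -/
inductive Exec (w : ℕ) : Prog → State → State → ℕ → Prop where
  | skip (s : State) : Exec w .skip s s 0
  | const (s : State) (d c : ℕ) (h : c < 2 ^ w) : Exec w (.const d c) s (s.setReg d c) 1
  | arith (s : State) (o : Op) (d x y : ℕ) (h : o.eval (s.reg x) (s.reg y) < 2 ^ w) :
      Exec w (.arith o d x y) s (s.setReg d (o.eval (s.reg x) (s.reg y))) 1
  | load (s : State) (d a x : ℕ) :
      Exec w (.load d a x) s (s.setReg d (s.mem a (s.reg x))) 1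
  | store (s : State) (a x y : ℕ) :
      Exec w (.store a x y) s (s.setMem a (s.reg x) (s.reg y)) 1
  | seq {P Q : Prog} {s s' s'' : State} {t t' : ℕ}
      (hP : Exec w P s s' t) (hQ : Exec w Q s' s'' t') : Exec w (.seq P Q) s s'' (t + t')
  | cond_true {x : ℕ} {P Q : Prog} {s s' : State} {t : ℕ} (h : s.reg x ≠ 0)
      (hP : Exec w P s s' t) : Exec w (.cond x P Q) s s' (t + 1)
  | cond_false {x : ℕ} {P Q : Prog} {s s' : State} {t : ℕ} (h : s.reg x = 0)
      (hQ : Exec w Q s s' t) : Exec w (.cond x P Q) s s' (t + 1)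
  | loop_true {x : ℕ} {P : Prog} {s s' s'' : State} {t t' : ℕ} (h : s.reg x ≠ 0)
      (hP : Exec w P s s' t) (hL : Exec w (.loop x P) s' s'' t') :
      Exec w (.loop x P) s s'' (t + t' + 1)
  | loop_false {x : ℕ} {P : Prog} {s : State} (h : s.reg x = 0) : Exec w (.loop x P) s s 1

end WordRAM

namespace TopDP

/-- The list of the arcs `(u, v)` of `H` as a sequence of numbers: tail, head, tail, head, ... -/
def encodeArcs {k : ℕ} (arcs : List (Fin k × Fin k)) : List ℕ :=
  arcs.flatMap fun e => [(e.1 : ℕ), (e.2 : ℕ)]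

/-- The bags, one after the other, each as its size followed by its elements. -/
def encodeBags {n : ℕ} (bags : List (List (Fin n))) : List ℕ :=
  bags.flatMap fun b => b.length :: b.map fun v => (v : ℕ)

open Classical in
/-- Row by row, the adjacency matrix of `T`: entry `u * n + v` is `1` if `(u, v)` is an arc, and `0`
otherwise. -/
noncomputable def encodeMatrix {n : ℕ} (T : Digraph (Fin n)) (i : ℕ) : ℕ :=
  if ∃ u v : Fin n, i = u * n + v ∧ T.Adj u v then 1 else 0

/-- The initial state of the machine. Registers `0, 1, 2, 3` hold the number of vertices of `H`, the
number of arcs of `H`, the number of vertices of `T` and the number of bags; arrays `0, 1, 2` hold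
the arc list of `H`, the adjacency matrix of `T` and the bags; everything else is `0`. -/
noncomputable def initialState {k n : ℕ} (arcs : List (Fin k × Fin k)) (T : Digraph (Fin n))
    (bags : List (List (Fin n))) : WordRAM.State where
  reg := fun i => [k, arcs.length, n, bags.length].getD i 0
  mem := fun a i =>
    match a with
    | 0 => (encodeArcs arcs).getD i 0
    | 1 => encodeMatrix T i
    | 2 => (encodeBags bags).getD i 0
    | _ => 0

/-- The factor `2 ^ (C * (p + k + ℓ) * log (p + 2))`. -/
noncomputable def expFactor (C p k l : ℕ) : ℝ :=
  (2 : ℝ) ^ ((C : ℝ) * ((p : ℝ) + k + l) * Real.logb 2 ((p : ℝ) + 2))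

end TopDP

/-! In a semi-complete digraph a path decomposition acts as a one-way street. If v has left the bags
and u has not yet appeared, then (u, v) is an arc and (v, u) is not (`IsBagSeq.separated`). A sweep
over the bags can therefore treat the forgotten vertices as one set: every future vertex dominates
all of it, and no arc leads from it to the future.

A path of an expansion may still enter the forgotten set from the future. Every path can be
shortened until it has no forward chord (`IsDirPath.exists_chordless`). If two arcs (u, x) and (u',
x') of such a path led from distinct future vertices to forgotten ones, then (u, x') and (u', x)
would both be arcs, and one of them would be a forward chord. So for each arc of the pattern at most
one arc from the future is outstanding, and the single bit `pend` records it. The bit need not name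
the waiting vertex, because every future vertex has an arc to it.

Vertices carry labels: 0 for unused, e + 1 for an internal vertex of the path of e, l + 1 + h for
the image of h. A state consists of the labels in the current bag and a few bits. With m the size of
the largest bag there are 2 ^ (3l + k + 2m) * (k + l + 1) ^ m codes of states.

The table of reachable states is correct in two senses (`Correct`). Soundness: every state in it has
a `PartialSol`, a labelling together with chosen arcs such that each vertex has at most one incoming
arc per path and each forgotten internal vertex has an outgoing one. This is weaker than an
expansion, since stray cycles and branching are allowed, but it suffices at the end. A walk from the
image of the tail cannot return to itself, as incoming arcs are unique, so it reaches the image of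
the head (`exists_isDirPath_of_rel`). Completeness: the state `stateOf` that is read off from any
chordless solution is always in the table. Chordlessness is used in `ArcPhase.take` and
`LeavePhase.step`, where it shows that one `pend` bit is enough. After an additional empty bag
everything is forgotten, and one fixed code decides the question (`Correct.accept_iff`).

For the running time, a small structured language is compiled to the machine and equipped with
time-bounded Hoare triples (`Run`). States are mixed radix numbers that index an array, and each
kind of move is one scan of this array in place (`run_pass`). The total time is polynomial in the
number of codes, times the number of bags plus one. `numCodes_le` bounds the number of codes; its
point is (q + 1) ^ a ≤ a ^ a * 4 ^ q, which keeps the logarithm of k + l out of the exponent. If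
consecutive bags differ, there are at most 2n + 1 bags, because each vertex enters once and leaves
once. -/

set_option linter.constructorNameAsVariable false

/-! ### Visible states of a structured language and their simulation by machine states -/

namespace WordRAM

/-- The variables of the high-level language; the first four hold the input. -/
inductive Var
  | k | l | n | r | m | nb | D | N | R | c | d | x | y | i | j | f | g | e | s1 | s2 | q | lam
  | v | u | b | pos | sz | h | ix
  deriving DecidableEq

/-- The arrays of the high-level language; the first three hold the input. -/
inductive Arr
  | arcs | mat | bags | wt | tab | slot
  deriving DecidableEq

/-- The order of the constructors matters: it puts `k`, `l`, `n`, `r` into registers 0 to 3, where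
the initial state has its input. Register 0, that is `k`, also holds the answer. -/
def Var.num (x : Var) : ℕ := x.ctorIdx

def Arr.num (a : Arr) : ℕ := a.ctorIdx

/-- The first register that holds temporary values. -/
def tempBase : ℕ := 64

theorem Var.num_injective : Function.Injective Var.num := by
  intro a b h
  have := congrArg Var.ofNat h
  simpa [Var.num, Var.ofNat_ctorIdx] using this

theorem Arr.num_injective : Function.Injective Arr.num := by
  intro a b h
  have := congrArg Arr.ofNat h
  simpa [Arr.num, Arr.ofNat_ctorIdx] using this

theorem Var.num_lt (x : Var) : x.num < tempBase := by
  cases x <;> decide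

/-- The part of a state that is visible to the high-level language. -/
structure HState where
  reg : Var → ℕ
  mem : Arr → ℕ → ℕ

namespace HState

def setReg (σ : HState) (x : Var) (a : ℕ) : HState :=
  ⟨fun y => if y = x then a else σ.reg y, σ.mem⟩

def setMem (σ : HState) (a : Arr) (i x : ℕ) : HState :=
  ⟨σ.reg, fun b j => if b = a ∧ j = i then x else σ.mem b j⟩

@[simp] theorem reg_setReg (σ : HState) (x y : Var) (a : ℕ) :
    (σ.setReg x a).reg y = if y = x then a else σ.reg y := rfl

@[simp] theorem mem_setReg (σ : HState) (x : Var) (a : ℕ) : (σ.setReg x a).mem = σ.mem := rfl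

@[simp] theorem reg_setMem (σ : HState) (a : Arr) (i x : ℕ) : (σ.setMem a i x).reg = σ.reg := rfl

@[simp] theorem mem_setMem (σ : HState) (a b : Arr) (i x j : ℕ) :
    (σ.setMem a i x).mem b j = if b = a ∧ j = i then x else σ.mem b j := rfl

theorem mem_setMem_of_ne (σ : HState) {a b : Arr} (h : b ≠ a) (i x : ℕ) :
    (σ.setMem a i x).mem b = σ.mem b := by
  funext j; simp [h]

end HState

/-- The machine state `s` has the visible part `σ`. -/
structure Sim (w : ℕ) (s : State) (σ : HState) : Prop where
  fits : s.Fits w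
  reg : ∀ x : Var, s.reg x.num = σ.reg x
  mem : ∀ a : Arr, s.mem a.num = σ.mem a

theorem Sim.reg_lt {w : ℕ} {s : State} {σ : HState} (h : Sim w s σ) (x : Var) :
    σ.reg x < 2 ^ w := h.reg x ▸ h.fits.1 _

theorem Sim.mem_lt {w : ℕ} {s : State} {σ : HState} (h : Sim w s σ) (a : Arr) (i : ℕ) :
    σ.mem a i < 2 ^ w := h.mem a ▸ h.fits.2 _ _

theorem Sim.setTemp {w : ℕ} {s : State} {σ : HState} (h : Sim w s σ) {d x : ℕ}
    (hd : tempBase ≤ d) (hx : x < 2 ^ w) : Sim w (s.setReg d x) σ where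
  fits := by
    refine ⟨fun i => ?_, h.fits.2⟩
    by_cases hi : i = d
    · simpa [State.setReg, hi] using hx
    · simpa [State.setReg, hi] using h.fits.1 i
  reg y := by
    have := y.num_lt
    have hy : y.num ≠ d := by omega
    simpa [State.setReg, hy] using h.reg y
  mem := h.mem

theorem Sim.setReg {w : ℕ} {s : State} {σ : HState} (h : Sim w s σ) (y : Var) {x : ℕ}
    (hx : x < 2 ^ w) : Sim w (s.setReg y.num x) (σ.setReg y x) where
  fits := by
    refine ⟨fun i => ?_, h.fits.2⟩
    by_cases hi : i = y.num
    · simpa [State.setReg, hi] using hx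
    · simpa [State.setReg, hi] using h.fits.1 i
  reg z := by
    by_cases hz : z = y
    · simp [State.setReg, hz]
    · have : z.num ≠ y.num := fun e => hz (Var.num_injective e)
      simpa [State.setReg, hz, this] using h.reg z
  mem := h.mem

theorem Sim.setMem {w : ℕ} {s : State} {σ : HState} (h : Sim w s σ) (a : Arr) (i : ℕ) {x : ℕ}
    (hx : x < 2 ^ w) : Sim w (s.setMem a.num i x) (σ.setMem a i x) where
  fits := by
    refine ⟨h.fits.1, fun b j => ?_⟩
    by_cases hb : b = a.num
    · by_cases hj : j = i
      · simpa [State.setMem, hb, hj] using hx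
      · simpa [State.setMem, hb, hj] using h.fits.2 _ j
    · simpa [State.setMem, hb] using h.fits.2 b j
  reg := h.reg
  mem b := by
    funext j
    by_cases hb : b = a
    · subst hb
      by_cases hj : j = i
      · simp [State.setMem, hj]
      · simpa [State.setMem, hj] using congrFun (h.mem b) j
    · have : b.num ≠ a.num := fun e => hb (Arr.num_injective e)
      simpa [State.setMem, hb, this] using congrFun (h.mem b) j

/-! ### Expressions and their compilation -/

/-- Expressions. -/
inductive Ex
  | var (x : Var)
  | lit (c : ℕ)
  | op (o : Op) (a b : Ex)
  | get (a : Arr) (i : Ex)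

namespace Ex

instance : Coe Var Ex := ⟨Ex.var⟩
instance (n : ℕ) : OfNat Ex n := ⟨Ex.lit n⟩
instance : Add Ex := ⟨Ex.op .add⟩
instance : Sub Ex := ⟨Ex.op .sub⟩
instance : Mul Ex := ⟨Ex.op .mul⟩
instance : Div Ex := ⟨Ex.op .div⟩
instance : Mod Ex := ⟨Ex.op .mod⟩

/-- The expression is `1` if `a < b`, and `0` otherwise. -/
def lt (a b : Ex) : Ex := .op .lt a b

/-- The expression is positive if and only if `a ≠ b`. -/
def ne (a b : Ex) : Ex := lt a b + lt b a

def val (σ : HState) : Ex → ℕ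
  | var x => σ.reg x
  | lit c => c
  | op o a b => o.eval (a.val σ) (b.val σ)
  | get a i => σ.mem a (i.val σ)

/-- No value that occurs in the evaluation exceeds a word. -/
def ok (B : ℕ) (σ : HState) : Ex → Prop
  | var _ => True
  | lit c => c < B
  | op o a b => a.ok B σ ∧ b.ok B σ ∧ o.eval (a.val σ) (b.val σ) < B
  | get _ i => i.ok B σ

/-- The registers from `d` on serve as an evaluation stack. The machine cannot copy a register, so a
variable is read by adding it to a register that holds zero. -/
def code : Ex → ℕ → Prog
  | var x, d => .seq (.const d 0) (.arith .add d x.num d)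
  | lit c, d => .const d c
  | op o a b, d => .seq (a.code d) (.seq (b.code (d + 1)) (.arith o d d (d + 1)))
  | get a i, d => .seq (i.code d) (.load d a.num d)

def cost : Ex → ℕ
  | var _ => 2
  | lit _ => 1
  | op _ a b => a.cost + (b.cost + 1)
  | get _ i => i.cost + 1

section
variable (σ : HState) (B : ℕ) (a b : Ex)

@[simp] theorem val_var (x : Var) : (var x).val σ = σ.reg x := rfl
@[simp] theorem val_lit (c : ℕ) : (lit c).val σ = c := rfl
@[simp] theorem val_zero : val σ 0 = 0 := rfl
@[simp] theorem val_one : val σ 1 = 1 := rfl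
@[simp] theorem val_two : val σ 2 = 2 := rfl
@[simp] theorem val_three : val σ 3 = 3 := rfl
@[simp] theorem val_add : (a + b).val σ = a.val σ + b.val σ := rfl
@[simp] theorem val_sub : (a - b).val σ = a.val σ - b.val σ := rfl
@[simp] theorem val_mul : (a * b).val σ = a.val σ * b.val σ := rfl
@[simp] theorem val_div : (a / b).val σ = a.val σ / b.val σ := rfl
@[simp] theorem val_mod : (a % b).val σ = a.val σ % b.val σ := rfl
@[simp] theorem val_lt : (lt a b).val σ = if a.val σ < b.val σ then 1 else 0 := rfl
@[simp] theorem val_get (r : Arr) : (get r a).val σ = σ.mem r (a.val σ) := rfl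
@[simp] theorem val_ne_eq_zero : (ne a b).val σ = 0 ↔ a.val σ = b.val σ := by
  rcases lt_trichotomy (a.val σ) (b.val σ) with h | h | h
  · simp [ne, h, h.ne]
  · simp [ne, h]
  · simp [ne, h, h.ne']
@[simp] theorem ok_var (x : Var) : (var x).ok B σ ↔ True := Iff.rfl
@[simp] theorem ok_lit (c : ℕ) : (lit c).ok B σ ↔ c < B := Iff.rfl
@[simp] theorem ok_zero : ok B σ 0 ↔ 0 < B := Iff.rfl
@[simp] theorem ok_one : ok B σ 1 ↔ 1 < B := Iff.rfl
@[simp] theorem ok_two : ok B σ 2 ↔ 2 < B := Iff.rfl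
@[simp] theorem ok_three : ok B σ 3 ↔ 3 < B := Iff.rfl
@[simp] theorem ok_add : (a + b).ok B σ ↔ a.ok B σ ∧ b.ok B σ ∧ a.val σ + b.val σ < B := Iff.rfl
@[simp] theorem ok_sub : (a - b).ok B σ ↔ a.ok B σ ∧ b.ok B σ ∧ a.val σ - b.val σ < B := Iff.rfl
@[simp] theorem ok_mul : (a * b).ok B σ ↔ a.ok B σ ∧ b.ok B σ ∧ a.val σ * b.val σ < B := Iff.rfl
@[simp] theorem ok_div : (a / b).ok B σ ↔ a.ok B σ ∧ b.ok B σ ∧ a.val σ / b.val σ < B := Iff.rfl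
@[simp] theorem ok_mod : (a % b).ok B σ ↔ a.ok B σ ∧ b.ok B σ ∧ a.val σ % b.val σ < B := Iff.rfl
@[simp] theorem ok_get (r : Arr) : (get r a).ok B σ ↔ a.ok B σ := Iff.rfl

theorem ok_lt (hB : 1 < B) : (lt a b).ok B σ ↔ a.ok B σ ∧ b.ok B σ := by
  refine ⟨fun h => ⟨h.1, h.2.1⟩, fun h => ⟨h.1, h.2, ?_⟩⟩
  simp only [Op.eval]; split_ifs <;> omega

theorem ok_ne (hB : 1 < B) : (ne a b).ok B σ ↔ a.ok B σ ∧ b.ok B σ := by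
  simp only [ne, ok_add, ok_lt _ _ _ _ hB, val_lt]
  refine ⟨fun h => h.1, fun h => ⟨h, h.symm, ?_⟩⟩
  split_ifs <;> omega
end

theorem val_lt_of_ok {w : ℕ} {s : State} {σ : HState} (h : Sim w s σ) :
    ∀ {e : Ex}, e.ok (2 ^ w) σ → e.val σ < 2 ^ w
  | var x, _ => h.reg_lt x
  | lit _, he => he
  | op _ _ _, he => he.2.2
  | get a _, _ => h.mem_lt a _

/-- The clause about registers below `d` makes the induction work: the left operand in `d` survives
while the right one is evaluated from `d + 1` on. -/
theorem exec_code {w : ℕ} {σ : HState} (e : Ex) : ∀ {s : State} {d : ℕ}, Sim w s σ →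
    e.ok (2 ^ w) σ → tempBase ≤ d → ∃ s', Exec w (e.code d) s s' e.cost ∧ Sim w s' σ ∧
      s'.reg d = e.val σ ∧ ∀ i, i < d → s'.reg i = s.reg i := by
  have hne : ∀ (s : State) (d x i : ℕ), i < d → (s.setReg d x).reg i = s.reg i := by
    intro s d x i hi
    simp [State.setReg, show i ≠ d by omega]
  have heq : ∀ (s : State) (d x : ℕ), (s.setReg d x).reg d = x := by
    intro s d x
    simp [State.setReg]
  induction e with
  | var x =>
    intro s d h _ hd
    have hx := h.reg_lt x
    have h1 := h.setTemp (x := 0) hd (by positivity)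
    have hv : (s.setReg d 0).reg x.num = σ.reg x := h1.reg x
    have h2 : Op.add.eval ((s.setReg d 0).reg x.num) ((s.setReg d 0).reg d) = σ.reg x := by
      rw [hv, heq]; rfl
    refine ⟨_, .seq (.const s d 0 (by positivity)) (.arith _ .add d x.num d (by rw [h2]; exact hx)),
      ?_, ?_, ?_⟩
    · rw [h2]; exact h1.setTemp hd hx
    · rw [h2, heq]; rfl
    · intro i hi
      rw [hne _ _ _ _ hi, hne _ _ _ _ hi]
  | lit c =>
    intro s d h he hd
    exact ⟨_, .const s d c he, h.setTemp hd he, heq _ _ _, fun i hi => hne _ _ _ _ hi⟩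
  | op o a b iha ihb =>
    intro s d h he hd
    obtain ⟨s1, e1, h1, v1, f1⟩ := iha h he.1 hd
    obtain ⟨s2, e2, h2, v2, f2⟩ := ihb h1 he.2.1 (Nat.le_succ_of_le hd)
    have hv : o.eval (s2.reg d) (s2.reg (d + 1)) = (op o a b).val σ := by
      rw [v2, f2 d (Nat.lt_succ_self d), v1]; rfl
    refine ⟨_, .seq e1 (.seq e2 (.arith s2 o d d (d + 1) (by rw [hv]; exact he.2.2))), ?_, ?_, ?_⟩
    · rw [hv]; exact h2.setTemp hd he.2.2
    · rw [heq, hv]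
    · intro i hi
      rw [hne _ _ _ _ hi, f2 i (by omega), f1 i hi]
  | get a i ih =>
    intro s d h he hd
    obtain ⟨s1, e1, h1, v1, f1⟩ := ih h he hd
    refine ⟨_, .seq e1 (.load s1 d a.num d), h1.setTemp hd (h1.fits.2 _ _), ?_, ?_⟩
    · rw [heq, v1, h1.mem]; rfl
    · intro j hj
      rw [hne _ _ _ _ hj, f1 j hj]

end Ex

/-! ### Statements, weakest preconditions and time-bounded Hoare triples -/

/-- Statements. `for_ x y S` runs `S` for `x = 0, ..., y - 1`. -/
inductive Stmt
  | skip
  | set (x : Var) (e : Ex)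
  | put (a : Arr) (i e : Ex)
  | seq (S S' : Stmt)
  | ite (c : Ex) (S S' : Stmt)
  | for_ (x y : Var) (S : Stmt)

infixr:60 " ;; " => Stmt.seq

namespace Stmt

/-- The program of `x := e`. -/
def setCode (x : Var) (e : Ex) : Prog :=
  .seq (e.code tempBase)
    (.seq (.const (tempBase + 1) 0) (.arith .add x.num tempBase (tempBase + 1)))

/-- The compiled statement. -/
def code : Stmt → Prog
  | skip => .skip
  | set x e => setCode x e
  | put a i e => .seq (i.code tempBase)
      (.seq (e.code (tempBase + 1)) (.store a.num tempBase (tempBase + 1)))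
  | seq S S' => .seq S.code S'.code
  | ite c S S' => .seq (c.code tempBase) (.cond tempBase S.code S'.code)
  | for_ x y S => .seq (setCode x (.lit 0)) (.seq ((Ex.lt x y).code tempBase)
      (.loop tempBase (.seq S.code (.seq (setCode x (x + 1)) ((Ex.lt x y).code tempBase)))))

/-- A bound for the number of steps of a statement without loops. -/
def cost : Stmt → ℕ
  | skip => 0
  | set _ e => e.cost + 2
  | put _ i e => i.cost + (e.cost + 1)
  | seq S S' => S.cost + S'.cost
  | ite c S S' => c.cost + (S.cost + S'.cost + 1)
  | for_ _ _ _ => 0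

/-- The weakest precondition of a statement without loops. -/
def wp (B : ℕ) : Stmt → (HState → Prop) → HState → Prop
  | skip, Q, σ => Q σ
  | set x e, Q, σ => e.ok B σ ∧ Q (σ.setReg x (e.val σ))
  | put a i e, Q, σ => i.ok B σ ∧ e.ok B σ ∧ Q (σ.setMem a (i.val σ) (e.val σ))
  | seq S S', Q, σ => S.wp B (S'.wp B Q) σ
  | ite c S S', Q, σ => c.ok B σ ∧ (c.val σ ≠ 0 → S.wp B Q σ) ∧ (c.val σ = 0 → S'.wp B Q σ)
  | for_ _ _ _, _, _ => False

/-- The variables that a statement may change. -/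
def wr : Stmt → Var → Bool
  | skip, _ => false
  | set x _, y => decide (y = x)
  | put _ _ _, _ => false
  | seq S S', y => S.wr y || S'.wr y
  | ite _ S S', y => S.wr y || S'.wr y
  | for_ x _ S, y => decide (y = x) || S.wr y

/-- The arrays that a statement may change. -/
def st : Stmt → Arr → Bool
  | skip, _ => false
  | set _ _, _ => false
  | put a _ _, b => decide (b = a)
  | seq S S', b => S.st b || S'.st b
  | ite _ S S', b => S.st b || S'.st b
  | for_ _ _ S, b => S.st b

end Stmt

/-- `σ` and `σ'` agree on everything that `S` does not change. -/
structure Same (S : Stmt) (σ σ' : HState) : Prop where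
  reg : ∀ x, S.wr x = false → σ'.reg x = σ.reg x
  mem : ∀ a, S.st a = false → σ'.mem a = σ.mem a

/-- With words of `w` bits, `S` started in a state `σ` halts after at most `t` steps in a state that
satisfies `Q`. -/
def Run (w : ℕ) (S : Stmt) (σ : HState) (t : ℕ) (Q : HState → Prop) : Prop :=
  ∀ s, Sim w s σ → ∃ s' σ' t', Exec w S.code s s' t' ∧ t' ≤ t ∧ Sim w s' σ' ∧ Q σ'

namespace Run

variable {w : ℕ} {S S' : Stmt} {σ : HState} {t t' : ℕ} {Q Q' : HState → Prop}

theorem mono (h : Run w S σ t Q) (ht : t ≤ t') (hQ : ∀ σ', Q σ' → Q' σ') : Run w S σ t' Q' := by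
  intro s hs
  obtain ⟨s', σ', u, h1, h2, h3, h4⟩ := h s hs
  exact ⟨s', σ', u, h1, h2.trans ht, h3, hQ _ h4⟩

theorem seq (h : Run w S σ t (fun σ' => Run w S' σ' t' Q)) : Run w (S ;; S') σ (t + t') Q := by
  intro s hs
  obtain ⟨s1, σ1, t1, e1, l1, h1, q1⟩ := h s hs
  obtain ⟨s2, σ2, t2, e2, l2, h2, q2⟩ := q1 s1 h1
  exact ⟨s2, σ2, _, .seq e1 e2, by omega, h2, q2⟩

theorem of_set {x : Var} {e : Ex} (he : e.ok (2 ^ w) σ) (hQ : Q (σ.setReg x (e.val σ))) :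
    Run w (.set x e) σ (e.cost + 2) Q := by
  intro s hs
  obtain ⟨s1, e1, h1, v1, -⟩ := e.exec_code hs he le_rfl
  have h2 := h1.setTemp (d := tempBase + 1) (x := 0) (by simp) (by positivity)
  have hv : Op.add.eval ((s1.setReg (tempBase + 1) 0).reg tempBase)
      ((s1.setReg (tempBase + 1) 0).reg (tempBase + 1)) = e.val σ := by
    simp [State.setReg, Op.eval, v1]
  have hlt := Ex.val_lt_of_ok h1 he
  refine ⟨_, _, _, .seq e1 (.seq (.const _ _ _ (by positivity))
    (.arith _ .add x.num _ _ (by rw [hv]; exact hlt))), le_rfl, ?_, hQ⟩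
  rw [hv]
  exact h2.setReg x hlt

theorem of_ite {c : Ex} (hc : c.ok (2 ^ w) σ) (h1 : c.val σ ≠ 0 → Run w S σ t Q)
    (h2 : c.val σ = 0 → Run w S' σ t Q) : Run w (.ite c S S') σ (c.cost + (t + 1)) Q := by
  intro s hs
  obtain ⟨s1, e1, g1, v1, -⟩ := c.exec_code hs hc le_rfl
  by_cases h : c.val σ = 0
  · obtain ⟨s2, σ2, t2, e2, l2, g2, q2⟩ := h2 h s1 g1
    exact ⟨s2, σ2, _, .seq e1 (.cond_false (v1.trans h) e2), by omega, g2, q2⟩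
  · obtain ⟨s2, σ2, t2, e2, l2, g2, q2⟩ := h1 h s1 g1
    exact ⟨s2, σ2, _, .seq e1 (.cond_true (fun e => h (v1.symm.trans e)) e2), by omega, g2, q2⟩

theorem of_wp {S : Stmt} : ∀ {σ : HState} {Q : HState → Prop}, S.wp (2 ^ w) Q σ →
    Run w S σ S.cost Q := by
  induction S with
  | skip => exact fun h s hs => ⟨s, _, 0, .skip s, le_rfl, hs, h⟩
  | set x e => exact fun h => of_set h.1 h.2
  | put a i e =>
    intro σ Q h s hs
    obtain ⟨s1, e1, h1, v1, -⟩ := i.exec_code hs h.1 le_rfl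
    obtain ⟨s2, e2, h2, v2, f2⟩ := e.exec_code h1 h.2.1 (Nat.le_succ tempBase)
    refine ⟨_, _, _, .seq e1 (.seq e2 (.store s2 a.num _ _)), le_rfl, ?_, h.2.2⟩
    rw [v2, f2 _ (Nat.lt_succ_self _), v1]
    exact h2.setMem a _ (Ex.val_lt_of_ok h1 h.2.1)
  | seq S S' ih ih' => exact fun h => Run.seq ((ih h).mono le_rfl fun _ => ih')
  | ite c S S' ih ih' =>
    exact fun h => of_ite h.1 (fun hc => (ih (h.2.1 hc)).mono (by omega) fun _ => id)
      (fun hc => (ih' (h.2.2 hc)).mono (by omega) fun _ => id)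
  | for_ => exact fun h => h.elim

end Run

/-! ### Frame property: what a program leaves unchanged -/

/-- The registers that a program may change. -/
def Prog.wr : Prog → ℕ → Prop
  | .skip, _ => False
  | .const d _, i => i = d
  | .arith _ d _ _, i => i = d
  | .load d _ _, i => i = d
  | .store _ _ _, _ => False
  | .seq P Q, i => P.wr i ∨ Q.wr i
  | .cond _ P Q, i => P.wr i ∨ Q.wr i
  | .loop _ P, i => P.wr i

/-- The arrays that a program may change. -/
def Prog.st : Prog → ℕ → Prop
  | .store a _ _, i => i = a
  | .seq P Q, i => P.st i ∨ Q.st i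
  | .cond _ P Q, i => P.st i ∨ Q.st i
  | .loop _ P, i => P.st i
  | _, _ => False

theorem Exec.reg_eq {w : ℕ} {P : Prog} {s s' : State} {t : ℕ} (h : Exec w P s s' t) {i : ℕ}
    (hi : ¬ P.wr i) : s'.reg i = s.reg i := by
  induction h with
  | skip => rfl
  | const s d c h => simp [State.setReg, show i ≠ d from hi]
  | arith s o d x y h => simp [State.setReg, show i ≠ d from hi]
  | load s d a x => simp [State.setReg, show i ≠ d from hi]
  | store => rfl
  | seq _ _ ih ih' =>
    rw [Prog.wr, not_or] at hi
    exact (ih' hi.2).trans (ih hi.1)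
  | cond_true _ _ ih => exact ih fun h => hi (Or.inl h)
  | cond_false _ _ ih => exact ih fun h => hi (Or.inr h)
  | loop_true _ _ _ ih ih' => exact (ih' hi).trans (ih hi)
  | loop_false => rfl

theorem Exec.mem_eq {w : ℕ} {P : Prog} {s s' : State} {t : ℕ} (h : Exec w P s s' t) {i : ℕ}
    (hi : ¬ P.st i) : s'.mem i = s.mem i := by
  induction h with
  | skip => rfl
  | const s d c h => rfl
  | arith s o d x y h => rfl
  | load s d a x => rfl
  | store s a x y => simp [State.setMem, show i ≠ a from hi]
  | seq _ _ ih ih' =>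
    rw [Prog.st, not_or] at hi
    exact (ih' hi.2).trans (ih hi.1)
  | cond_true _ _ ih => exact ih fun h => hi (Or.inl h)
  | cond_false _ _ ih => exact ih fun h => hi (Or.inr h)
  | loop_true _ _ _ ih ih' => exact (ih' hi).trans (ih hi)
  | loop_false => rfl

theorem Ex.wr_code (e : Ex) : ∀ {d i : ℕ}, (e.code d).wr i → d ≤ i := by
  induction e with
  | var x => rintro d i (h | h) <;> exact h.ge
  | lit c => exact fun h => h.ge
  | op o a b iha ihb =>
    rintro d i (h | h | h)
    · exact iha h
    · have := ihb h; omega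
    · exact h.ge
  | get a j ih =>
    rintro d i (h | h)
    · exact ih h
    · exact h.ge

theorem Ex.st_code (e : Ex) : ∀ {d i : ℕ}, ¬ (e.code d).st i := by
  induction e with
  | var x => rintro d i (h | h) <;> exact h
  | lit c => exact fun h => h
  | op o a b iha ihb =>
    rintro d i (h | h | h)
    · exact iha h
    · exact ihb h
    · exact h
  | get a j ih =>
    rintro d i (h | h)
    · exact ih h
    · exact h

theorem Stmt.wr_setCode {x y : Var} {e : Ex} (h : (setCode x e).wr y.num) : y = x := by
  have hy := y.num_lt
  rcases h with h | h | h
  · have := Ex.wr_code _ h; omega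
  · have : y.num = tempBase + 1 := h
    omega
  · exact Var.num_injective h

theorem Stmt.st_setCode {x : Var} {e : Ex} {i : ℕ} : ¬ (setCode x e).st i := by
  rintro (h | h | h)
  · exact Ex.st_code _ h
  · exact h
  · exact h

theorem Stmt.wr_code {S : Stmt} {y : Var} (h : S.code.wr y.num) : S.wr y = true := by
  have hy := y.num_lt
  have hx : ∀ {e : Ex} {d : ℕ}, tempBase ≤ d → ¬ (e.code d).wr y.num := fun hd h => by
    have := Ex.wr_code _ h; omega
  induction S with
  | skip => exact h.elim
  | set x e => exact decide_eq_true (wr_setCode h)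
  | put a i e =>
    rcases h with h | h | h
    · exact (hx le_rfl h).elim
    · exact (hx (Nat.le_succ _) h).elim
    · exact h.elim
  | seq S S' ih ih' => exact h.elim (fun h => by simp [wr, ih h]) fun h => by simp [wr, ih' h]
  | ite c S S' ih ih' =>
    rcases h with h | h | h
    · exact (hx le_rfl h).elim
    · simp [wr, ih h]
    · simp [wr, ih' h]
  | for_ x z S ih =>
    rcases h with h | h | h | h | h
    · simp [wr, wr_setCode h]
    · exact (hx le_rfl h).elim
    · simp [wr, ih h]
    · simp [wr, wr_setCode h]
    · exact (hx le_rfl h).elim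

theorem Stmt.st_code {S : Stmt} {b : Arr} (h : S.code.st b.num) : S.st b = true := by
  induction S with
  | skip => exact h.elim
  | set x e => exact (st_setCode h).elim
  | put a i e =>
    rcases h with h | h | h
    · exact (Ex.st_code _ h).elim
    · exact (Ex.st_code _ h).elim
    · exact decide_eq_true (Arr.num_injective h)
  | seq S S' ih ih' => exact h.elim (fun h => by simp [st, ih h]) fun h => by simp [st, ih' h]
  | ite c S S' ih ih' =>
    rcases h with h | h | h
    · exact (Ex.st_code _ h).elim
    · simp [st, ih h]
    · simp [st, ih' h]
  | for_ x z S ih =>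
    rcases h with h | h | h | h | h
    · exact (st_setCode h).elim
    · exact (Ex.st_code _ h).elim
    · simp [st, ih h]
    · exact (st_setCode h).elim
    · exact (Ex.st_code _ h).elim

/-- A statement leaves alone what it does not mention, already on the machine. Since `wr` and `st`
are computable, the frame conditions for concrete statements hold by `rfl`. -/
theorem Exec.same {w : ℕ} {S : Stmt} {s s' : State} {σ σ' : HState} {t : ℕ}
    (h : Exec w S.code s s' t) (hs : Sim w s σ) (hs' : Sim w s' σ') : Same S σ σ' where
  reg x hx := by
    rw [← hs.reg, ← hs'.reg]
    exact h.reg_eq fun hc => by simp [Stmt.wr_code hc] at hx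
  mem a ha := by
    rw [← hs.mem, ← hs'.mem]
    exact h.mem_eq fun hc => by simp [Stmt.st_code hc] at ha

/-! ### Sequencing with a frame, and the rule for counting loops -/

namespace Run

variable {w : ℕ} {S S' : Stmt} {σ : HState} {t t' : ℕ} {Q Q' : HState → Prop}

theorem frame (h : Run w S σ t Q) : Run w S σ t (fun σ' => Same S σ σ' ∧ Q σ') := by
  intro s hs
  obtain ⟨s', σ', u, h1, h2, h3, h4⟩ := h s hs
  exact ⟨s', σ', u, h1, h2, h3, h1.same hs h3, h4⟩

theorem andThen (h : Run w S σ t Q)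
    (h' : ∀ σ', Same S σ σ' → Q σ' → Run w S' σ' t' Q') : Run w (S ;; S') σ (t + t') Q' :=
  seq (h.frame.mono le_rfl fun σ' hq => h' σ' hq.1 hq.2)

theorem ofLoop {x y : Var} {L : ℕ} (hw : 1 < 2 ^ w) (hxy : y ≠ x) (hL : σ.reg y = L)
    (hx : S.wr x = false) (hy : S.wr y = false) (I : ℕ → HState → Prop)
    (h0 : I 0 (σ.setReg x 0))
    (hb : ∀ i < L, ∀ σ₁, Same (.for_ x y S) σ σ₁ → σ₁.reg x = i → I i σ₁ →
      Run w S σ₁ t (fun σ₂ => I (i + 1) (σ₂.setReg x (i + 1)))) :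
    Run w (.for_ x y S) σ (9 + L * (t + 12)) (I L) := by
  have key : ∀ j i, i + j = L → ∀ s₁ σ₁, Sim w s₁ σ₁ → Same (.for_ x y S) σ σ₁ → σ₁.reg x = i →
      I i σ₁ → s₁.reg tempBase = (if i < L then 1 else 0) → ∃ s' σ' t', Exec w
        (.loop tempBase (.seq S.code (.seq (Stmt.setCode x (x + 1))
          ((Ex.lt x y).code tempBase)))) s₁ s' t' ∧ t' ≤ 1 + j * (t + 12) ∧ Sim w s' σ' ∧
          I L σ' := by
    intro j
    induction j with
    | zero =>
      intro i hi s₁ σ₁ h₁ _ _ hI hc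
      obtain rfl : i = L := by omega
      exact ⟨s₁, σ₁, 1, .loop_false (by simpa using hc), by omega, h₁, hI⟩
    | succ j ih =>
      intro i hi s₁ σ₁ h₁ hs hr hI hc
      have hiL : i < L := by omega
      obtain ⟨s₂, σ₂, t₂, e₂, l₂, h₂, hs₂, q₂⟩ := (hb i hiL σ₁ hs hr hI).frame s₁ h₁
      have hyr : σ₂.reg y = L := by
        rw [hs₂.reg y hy, hs.reg y (by simp [Stmt.wr, hxy, hy]), hL]
      have hxr : σ₂.reg x = i := by rw [hs₂.reg x hx, hr]
      -- The incremented counter is at most the bound in `y`, which is a word, so the increment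
      -- cannot overflow.
      have hlt : i + 1 < 2 ^ w := by have := h₂.reg_lt y; omega
      have hset : Run w (.set x (x + 1)) σ₂ 6 (fun σ₃ => σ₃ = σ₂.setReg x (i + 1)) :=
        of_set (by simp [hxr, hlt, hw]) (by simp [hxr])
      obtain ⟨s₃, σ₃, t₃, e₃, l₃, h₃, rfl⟩ := hset s₂ h₂
      have hcok : (Ex.lt x y).ok (2 ^ w) (σ₂.setReg x (i + 1)) := by
        rw [Ex.ok_lt _ _ _ _ hw]; simp
      obtain ⟨s₄, e₄, h₄, v₄, -⟩ := (Ex.lt x y).exec_code h₃ hcok le_rfl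
      have hs₄ : Same (.for_ x y S) σ (σ₂.setReg x (i + 1)) := by
        constructor
        · intro z hz
          have hz' : z ≠ x ∧ S.wr z = false := by simpa [Stmt.wr] using hz
          simp only [HState.reg_setReg, hz'.1, if_false]
          rw [hs₂.reg z hz'.2, hs.reg z hz]
        · intro a ha
          have ha' : S.st a = false := ha
          rw [HState.mem_setReg, hs₂.mem a ha', hs.mem a ha]
      obtain ⟨s₅, σ₅, t₅, e₅, l₅, h₅, q₅⟩ := ih (i + 1) (by omega) s₄ _ h₄ hs₄ (by simp) q₂
        (by rw [v₄]; simp [hxy, hyr])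
      refine ⟨s₅, σ₅, _, .loop_true (by simp [hc, hiL]) (.seq e₂ (.seq e₃ e₄)) e₅, ?_, h₅, q₅⟩
      have hcost : (Ex.lt x y).cost = 5 := rfl
      have : (j + 1) * (t + 12) = j * (t + 12) + t + 12 := by ring
      omega
  intro s hs
  have hset : Run w (.set x (.lit 0)) σ 3 (fun σ₃ => σ₃ = σ.setReg x 0) :=
    of_set (by simp) rfl
  obtain ⟨s₃, σ₃, t₃, e₃, l₃, h₃, rfl⟩ := hset s hs
  have hcok : (Ex.lt x y).ok (2 ^ w) (σ.setReg x 0) := by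
    rw [Ex.ok_lt _ _ _ _ hw]; simp
  obtain ⟨s₄, e₄, h₄, v₄, -⟩ := (Ex.lt x y).exec_code h₃ hcok le_rfl
  have hs₄ : Same (.for_ x y S) σ (σ.setReg x 0) := by
    constructor
    · intro z hz
      have hz' : z ≠ x ∧ S.wr z = false := by simpa [Stmt.wr] using hz
      simp [hz'.1]
    · intro a ha
      simp
  obtain ⟨s₅, σ₅, t₅, e₅, l₅, h₅, q₅⟩ := key L 0 (by omega) s₄ _ h₄ hs₄ (by simp) h0
    (by rw [v₄]; simp [hxy, hL])
  refine ⟨s₅, σ₅, _, .seq e₃ (.seq e₄ e₅), ?_, h₅, q₅⟩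
  have hcost : (Ex.lt x y).cost = 5 := rfl
  omega

end Run

end WordRAM

/-! ### Mixed radix numbers as codes of states -/

namespace TopDP

/-- The weight of digit `i` in the mixed radix system with radices `rad`. -/
def weight (rad : ℕ → ℕ) : ℕ → ℕ
  | 0 => 1
  | i + 1 => weight rad i * rad i

/-- Digit `i` of `c` in the mixed radix system with radices `rad`. -/
def digit (rad : ℕ → ℕ) (c i : ℕ) : ℕ := c / weight rad i % rad i

section
variable {rad : ℕ → ℕ}

theorem weight_pos (hr : ∀ i, 0 < rad i) (i : ℕ) : 0 < weight rad i := by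
  induction i with
  | zero => exact Nat.one_pos
  | succ i ih => exact Nat.mul_pos ih (hr i)

theorem weight_dvd {i j : ℕ} (h : i ≤ j) : weight rad i ∣ weight rad j := by
  induction j, h using Nat.le_induction with
  | base => exact dvd_rfl
  | succ j _ ih => exact ih.mul_right _

theorem weight_mono (hr : ∀ i, 0 < rad i) {i j : ℕ} (h : i ≤ j) : weight rad i ≤ weight rad j :=
  Nat.le_of_dvd (weight_pos hr j) (weight_dvd h)

/-- There is no carry: digit `i` has room for `x`, so everything above it stays as it is. -/
theorem add_mul_weight_div (hr : ∀ i, 0 < rad i) {c i x : ℕ} (hx : digit rad c i + x < rad i)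
    {j : ℕ} (hj : i < j) : (c + x * weight rad i) / weight rad j = c / weight rad j := by
  obtain ⟨q, hq⟩ := weight_dvd (rad := rad) hj
  have hw := weight_pos hr i
  rw [hq, weight, ← Nat.div_div_eq_div_mul, ← Nat.div_div_eq_div_mul, ← Nat.div_div_eq_div_mul,
    ← Nat.div_div_eq_div_mul, Nat.add_mul_div_right _ _ hw]
  congr 1
  unfold digit at hx
  generalize c / weight rad i = a at *
  have h1 := Nat.div_add_mod a (rad i)
  rw [show a + x = (a % rad i + x) + rad i * (a / rad i) by omega,
    Nat.add_mul_div_left _ _ (hr i), Nat.div_eq_of_lt hx, Nat.zero_add]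

theorem digit_add (hr : ∀ i, 0 < rad i) {c i x : ℕ} (hx : digit rad c i + x < rad i) (j : ℕ) :
    digit rad (c + x * weight rad i) j = if j = i then digit rad c i + x else digit rad c j := by
  have hw := weight_pos hr i
  split_ifs with hj
  · subst hj
    unfold digit at hx ⊢
    rw [Nat.add_mul_div_right _ _ hw, ← Nat.mod_add_mod, Nat.mod_eq_of_lt hx]
  · rcases Nat.lt_or_gt_of_ne hj with h | h
    · obtain ⟨q, hq⟩ := weight_dvd (rad := rad) h
      unfold digit
      rw [hq, weight, show c + x * (weight rad j * rad j * q) =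
        c + weight rad j * (rad j * (q * x)) by ring, Nat.add_mul_div_left _ _ (weight_pos hr j),
        Nat.add_mul_mod_self_left]
    · unfold digit
      rw [add_mul_weight_div hr hx h]

theorem add_mul_weight_lt (hr : ∀ i, 0 < rad i) {c i x D : ℕ} (hx : digit rad c i + x < rad i)
    (hi : i < D) (hc : c < weight rad D) : c + x * weight rad i < weight rad D := by
  have := add_mul_weight_div hr hx hi
  rw [Nat.div_eq_of_lt hc] at this
  exact (Nat.div_eq_zero_iff_lt (weight_pos hr D)).1 this

theorem mul_weight_le {c i y : ℕ} (hr : ∀ i, 0 < rad i) (hy : y ≤ digit rad c i) :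
    y * weight rad i ≤ c :=
  (Nat.le_div_iff_mul_le (weight_pos hr i)).1 (hy.trans (Nat.mod_le _ _))

/-- Subtraction without borrow undoes addition without carry. Once digit `i` is known, `digit_add`
applied to the difference gives all the other digits. -/
theorem digit_sub (hr : ∀ i, 0 < rad i) {c i y : ℕ} (hy : y ≤ digit rad c i) (j : ℕ) :
    digit rad (c - y * weight rad i) j = if j = i then digit rad c i - y else digit rad c j := by
  have hle := mul_weight_le hr hy
  have h0 : digit rad (c - y * weight rad i) i = digit rad c i - y := by
    unfold digit at hy ⊢
    rw [Nat.mul_comm, Nat.sub_mul_div_of_le]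
    · generalize c / weight rad i = a at *
      have h1 := Nat.div_add_mod a (rad i)
      have h2 := Nat.mod_lt a (hr i)
      rw [show a - y = (a % rad i - y) + rad i * (a / rad i) by omega, Nat.add_mul_mod_self_left,
        Nat.mod_eq_of_lt (by omega)]
    · rwa [Nat.mul_comm]
  have hlt : digit rad (c - y * weight rad i) i + y < rad i := by
    rw [h0, Nat.sub_add_cancel hy]
    exact Nat.mod_lt _ (hr i)
  have key := digit_add hr hlt j
  rw [Nat.sub_add_cancel hle] at key
  split_ifs at key ⊢ with hj
  · rw [hj, h0]
  · exact key.symm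

theorem eq_of_digit_eq {c c' D : ℕ} (hc : c < weight rad D) (hc' : c' < weight rad D)
    (h : ∀ i < D, digit rad c i = digit rad c' i) : c = c' := by
  have key : ∀ i ≤ D, c % weight rad i = c' % weight rad i := by
    intro i
    induction i with
    | zero => simp [weight, Nat.mod_one]
    | succ i ih =>
      intro hi
      rw [weight, Nat.mod_mul, Nat.mod_mul, ih (by omega)]
      have := h i (by omega)
      unfold digit at this
      rw [this]
  have := key D le_rfl
  rwa [Nat.mod_eq_of_lt hc, Nat.mod_eq_of_lt hc'] at this

theorem digit_zero_left (i : ℕ) : digit rad 0 i = 0 := by simp [digit]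

end

/-- The digits of a state of the dynamic programme: for an arc `e` of the pattern graph, whether an
arc leaving the image of its tail is chosen (`start`), whether an arc entering the image of its head
is chosen or promised (`fin`), and whether an arc from a future vertex to a forgotten one is promised
(`pend`); for a vertex `h` of the pattern graph, whether its image is known (`placed`); for a slot of
the current bag, its label (`lab`), and, if the label is an arc, whether an arc that enters or leaves
the vertex is chosen (`inn`, `out`). -/
inductive Ix (k l m : ℕ)
  | start (e : Fin l)
  | fin (e : Fin l)
  | placed (h : Fin k)
  | pend (e : Fin l)
  | inn (s : Fin m)
  | out (s : Fin m)
  | lab (s : Fin m)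
  deriving DecidableEq

variable {k l m : ℕ}

/-- The number of the binary digits. -/
def numBits (k l m : ℕ) : ℕ := 3 * l + k + 2 * m

/-- The position of a digit. -/
def Ix.num : Ix k l m → ℕ
  | start e => e
  | fin e => l + e
  | placed h => 2 * l + h
  | pend e => 2 * l + k + e
  | inn s => 3 * l + k + s
  | out s => 3 * l + k + m + s
  | lab s => 3 * l + k + 2 * m + s

/-- The radices of the digits. -/
def radix (k l m i : ℕ) : ℕ := if i < numBits k l m then 2 else k + l + 1

theorem radix_pos (i : ℕ) : 0 < radix k l m i := by
  unfold radix; split_ifs <;> omega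

theorem Ix.num_injective : Function.Injective (Ix.num : Ix k l m → ℕ) := by
  intro a b h
  cases a <;> cases b <;> simp only [Ix.num] at h <;> first
    | (congr 1; apply Fin.ext; omega)
    | (exfalso; omega)

theorem Ix.num_lt (a : Ix k l m) : a.num < numBits k l m + m := by
  unfold numBits
  cases a <;> simp only [Ix.num] <;> omega

theorem Ix.exists_num {i : ℕ} (hi : i < numBits k l m + m) : ∃ a : Ix k l m, a.num = i := by
  unfold numBits at hi
  by_cases h1 : i < l
  · exact ⟨start ⟨i, h1⟩, rfl⟩
  by_cases h2 : i < 2 * l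
  · exact ⟨fin ⟨i - l, by omega⟩, by simp only [num]; omega⟩
  by_cases h3 : i < 2 * l + k
  · exact ⟨placed ⟨i - 2 * l, by omega⟩, by simp only [num]; omega⟩
  by_cases h4 : i < 3 * l + k
  · exact ⟨pend ⟨i - (2 * l + k), by omega⟩, by simp only [num]; omega⟩
  by_cases h5 : i < 3 * l + k + m
  · exact ⟨inn ⟨i - (3 * l + k), by omega⟩, by simp only [num]; omega⟩
  by_cases h6 : i < 3 * l + k + 2 * m
  · exact ⟨out ⟨i - (3 * l + k + m), by omega⟩, by simp only [num]; omega⟩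
  · exact ⟨lab ⟨i - (3 * l + k + 2 * m), by omega⟩, by simp only [num]; omega⟩

/-- The weight of a digit. -/
def Ix.weight (a : Ix k l m) : ℕ := TopDP.weight (radix k l m) a.num

/-- The number of the codes of states. -/
def numCodes (k l m : ℕ) : ℕ := weight (radix k l m) (numBits k l m + m)

/-- The radix of a digit. -/
def Ix.rad (a : Ix k l m) : ℕ := radix k l m a.num

@[simp] theorem Ix.rad_start (e : Fin l) : (start e : Ix k l m).rad = 2 :=
  if_pos (by simp only [num, numBits]; omega)
@[simp] theorem Ix.rad_fin (e : Fin l) : (fin e : Ix k l m).rad = 2 :=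
  if_pos (by simp only [num, numBits]; omega)
@[simp] theorem Ix.rad_placed (h : Fin k) : (placed h : Ix k l m).rad = 2 :=
  if_pos (by simp only [num, numBits]; omega)
@[simp] theorem Ix.rad_pend (e : Fin l) : (pend e : Ix k l m).rad = 2 :=
  if_pos (by simp only [num, numBits]; omega)
@[simp] theorem Ix.rad_inn (s : Fin m) : (inn s : Ix k l m).rad = 2 :=
  if_pos (by simp only [num, numBits]; omega)
@[simp] theorem Ix.rad_out (s : Fin m) : (out s : Ix k l m).rad = 2 :=
  if_pos (by simp only [num, numBits]; omega)
@[simp] theorem Ix.rad_lab (s : Fin m) : (lab s : Ix k l m).rad = k + l + 1 :=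
  if_neg (by simp only [num, numBits]; omega)

/-- A state of the dynamic programme. -/
abbrev DState (k l m : ℕ) := Ix k l m → ℕ

/-- The state with code `c`. -/
def view (k l m c : ℕ) : DState k l m := fun a => digit (radix k l m) c a.num

theorem view_apply (c : ℕ) (a : Ix k l m) : view k l m c a = c / a.weight % a.rad := rfl

theorem view_zero : view k l m 0 = fun _ => 0 := by
  funext a; exact digit_zero_left _

theorem view_lt (c : ℕ) (a : Ix k l m) : view k l m c a < a.rad := Nat.mod_lt _ (radix_pos _)

theorem view_injOn {c c' : ℕ} (hc : c < numCodes k l m) (hc' : c' < numCodes k l m)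
    (h : view k l m c = view k l m c') : c = c' := by
  refine eq_of_digit_eq hc hc' fun i hi => ?_
  obtain ⟨a, rfl⟩ := Ix.exists_num hi
  exact congrFun h a

theorem view_add {c x : ℕ} {a : Ix k l m} (h : view k l m c a + x < a.rad) :
    view k l m (c + x * a.weight) = Function.update (view k l m c) a (view k l m c a + x) := by
  funext b
  rw [Function.update_apply]
  refine (digit_add radix_pos h b.num).trans ?_
  simp only [Ix.num_injective.eq_iff]
  rfl

theorem add_lt_numCodes {c x : ℕ} {a : Ix k l m} (h : view k l m c a + x < a.rad)
    (hc : c < numCodes k l m) : c + x * a.weight < numCodes k l m :=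
  add_mul_weight_lt radix_pos h a.num_lt hc

theorem view_sub {c y : ℕ} {a : Ix k l m} (h : y ≤ view k l m c a) :
    view k l m (c - y * a.weight) = Function.update (view k l m c) a (view k l m c a - y) := by
  funext b
  rw [Function.update_apply]
  refine (digit_sub radix_pos h b.num).trans ?_
  simp only [Ix.num_injective.eq_iff]
  rfl

theorem mul_weight_le_of_le_view {c y : ℕ} {a : Ix k l m} (h : y ≤ view k l m c a) :
    y * a.weight ≤ c := mul_weight_le radix_pos h

theorem mul_weight_lt_numCodes {x : ℕ} {a : Ix k l m} (h : x < a.rad) :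
    x * a.weight < numCodes k l m := by
  have := add_lt_numCodes (c := 0) (x := x) (a := a) (by simpa [view_zero] using h)
    (weight_pos radix_pos _)
  simpa using this

theorem weight_radix_eq_two_pow {i : ℕ} (hi : i ≤ numBits k l m) :
    weight (radix k l m) i = 2 ^ i := by
  induction i with
  | zero => rfl
  | succ i ih => rw [weight, ih (by omega), radix, if_pos (by omega), pow_succ]

theorem numCodes_eq : numCodes k l m = 2 ^ numBits k l m * (k + l + 1) ^ m := by
  have : ∀ j, weight (radix k l m) (numBits k l m + j) =
      2 ^ numBits k l m * (k + l + 1) ^ j := by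
    intro j
    induction j with
    | zero => simp [weight_radix_eq_two_pow]
    | succ j ih =>
      rw [← Nat.add_assoc, weight, ih, radix, if_neg (by omega), pow_succ, Nat.mul_assoc]
  exact this m

/-- The accepting code has the digits `start`, `fin` and `placed` equal to one. -/
theorem view_two_pow_sub_one (a : Ix k l m) : view k l m (2 ^ (2 * l + k) - 1) a =
    match a with
    | .start _ => 1 | .fin _ => 1 | .placed _ => 1 | _ => 0 := by
  have key : ∀ i, digit (radix k l m) (2 ^ (2 * l + k) - 1) i = if i < 2 * l + k then 1 else 0 := by
    intro i
    split_ifs with hi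
    · have hb : i < numBits k l m := by unfold numBits; omega
      rw [digit, weight_radix_eq_two_pow hb.le, radix, if_pos hb]
      -- The digits `start`, `fin` and `placed` occupy the lowest 2l + k positions and are binary,
      -- so here digits are ordinary bits.
      have := Nat.testBit_two_pow_sub_one (2 * l + k) i
      rw [Nat.testBit_eq_decide_div_mod_eq] at this
      simpa [hi] using this
    · rw [digit, Nat.div_eq_of_lt, Nat.zero_mod]
      have h1 : weight (radix k l m) (2 * l + k) ≤ weight (radix k l m) i :=
        weight_mono radix_pos (by omega)
      rw [weight_radix_eq_two_pow (by unfold numBits; omega)] at h1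
      have := Nat.two_pow_pos (2 * l + k)
      omega
  have h := key a.num
  cases a <;> simp only [Ix.num] at h <;> refine h.trans ?_ <;> first
    | exact if_pos (by omega)
    | exact if_neg (by omega)

theorem two_pow_sub_one_lt_numCodes : 2 ^ (2 * l + k) - 1 < numCodes k l m := by
  have h1 : weight (radix k l m) (2 * l + k) ≤ numCodes k l m :=
    weight_mono radix_pos (by unfold numBits; omega)
  rw [weight_radix_eq_two_pow (by unfold numBits; omega)] at h1
  have := Nat.two_pow_pos (2 * l + k)
  omega

end TopDP

/-! ### Moves between states, and their soundness -/

namespace TopDP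

variable {k l m n : ℕ}

/-- A vertex with label `x` may be the tail of an arc of the path of `e`. -/
def OutLabel (arc : Fin l → Fin k × Fin k) (e : Fin l) (x : ℕ) : Prop :=
  x = e + 1 ∨ x = l + 1 + (arc e).1

/-- A vertex with label `x` may be the head of an arc of the path of `e`. -/
def InLabel (arc : Fin l → Fin k × Fin k) (e : Fin l) (x : ℕ) : Prop :=
  x = e + 1 ∨ x = l + 1 + (arc e).2

/-- Digit `i` records an arc of the path of `e` that leaves the vertex in slot `s`. -/
def OutAt (arc : Fin l → Fin k × Fin k) (d : DState k l m) (s : Fin m) (e : Fin l)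
    (i : Ix k l m) : Prop :=
  d (.lab s) = e + 1 ∧ i = .out s ∨ d (.lab s) = l + 1 + (arc e).1 ∧ i = .start e

/-- Digit `j` records an arc of the path of `e` that enters the vertex in slot `s`. -/
def InAt (arc : Fin l → Fin k × Fin k) (d : DState k l m) (s : Fin m) (e : Fin l)
    (j : Ix k l m) : Prop :=
  d (.lab s) = e + 1 ∧ j = .inn s ∨ d (.lab s) = l + 1 + (arc e).2 ∧ j = .fin e

open Function in
/-- The arc from the vertex in slot `s` to the vertex in slot `s'` is added to the path of `e`. -/
def ArcMove (arc : Fin l → Fin k × Fin k) (s s' : Fin m) (e : Fin l) (d d' : DState k l m) : Prop :=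
  ∃ i j, OutAt arc d s e i ∧ InAt arc d s' e j ∧ d i = 0 ∧ d j = 0 ∧
    d' = update (update d i 1) j 1

open Function in
/-- An arc from the vertex in slot `s` to a forgotten vertex is added to the path of `e`. -/
def TakeMove (arc : Fin l → Fin k × Fin k) (s : Fin m) (e : Fin l) (d d' : DState k l m) : Prop :=
  ∃ i, OutAt arc d s e i ∧ d i = 0 ∧ d (.pend e) ≠ 0 ∧ d' = update (update d i 1) (.pend e) 0

open Function in
/-- The vertex in slot `s`, which is to be forgotten, shall be entered from a future vertex. -/
def LeaveMove (arc : Fin l → Fin k × Fin k) (s : Fin m) (e : Fin l) (d d' : DState k l m) : Prop :=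
  ∃ j, InAt arc d s e j ∧ d j = 0 ∧ d (.pend e) = 0 ∧ d' = update (update d j 1) (.pend e) 1

open Function in
/-- The vertex in slot `s` gets the label `x`. -/
def LabelMove (s : Fin m) (x : ℕ) (d d' : DState k l m) : Prop :=
  d (.lab s) = 0 ∧ (x ≤ l ∧ d' = update d (.lab s) x ∨
    ∃ h : Fin k, x = l + 1 + h ∧ d (.placed h) = 0 ∧
      d' = update (update d (.lab s) x) (.placed h) 1)

open Function in
/-- The vertex in slot `s` is forgotten. -/
def ClearMove (s : Fin m) (d d' : DState k l m) : Prop :=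
  (d (.lab s) = 0 ∨ l < d (.lab s) ∨ d (.out s) ≠ 0) ∧
    d' = update (update (update d (.lab s) 0) (.inn s) 0) (.out s) 0

/-- A set of states is extended by the results of moves. -/
def addMoves (R : DState k l m → DState k l m → Prop) (S : Set (DState k l m)) :
    Set (DState k l m) := S ∪ {d' | ∃ d ∈ S, R d d'}

/-- A set of states is replaced by the results of moves. -/
def applyMoves (R : DState k l m → DState k l m → Prop) (S : Set (DState k l m)) :
    Set (DState k l m) := {d' | ∃ d ∈ S, R d d'}

/-- The slots hold distinct vertices, and none of them is forgotten. -/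
structure SlotsOK (F : Set (Fin n)) (sl : Fin m → Option (Fin n)) : Prop where
  inj : ∀ s s' v, sl s = some v → sl s' = some v → s = s'
  disj : ∀ s v, sl s = some v → v ∉ F

/-- `v` is in `F` or in a slot. -/
def Seen (F : Set (Fin n)) (sl : Fin m → Option (Fin n)) (v : Fin n) : Prop :=
  v ∈ F ∨ ∃ s, sl s = some v

/-- `lab` and `M` are a partial solution with state `d`. The set of the forgotten vertices is `F`; arcs
from the future may be promised to vertices of `L`. -/
structure PartialSol (arc : Fin l → Fin k × Fin k) (T : Digraph (Fin n)) (F L : Set (Fin n))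
    (sl : Fin m → Option (Fin n)) (d : DState k l m) (lab : Fin n → ℕ)
    (M : Fin l → Fin n → Fin n → Prop) : Prop where
  lab_zero : ∀ v, v ∉ F → (∀ s, sl s ≠ some v) → lab v = 0
  slot : ∀ s v, sl s = some v → d (.lab s) = lab v
  empty : ∀ s, sl s = none → d (.lab s) = 0
  zero : ∀ s, d (.lab s) = 0 → d (.inn s) = 0 ∧ d (.out s) = 0
  adj : ∀ e u w, M e u w → T.Adj u w ∧ OutLabel arc e (lab u) ∧ InLabel arc e (lab w)
  inj : ∀ e u u' w, M e u w → M e u' w → u = u'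
  uniq : ∀ u w, lab u = lab w → l < lab u → u = w
  not_placed : ∀ h, d (.placed h) = 0 → ∀ v, lab v ≠ l + 1 + h
  placed : ∀ h, d (.placed h) ≠ 0 → ∃ v, lab v = l + 1 + h
  outF : ∀ v ∈ F, ∀ e : Fin l, lab v = e + 1 → ∃ w, M e v w
  outS : ∀ s v, sl s = some v → ∀ e : Fin l, lab v = e + 1 → d (.out s) ≠ 0 → ∃ w, M e v w
  start : ∀ e, d (.start e) ≠ 0 → ∃ v w, lab v = l + 1 + (arc e).1 ∧ M e v w
  inn : ∀ s v, sl s = some v → ∀ e : Fin l, lab v = e + 1 → d (.inn s) = 0 → ∀ u, ¬ M e u v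
  fin : ∀ e, d (.fin e) = 0 → ∀ v, lab v = l + 1 + (arc e).2 → ∀ u, ¬ M e u v
  pend : ∀ e, d (.pend e) ≠ 0 → ∃ x ∈ L, InLabel arc e (lab x) ∧ (∀ u, ¬ M e u x) ∧
    (lab x = l + 1 + (arc e).2 → d (.fin e) ≠ 0)

/-- All states of `S` have partial solutions. -/
def Sound (arc : Fin l → Fin k × Fin k) (T : Digraph (Fin n)) (F L : Set (Fin n))
    (sl : Fin m → Option (Fin n)) (S : Set (DState k l m)) : Prop :=
  ∀ d ∈ S, ∃ lab M, PartialSol arc T F L sl d lab M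

namespace PartialSol

variable {arc : Fin l → Fin k × Fin k} {T : Digraph (Fin n)} {F L : Set (Fin n)}
  {sl : Fin m → Option (Fin n)} {d d' : DState k l m} {lab : Fin n → ℕ}
  {M : Fin l → Fin n → Fin n → Prop}

/-- The set `L` of possible targets of promises is kept apart from `F` because a vertex about to be
forgotten may already receive a promise while it is still in its slot. -/
theorem mono_right (h : PartialSol arc T F L sl d lab M) {L' : Set (Fin n)} (hL : L ⊆ L') :
    PartialSol arc T F L' sl d lab M :=
  { h with pend := fun e he => by obtain ⟨x, hx, h'⟩ := h.pend e he; exact ⟨x, hL hx, h'⟩ }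

/-- Nothing has to change: an unseen vertex has label 0, which is also the digit of an empty slot.
-/
theorem open_slot (h : PartialSol arc T F L sl d lab M) {q : Fin m} {v : Fin n}
    (hq : sl q = none) (hv : ¬ Seen F sl v) :
    PartialSol arc T F L (Function.update sl q (some v)) d lab M := by
  have hlv : lab v = 0 := h.lab_zero v (fun hF => hv (Or.inl hF)) fun s hs => hv (Or.inr ⟨s, hs⟩)
  have he := h.empty q hq
  refine { h with lab_zero := ?_, slot := ?_, empty := ?_, outS := ?_, inn := ?_ }
  · intro u hu hs
    refine h.lab_zero u hu fun s hsu => ?_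
    have hsq : s ≠ q := by rintro rfl; simp [hq] at hsu
    exact hs s (by simpa [hsq] using hsu)
  · intro s u hs
    by_cases hsq : s = q
    · subst hsq
      obtain rfl : v = u := by simpa using hs
      rw [he, hlv]
    · exact h.slot s u (by simpa [hsq] using hs)
  · intro s hs
    by_cases hsq : s = q
    · simp [hsq] at hs
    · exact h.empty s (by simpa [hsq] using hs)
  · intro s u hs e hu
    by_cases hsq : s = q
    · subst hsq
      obtain rfl : v = u := by simpa using hs
      omega
    · exact h.outS s u (by simpa [hsq] using hs) e hu
  · intro s u hs e hu
    by_cases hsq : s = q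
    · subst hsq
      obtain rfl : v = u := by simpa using hs
      omega
    · exact h.inn s u (by simpa [hsq] using hs) e hu

theorem arcMove (h : PartialSol arc T F F sl d lab M) (hF : SlotsOK F sl) {s s' : Fin m}
    {e : Fin l} {u w : Fin n} (hs : sl s = some u) (hs' : sl s' = some w) (ha : T.Adj u w)
    (hm : ArcMove arc s s' e d d') :
    PartialSol arc T F F sl d' lab (fun e' a b => M e' a b ∨ e' = e ∧ a = u ∧ b = w) := by
  obtain ⟨i, j, hi, hj, hi0, hj0, rfl⟩ := hm
  have hu := h.slot s u hs
  have hw := h.slot s' w hs'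
  -- The digit for incoming arcs is zero, which certifies that `w` has not been entered yet. This
  -- keeps incoming arcs unique.
  have hin : ∀ a, ¬ M e a w := by
    rcases hj with ⟨h1, rfl⟩ | ⟨h1, rfl⟩
    · exact h.inn s' w hs' e (by omega) hj0
    · exact h.fin e hj0 w (by omega)
  have h1 := h.zero
  have h2 := hF.inj
  have h3 := hF.disj
  constructor
  · exact h.lab_zero
  · have := h.slot; unfold OutAt InAt at *; grind
  · have := h.empty; unfold OutAt InAt at *; grind
  · have := h.zero; unfold OutAt InAt at *; grind
  · have := h.adj; unfold OutAt InAt OutLabel InLabel at *; grind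
  · have := h.inj; grind
  · exact h.uniq
  · have := h.not_placed; unfold OutAt InAt at *; grind
  · have := h.placed; unfold OutAt InAt at *; grind
  · have := h.outF; grind
  · have := h.outS; unfold OutAt InAt at *; grind
  · have := h.start; unfold OutAt InAt at *; grind
  · have := h.inn; unfold OutAt InAt at *; grind
  · have := h.fin; have := h.uniq; unfold OutAt InAt at *; grind
  · have := h.pend; unfold OutAt InAt at *; grind

/-- The state does not tell which forgotten vertex is waiting. The partial solution supplies one,
and `u` is adjacent to it because it is adjacent to all of `F`. -/
theorem takeMove (h : PartialSol arc T F F sl d lab M) (hF : SlotsOK F sl) {s : Fin m}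
    {e : Fin l} {u : Fin n} (hs : sl s = some u) (ha : ∀ x ∈ F, T.Adj u x)
    (hm : TakeMove arc s e d d') :
    ∃ M', PartialSol arc T F F sl d' lab M' := by
  obtain ⟨i, hi, hi0, hp, rfl⟩ := hm
  obtain ⟨x, hx, hxl, hxM, hxf⟩ := h.pend e hp
  refine ⟨fun e' a b => M e' a b ∨ e' = e ∧ a = u ∧ b = x, ?_⟩
  have hu := h.slot s u hs
  have h1 := h.zero
  have h2 := hF.inj
  have h3 := hF.disj
  constructor
  · exact h.lab_zero
  · have := h.slot; unfold OutAt at *; grind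
  · have := h.empty; unfold OutAt at *; grind
  · have := h.zero; unfold OutAt at *; grind
  · have := h.adj; unfold OutAt OutLabel at *; grind
  · have := h.inj; grind
  · exact h.uniq
  · have := h.not_placed; unfold OutAt at *; grind
  · have := h.placed; unfold OutAt at *; grind
  · have := h.outF; grind
  · have := h.outS; unfold OutAt at *; grind
  · have := h.start; unfold OutAt at *; grind
  · have := h.inn; unfold OutAt at *; grind
  -- If the waiting vertex is the image of the head of `e`, the last clause of `pend` says that `fin
  -- e` is already set, so the new arc does not contradict a zero digit.
  · have := h.fin; have := h.uniq; unfold OutAt at *; grind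
  · have := h.pend; unfold OutAt at *; grind

/-- No arc is added. The digit is set in advance, so that `v` cannot be entered in another way, and
`v` itself is the witness for the new promise. -/
theorem leaveMove (h : PartialSol arc T F L sl d lab M) {s : Fin m}
    {e : Fin l} {v : Fin n} (hs : sl s = some v) (hv : v ∈ L)
    (hm : LeaveMove arc s e d d') :
    PartialSol arc T F L sl d' lab M := by
  obtain ⟨j, hj, hj0, hp, rfl⟩ := hm
  have hu := h.slot s v hs
  have hin : ∀ a, ¬ M e a v := by
    rcases hj with ⟨h1, rfl⟩ | ⟨h1, rfl⟩
    · exact h.inn s v hs e (by omega) hj0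
    · exact h.fin e hj0 v (by omega)
  constructor
  · exact h.lab_zero
  · have := h.slot; unfold InAt at *; grind
  · have := h.empty; unfold InAt at *; grind
  · have := h.zero; unfold InAt at *; grind
  · exact h.adj
  · exact h.inj
  · exact h.uniq
  · have := h.not_placed; unfold InAt at *; grind
  · have := h.placed; unfold InAt at *; grind
  · exact h.outF
  · have := h.outS; unfold InAt at *; grind
  · have := h.start; unfold InAt at *; grind
  · have := h.inn; unfold InAt at *; grind
  · have := h.fin; unfold InAt at *; grind
  · have := h.pend; unfold InAt InLabel at *; grind

theorem labelMove (h : PartialSol arc T F F sl d lab M) (hF : SlotsOK F sl) {s : Fin m}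
    {x : ℕ} {v : Fin n} (hs : sl s = some v) (hm : LabelMove s x d d') :
    PartialSol arc T F F sl d' (Function.update lab v x) M := by
  obtain ⟨h0, hm⟩ := hm
  have hu := h.slot s v hs
  have h2 := hF.inj
  have h3 := hF.disj
  have h4 := h.zero s h0
  -- Both ends of a chosen arc have nonzero labels, so no chosen arc touches `v`, and relabelling
  -- `v` is harmless.
  have hM : ∀ e a b, M e a b → a ≠ v ∧ b ≠ v := by
    intro e a b hab
    have := h.adj e a b hab
    unfold OutLabel InLabel at this
    constructor <;> rintro rfl <;> omega
  rcases hm with ⟨hx, rfl⟩ | ⟨y, hx, hy, rfl⟩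
  · constructor
    · intro u hu hs'
      have : u ≠ v := by rintro rfl; exact hs' s hs
      rw [Function.update_of_ne this]
      exact h.lab_zero u hu hs'
    · have := h.slot; grind [Function.update_apply]
    · have := h.empty; grind [Function.update_apply]
    · have := h.zero; grind [Function.update_apply]
    · have := h.adj; grind [Function.update_apply]
    · exact h.inj
    · have := h.uniq; have := h.not_placed; grind [Function.update_apply]
    · have := h.not_placed; grind [Function.update_apply]
    · intro y hy
      obtain ⟨a, ha⟩ := h.placed y (by simpa using hy)
      have : a ≠ v := by rintro rfl; omega
      exact ⟨a, by simpa [this] using ha⟩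
    · have := h.outF; grind [Function.update_apply]
    · have := h.outS; grind [Function.update_apply]
    · have := h.start; grind [Function.update_apply]
    · have := h.inn; grind [Function.update_apply]
    · have := h.fin; grind [Function.update_apply]
    · have := h.pend; unfold InLabel at *; grind [Function.update_apply]
  · constructor
    · intro u hu hs'
      have : u ≠ v := by rintro rfl; exact hs' s hs
      rw [Function.update_of_ne this]
      exact h.lab_zero u hu hs'
    · have := h.slot; grind [Function.update_apply]
    · have := h.empty; grind [Function.update_apply]
    · have := h.zero; grind [Function.update_apply]
    · have := h.adj; grind [Function.update_apply]
    · exact h.inj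
    · have := h.uniq; have := h.not_placed; grind [Function.update_apply]
    · have := h.not_placed; grind [Function.update_apply]
    · intro z hz
      by_cases hzy : z = y
      · subst hzy
        exact ⟨v, by simpa using hx⟩
      · obtain ⟨a, ha⟩ := h.placed z (by simpa [hzy] using hz)
        have : a ≠ v := by rintro rfl; omega
        exact ⟨a, by simpa [this] using ha⟩
    · have := h.outF; grind [Function.update_apply]
    · have := h.outS; grind [Function.update_apply]
    · have := h.start; grind [Function.update_apply]
    · have := h.inn; grind [Function.update_apply]
    · have := h.fin; grind [Function.update_apply]
    · have := h.pend; unfold InLabel at *; grind [Function.update_apply]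

/-- The only new obligation is `outF` for `v`, which the condition of the move provides. A missing
incoming arc of an internal vertex does no harm, and for images of pattern vertices the record stays
in `start` and `fin`. -/
theorem clearMove (hF : SlotsOK F sl) {s : Fin m} {v : Fin n} (hs : sl s = some v)
    (h : PartialSol arc T F (insert v F) sl d lab M) (hm : ClearMove s d d') :
    PartialSol arc T (insert v F) (insert v F) (Function.update sl s none) d' lab M := by
  obtain ⟨h0, rfl⟩ := hm
  have hu := h.slot s v hs
  have h2 := hF.inj
  have h3 := hF.disj
  constructor
  · intro u hn hs'
    refine h.lab_zero u (fun h => hn (Or.inr h)) fun s1 h1 => hs' s1 ?_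
    have : s1 ≠ s := by
      rintro rfl
      exact hn (Or.inl (by simpa using (h1.symm.trans hs)))
    simpa [this] using h1
  · have := h.slot; grind [Function.update_apply]
  · have := h.empty; grind [Function.update_apply]
  · have := h.zero; grind [Function.update_apply]
  · exact h.adj
  · exact h.inj
  · exact h.uniq
  · have := h.not_placed; grind [Function.update_apply]
  · have := h.placed; grind [Function.update_apply]
  · have := h.outF; have := h.outS; have := h.zero s; grind [Function.update_apply]
  · have := h.outS; grind [Function.update_apply]
  · have := h.start; grind [Function.update_apply]
  · have := h.inn; grind [Function.update_apply]
  · have := h.fin; grind [Function.update_apply]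
  · have := h.pend; grind [Function.update_apply]

end PartialSol

end TopDP

/-! ### The state of a solution, and how moves act on it -/

namespace TopDP

variable {k l m n : ℕ}

open Classical in
/-- The truth value of `p` as a number. -/
noncomputable def ind (p : Prop) : ℕ := if p then 1 else 0

theorem ind_of {p : Prop} (h : p) : ind p = 1 := if_pos h

theorem ind_of_not {p : Prop} (h : ¬ p) : ind p = 0 := if_neg h

theorem ind_congr {p q : Prop} (h : p ↔ q) : ind p = ind q := by rw [propext h]

/-- `lab` and `M` describe the labels of the vertices and the arcs of the paths of an expansion. -/
structure Solution (arc : Fin l → Fin k × Fin k) (T : Digraph (Fin n)) (lab : Fin n → ℕ)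
    (M : Fin l → Fin n → Fin n → Prop) : Prop where
  adj : ∀ e u w, M e u w → T.Adj u w ∧ OutLabel arc e (lab u) ∧ InLabel arc e (lab w)
  func : ∀ e u w w', M e u w → M e u w' → w = w'
  inj : ∀ e u u' w, M e u w → M e u' w → u = u'
  uniq : ∀ u w, lab u = lab w → l < lab u → u = w
  surj : ∀ h : Fin k, ∃ v, lab v = l + 1 + h
  le : ∀ v, lab v ≤ l + k
  out : ∀ v, ∀ e : Fin l, lab v = e + 1 → ∃ w, M e v w
  start : ∀ v e, lab v = l + 1 + (arc e).1 → ∃ w, M e v w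
  fin : ∀ v e, lab v = l + 1 + (arc e).2 → ∃ u, M e u v
  cross : ∀ e u x u' x', M e u x → M e u' x' → u ≠ u' → ¬ T.Adj u x' ∨ ¬ T.Adj u' x

/-- The state that belongs to the slots `sl`, if the vertices of `A` have been seen, the arcs of `X`
have been chosen, and arcs into the vertices of `Y` have been promised. -/
noncomputable def stateOf (arc : Fin l → Fin k × Fin k) (lab : Fin n → ℕ)
    (sl : Fin m → Option (Fin n)) (A : Fin n → Prop) (X : Fin l → Fin n → Fin n → Prop)
    (Y : Fin l → Fin n → Prop) : DState k l m
  | .start e => ind (∃ v w, lab v = l + 1 + (arc e).1 ∧ X e v w)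
  | .fin e => ind (∃ v, lab v = l + 1 + (arc e).2 ∧ (Y e v ∨ ∃ u, X e u v))
  | .placed h => ind (∃ v, A v ∧ lab v = l + 1 + h)
  | .pend e => ind (∃ x, Y e x ∧ ∀ u, ¬ X e u x)
  | .inn s => ind (∃ v, ∃ e : Fin l, sl s = some v ∧ lab v = e + 1 ∧ (Y e v ∨ ∃ u, X e u v))
  | .out s => ind (∃ v, ∃ e : Fin l, ∃ w, sl s = some v ∧ lab v = e + 1 ∧ X e v w)
  | .lab s => (sl s).elim 0 lab

section
variable {arc : Fin l → Fin k × Fin k} {T : Digraph (Fin n)} {F : Set (Fin n)}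
  {sl : Fin m → Option (Fin n)} {lab : Fin n → ℕ} {A A' : Fin n → Prop}
  {M X : Fin l → Fin n → Fin n → Prop} {Y : Fin l → Fin n → Prop}

theorem stateOf_congr {X' : Fin l → Fin n → Fin n → Prop} {Y' : Fin l → Fin n → Prop}
    (hA : ∀ v, A v ↔ A' v) (hX : ∀ e u w, X e u w ↔ X' e u w) (hY : ∀ e v, Y e v ↔ Y' e v) :
    stateOf arc lab sl A X Y = stateOf arc lab sl A' X' Y' := by
  obtain rfl : A = A' := funext fun v => propext (hA v)
  obtain rfl : X = X' := funext fun e => funext fun u => funext fun w => propext (hX e u w)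
  obtain rfl : Y = Y' := funext fun e => funext fun v => propext (hY e v)
  rfl

theorem stateOf_lab {s : Fin m} {v : Fin n} (hs : sl s = some v) :
    stateOf arc lab sl A X Y (.lab s) = lab v := by simp [stateOf, hs]

/-- Whether the relevant digit is `out s` or `start e`, it means the same thing: `u` has a chosen
outgoing arc of `e`. For `start` this needs that the image of a pattern vertex is unique. -/
theorem stateOf_outAt (hu : ∀ u w, lab u = lab w → l < lab u → u = w) {s : Fin m} {u : Fin n}
    (hs : sl s = some u) {e : Fin l} {i : Ix k l m}
    (hi : OutAt arc (stateOf arc lab sl A X Y) s e i) :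
    stateOf arc lab sl A X Y i = ind (∃ w, X e u w) := by
  rcases hi with ⟨h1, rfl⟩ | ⟨h1, rfl⟩ <;> rw [stateOf_lab hs] at h1 <;>
    simp only [stateOf] <;> apply ind_congr
  · constructor
    · rintro ⟨v, e', w, hv, he, hX⟩
      obtain rfl : u = v := by simpa [hs] using hv
      obtain rfl : e = e' := Fin.ext (by omega)
      exact ⟨w, hX⟩
    · rintro ⟨w, hX⟩
      exact ⟨u, e, w, hs, h1, hX⟩
  · constructor
    · rintro ⟨v, w, hv, hX⟩
      obtain rfl : u = v := hu _ _ (h1.trans hv.symm) (by omega)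
      exact ⟨w, hX⟩
    · rintro ⟨w, hX⟩
      exact ⟨u, w, h1, hX⟩

theorem stateOf_inAt (hu : ∀ u w, lab u = lab w → l < lab u → u = w) {s : Fin m} {w : Fin n}
    (hs : sl s = some w) {e : Fin l} {j : Ix k l m}
    (hj : InAt arc (stateOf arc lab sl A X Y) s e j) :
    stateOf arc lab sl A X Y j = ind (Y e w ∨ ∃ u, X e u w) := by
  rcases hj with ⟨h1, rfl⟩ | ⟨h1, rfl⟩ <;> rw [stateOf_lab hs] at h1 <;>
    simp only [stateOf] <;> apply ind_congr
  · constructor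
    · rintro ⟨v, e', hv, he, hX⟩
      obtain rfl : w = v := by simpa [hs] using hv
      obtain rfl : e = e' := Fin.ext (by omega)
      exact hX
    · exact fun hX => ⟨w, e, hs, h1, hX⟩
  · constructor
    · rintro ⟨v, hv, hX⟩
      obtain rfl : w = v := hu _ _ (h1.trans hv.symm) (by omega)
      exact hX
    · exact fun hX => ⟨w, h1, hX⟩

/-- The arc `(u, w)` is added to the chosen arcs of `e`. -/
def addArc (X : Fin l → Fin n → Fin n → Prop) (e : Fin l) (u w : Fin n) :
    Fin l → Fin n → Fin n → Prop :=
  fun e' a b => X e' a b ∨ e' = e ∧ a = u ∧ b = w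

/-- An arc of `e` into `v` is promised. -/
def addPromise (Y : Fin l → Fin n → Prop) (e : Fin l) (v : Fin n) : Fin l → Fin n → Prop :=
  fun e' a => Y e' a ∨ e' = e ∧ a = v

theorem exists_outAt {s : Fin m} {u : Fin n} {e : Fin l}
    (hs : sl s = some u) (hM : OutLabel arc e (lab u)) :
    ∃ i, OutAt arc (stateOf arc lab sl A X Y) s e i := by
  unfold OutAt
  rw [stateOf_lab hs]
  rcases hM with h | h
  · exact ⟨_, Or.inl ⟨h, rfl⟩⟩
  · exact ⟨_, Or.inr ⟨h, rfl⟩⟩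

theorem exists_inAt {s : Fin m} {u : Fin n} {e : Fin l}
    (hs : sl s = some u) (hM : InLabel arc e (lab u)) :
    ∃ i, InAt arc (stateOf arc lab sl A X Y) s e i := by
  unfold InAt
  rw [stateOf_lab hs]
  rcases hM with h | h
  · exact ⟨_, Or.inl ⟨h, rfl⟩⟩
  · exact ⟨_, Or.inr ⟨h, rfl⟩⟩

/-- An arc of the solution that is not yet chosen finds both digits zero, since any other chosen arc
out of `u` or into `w` would coincide with it. -/
theorem arcMove_stateOf (g : Solution arc T lab M) (hsl : SlotsOK F sl)
    (hX : ∀ e u w, X e u w → M e u w) {s s' : Fin m} {e : Fin l} {u w : Fin n}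
    (hs : sl s = some u) (hs' : sl s' = some w) (hM : M e u w) (hn : ¬ X e u w) (hY : ¬ Y e w) :
    ArcMove arc s s' e (stateOf arc lab sl A X Y) (stateOf arc lab sl A (addArc X e u w) Y) := by
  obtain ⟨-, h1, h2⟩ := g.adj e u w hM
  obtain ⟨i, hi⟩ := exists_outAt (A := A) (X := X) (Y := Y) hs h1
  obtain ⟨j, hj⟩ := exists_inAt (A := A) (X := X) (Y := Y) hs' h2
  refine ⟨i, j, hi, hj, ?_, ?_, ?_⟩
  · rw [stateOf_outAt g.uniq hs hi]
    refine ind_of_not ?_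
    rintro ⟨w', hw'⟩
    obtain rfl := g.func e u w w' hM (hX _ _ _ hw')
    exact hn hw'
  · rw [stateOf_inAt g.uniq hs' hj]
    refine ind_of_not ?_
    rintro (h | ⟨u', hu'⟩)
    · exact hY h
    · obtain rfl := g.inj e u u' w hM (hX _ _ _ hu')
      exact hn hu'
  · unfold OutAt at hi
    unfold InAt at hj
    rw [stateOf_lab hs] at hi
    rw [stateOf_lab hs'] at hj
    have hinj := hsl.inj
    funext a
    simp only [Function.update_apply]
    split_ifs with ha hb
    · subst ha
      rcases hj with ⟨hj, rfl⟩ | ⟨hj, rfl⟩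
      · exact ind_of ⟨w, e, hs', hj, Or.inr ⟨u, Or.inr ⟨rfl, rfl, rfl⟩⟩⟩
      · exact ind_of ⟨w, hj, Or.inr ⟨u, Or.inr ⟨rfl, rfl, rfl⟩⟩⟩
    · subst hb
      rcases hi with ⟨hi, rfl⟩ | ⟨hi, rfl⟩
      · exact ind_of ⟨u, e, w, hs, hi, Or.inr ⟨rfl, rfl, rfl⟩⟩
      · exact ind_of ⟨u, w, hi, Or.inr ⟨rfl, rfl, rfl⟩⟩
    · cases a <;> simp only [stateOf, addArc] <;> apply ind_congr <;> grind

/-- By `hp`, `x` is the only vertex that waits for an arc of `e`; so once it is served the bit `pend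
e` drops to zero, as the move prescribes. -/
theorem takeMove_stateOf (g : Solution arc T lab M)
    (hX : ∀ e u w, X e u w → M e u w) {s : Fin m} {e : Fin l} {u x : Fin n}
    (hs : sl s = some u) (hinj : ∀ s s' v, sl s = some v → sl s' = some v → s = s')
    (hM : M e u x) (hn : ¬ X e u x) (hY : Y e x)
    (hp : ∀ x', Y e x' → (∀ u', ¬ X e u' x') → x' = x) :
    TakeMove arc s e (stateOf arc lab sl A X Y) (stateOf arc lab sl A (addArc X e u x) Y) := by
  obtain ⟨-, h1, h2⟩ := g.adj e u x hM
  obtain ⟨i, hi⟩ := exists_outAt (A := A) (X := X) (Y := Y) hs h1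
  have hx : ∀ u', ¬ X e u' x := by
    intro u' hu'
    obtain rfl := g.inj e u u' x hM (hX _ _ _ hu')
    exact hn hu'
  refine ⟨i, hi, ?_, ?_, ?_⟩
  · rw [stateOf_outAt g.uniq hs hi]
    refine ind_of_not ?_
    rintro ⟨w', hw'⟩
    obtain rfl := g.func e u x w' hM (hX _ _ _ hw')
    exact hn hw'
  · have : stateOf arc lab sl A X Y (.pend e) = 1 := ind_of ⟨x, hY, hx⟩
    omega
  · unfold OutAt at hi
    rw [stateOf_lab hs] at hi
    funext a
    simp only [Function.update_apply]
    split_ifs with ha hb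
    · subst ha
      refine ind_of_not ?_
      rintro ⟨x', hx', hn'⟩
      obtain rfl := hp x' hx' fun u' hu' => hn' u' (Or.inl hu')
      exact hn' u (Or.inr ⟨rfl, rfl, rfl⟩)
    · subst hb
      rcases hi with ⟨hi, rfl⟩ | ⟨hi, rfl⟩
      · exact ind_of ⟨u, e, x, hs, hi, Or.inr ⟨rfl, rfl, rfl⟩⟩
      · exact ind_of ⟨u, x, hi, Or.inr ⟨rfl, rfl, rfl⟩⟩
    · cases a <;> simp only [stateOf, addArc] <;> apply ind_congr <;> grind

/-- By `hp`, all earlier promises of `e` have been fulfilled, so the bit `pend e` is free. -/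
theorem leaveMove_stateOf (g : Solution arc T lab M) {s : Fin m} {e : Fin l} {u v : Fin n}
    (hs : sl s = some v) (hinj : ∀ s s' v, sl s = some v → sl s' = some v → s = s')
    (hM : M e u v) (hn : ∀ u, ¬ X e u v) (hY : ¬ Y e v)
    (hp : ∀ x', Y e x' → ∃ u', X e u' x') :
    LeaveMove arc s e (stateOf arc lab sl A X Y) (stateOf arc lab sl A X (addPromise Y e v)) := by
  obtain ⟨-, h1, h2⟩ := g.adj e u v hM
  obtain ⟨j, hj⟩ := exists_inAt (A := A) (X := X) (Y := Y) hs h2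
  refine ⟨j, hj, ?_, ?_, ?_⟩
  · rw [stateOf_inAt g.uniq hs hj]
    refine ind_of_not ?_
    rintro (h | ⟨u', hu'⟩)
    · exact hY h
    · exact hn _ hu'
  · refine ind_of_not ?_
    rintro ⟨x, hx, hx'⟩
    obtain ⟨u', hu'⟩ := hp x hx
    exact hx' _ hu'
  · unfold InAt at hj
    rw [stateOf_lab hs] at hj
    funext a
    simp only [Function.update_apply]
    split_ifs with ha hb
    · subst ha
      exact ind_of ⟨v, Or.inr ⟨rfl, rfl⟩, hn⟩
    · subst hb
      rcases hj with ⟨hj, rfl⟩ | ⟨hj, rfl⟩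
      · exact ind_of ⟨v, e, hs, hj, Or.inl (Or.inr ⟨rfl, rfl⟩)⟩
      · exact ind_of ⟨v, hj, Or.inl (Or.inr ⟨rfl, rfl⟩)⟩
    · cases a <;> simp only [stateOf, addPromise] <;> apply ind_congr <;> grind

/-- A promise of an arc that is already chosen does not change the state. -/
theorem stateOf_addPromise {e : Fin l} {u v : Fin n} (hX : X e u v) :
    stateOf arc lab sl A X (addPromise Y e v) = stateOf arc lab sl A X Y := by
  funext a
  cases a <;> simp only [stateOf, addPromise] <;> apply ind_congr <;> grind

theorem labelMove_stateOf (g : Solution arc T lab M) {s : Fin m} {v : Fin n} (hs : sl s = none)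
    (hv : ¬ A v) (hX : ∀ e u w, X e u w → u ≠ v ∧ w ≠ v) (hY : ∀ e, ¬ Y e v) :
    LabelMove s (lab v) (stateOf arc lab sl A X Y)
      (stateOf arc lab (Function.update sl s (some v)) (fun u => A u ∨ u = v) X Y) := by
  refine ⟨by simp [stateOf, hs], ?_⟩
  have hle := g.le v
  by_cases hl : lab v ≤ l
  · refine Or.inl ⟨hl, ?_⟩
    funext a
    simp only [Function.update_apply]
    split_ifs with ha
    · subst ha; simp [stateOf]
    · cases a <;> simp only [stateOf, Function.update_apply] <;> first
        | (apply ind_congr; grind)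
        | grind
  · refine Or.inr ⟨⟨lab v - (l + 1), by omega⟩, by simp only; omega, ?_, ?_⟩
    · refine ind_of_not ?_
      rintro ⟨u, hu, hl'⟩
      obtain rfl : u = v := g.uniq _ _ (hl'.trans (by simp only; omega)) (by omega)
      exact hv hu
    · funext a
      simp only [Function.update_apply]
      split_ifs with ha hb
      · subst ha
        exact ind_of ⟨v, Or.inr rfl, by simp only; omega⟩
      · subst hb; simp [stateOf]
      · cases a <;> simp only [stateOf, Function.update_apply] <;> first
        | (apply ind_congr; grind)
        | grind

theorem clearMove_stateOf {s : Fin m} {v : Fin n} (hs : sl s = some v)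
    (ho : ∀ e : Fin l, lab v = e + 1 → ∃ w, X e v w) :
    ClearMove s (stateOf arc lab sl A X Y)
      (stateOf arc lab (Function.update sl s none) A X Y) := by
  refine ⟨?_, ?_⟩
  · rw [stateOf_lab hs]
    by_cases h0 : lab v = 0
    · exact Or.inl h0
    by_cases h1 : l < lab v
    · exact Or.inr (Or.inl h1)
    · obtain ⟨w, hw⟩ := ho ⟨lab v - 1, by omega⟩ (by simp only; omega)
      have : stateOf arc lab sl A X Y (.out s) = 1 :=
        ind_of ⟨v, ⟨lab v - 1, by omega⟩, w, hs, by simp only; omega, hw⟩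
      omega
  · funext a
    simp only [Function.update_apply]
    split_ifs with ha hb hc
    · subst ha; exact ind_of_not (by simp)
    · subst hb; exact ind_of_not (by simp)
    · subst hc; simp [stateOf]
    · cases a <;> simp only [stateOf, Function.update_apply] <;> first
        | (apply ind_congr; grind)
        | grind

end

end TopDP

/-! ### Entering and leaving of a vertex: soundness and completeness of the table -/

namespace TopDP

variable {k l m n : ℕ}

section
variable (arc : Fin l → Fin k × Fin k) (T : Digraph (Fin n)) (F : Set (Fin n))
  (sl : Fin m → Option (Fin n))

/-- The arcs between the vertices that have been seen. -/
def seenArcs (M : Fin l → Fin n → Fin n → Prop) : Fin l → Fin n → Fin n → Prop :=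
  fun e u w => M e u w ∧ Seen F sl u ∧ Seen F sl w

/-- The arcs into the forgotten vertices are promised. -/
def promises (F : Set (Fin n)) (M : Fin l → Fin n → Fin n → Prop) : Fin l → Fin n → Prop :=
  fun e x => x ∈ F ∧ ∃ u, M e u x

/-- `S` contains the states that belong to the solutions. -/
def Complete (S : Set (DState k l m)) : Prop :=
  ∀ lab M, Solution arc T lab M →
    stateOf arc lab sl (Seen F sl) (seenArcs F sl M) (promises F M) ∈ S

/-- The forgotten vertices are separated from those that have not been seen. -/
def Separated : Prop :=
  ∀ x ∈ F, ∀ u, ¬ Seen F sl u → T.Adj u x ∧ ¬ T.Adj x u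

/-- The set of states is correct for the forgotten vertices `F` and the slots `sl`. -/
structure Correct (S : Set (DState k l m)) : Prop where
  ok : SlotsOK F sl
  sep : Separated T F sl
  sound : Sound arc T F F sl S
  complete : Complete arc T F sl S

/-- The vertex `v` enters slot `q`, and the labels below `x` have been tried. -/
structure LabelPhase (q : Fin m) (v : Fin n) (x : ℕ) (S : Set (DState k l m)) : Prop where
  ok : SlotsOK F sl
  sep : Separated T F sl
  empty : sl q = none
  not_seen : ¬ Seen F sl v
  sound : Sound arc T F F (Function.update sl q (some v)) S
  complete : ∀ lab M, Solution arc T lab M →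
    stateOf arc lab sl (Seen F sl) (seenArcs F sl M) (promises F M) ∈ S ∧
    (lab v < x → stateOf arc lab (Function.update sl q (some v)) (fun u => Seen F sl u ∨ u = v)
      (seenArcs F sl M) (promises F M) ∈ S)

/-- The vertex `v` in slot `q` has its label, and the arcs with `done` have been tried. -/
structure ArcPhase (q : Fin m) (v : Fin n) (done : Fin l → Fin n → Fin n → Prop)
    (S : Set (DState k l m)) : Prop where
  ok : SlotsOK F sl
  sep : Separated T F sl
  slot : sl q = some v
  adj : ∀ x ∈ F, T.Adj v x ∧ ¬ T.Adj x v
  sound : Sound arc T F F sl S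
  old : ∀ e u w, u ≠ v → w ≠ v → done e u w
  complete : ∀ lab M, Solution arc T lab M → ∃ X,
    (∀ e u w, X e u w → seenArcs F sl M e u w) ∧
    (∀ e u w, seenArcs F sl M e u w → done e u w → X e u w) ∧
    stateOf arc lab sl (Seen F sl) X (promises F M) ∈ S

/-- The vertex `v` in slot `s` is to be forgotten, and the arcs `e` with `done` have been
considered. -/
structure LeavePhase (s : Fin m) (v : Fin n) (done : Fin l → Prop)
    (S : Set (DState k l m)) : Prop where
  ok : SlotsOK F sl
  sep : Separated T F sl
  slot : sl s = some v
  adj : ∀ u, ¬ Seen F sl u → T.Adj u v ∧ ¬ T.Adj v u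
  sound : Sound arc T F (insert v F) sl S
  complete : ∀ lab M, Solution arc T lab M →
    stateOf arc lab sl (Seen F sl) (seenArcs F sl M)
      (fun e x => promises F M e x ∨ x = v ∧ done e ∧ ∃ u, M e u v) ∈ S

end

section
variable {arc : Fin l → Fin k × Fin k} {T : Digraph (Fin n)} {F L : Set (Fin n)}
  {sl : Fin m → Option (Fin n)} {S : Set (DState k l m)} {q s : Fin m} {v : Fin n}

theorem Sound.addMoves {R : DState k l m → DState k l m → Prop} (h : Sound arc T F L sl S)
    (hR : ∀ d d' lab M, PartialSol arc T F L sl d lab M → R d d' →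
      ∃ lab' M', PartialSol arc T F L sl d' lab' M') :
    Sound arc T F L sl (addMoves R S) := by
  rintro d' (hd | ⟨d, hd, hR'⟩)
  · exact h d' hd
  · obtain ⟨lab, M, hp⟩ := h d hd
    exact hR d d' lab M hp hR'

theorem seen_update_some (hq : sl q = none) (u : Fin n) :
    Seen F (Function.update sl q (some v)) u ↔ Seen F sl u ∨ u = v := by
  unfold Seen
  constructor
  · rintro (h | ⟨s, hs⟩)
    · exact Or.inl (Or.inl h)
    · by_cases hsq : s = q
      · subst hsq
        exact Or.inr (by simpa using hs.symm)
      · exact Or.inl (Or.inr ⟨s, by simpa [hsq] using hs⟩)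
  · rintro ((h | ⟨s, hs⟩) | rfl)
    · exact Or.inl h
    · have : s ≠ q := by rintro rfl; simp [hq] at hs
      exact Or.inr ⟨s, by simpa [this] using hs⟩
    · exact Or.inr ⟨q, by simp⟩

theorem seen_update_none (hs : sl s = some v) (u : Fin n) :
    Seen (insert v F) (Function.update sl s none) u ↔ Seen F sl u := by
  unfold Seen
  constructor
  · rintro ((rfl | h) | ⟨t, ht⟩)
    · exact Or.inr ⟨s, hs⟩
    · exact Or.inl h
    · have : t ≠ s := by rintro rfl; simp at ht
      exact Or.inr ⟨t, by simpa [this] using ht⟩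
  · rintro (h | ⟨t, ht⟩)
    · exact Or.inl (Or.inr h)
    · by_cases h : t = s
      · subst h
        exact Or.inl (Or.inl (by simpa [hs] using ht.symm))
      · exact Or.inr ⟨t, by simpa [h] using ht⟩

theorem Correct.labelPhase (h : Correct arc T F sl S) (hq : sl q = none) (hv : ¬ Seen F sl v) :
    LabelPhase arc T F sl q v 0 S where
  ok := h.ok
  sep := h.sep
  empty := hq
  not_seen := hv
  sound d hd := by
    obtain ⟨lab, M, hp⟩ := h.sound d hd
    exact ⟨lab, M, hp.open_slot hq hv⟩
  complete lab M g := ⟨h.complete lab M g, fun h => absurd h (Nat.not_lt_zero _)⟩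

theorem SlotsOK.update_some (ok : SlotsOK F sl) (hv : ¬ Seen F sl v) :
    SlotsOK F (Function.update sl q (some v)) := by
  unfold Seen at hv
  obtain ⟨h1, h2⟩ := ok
  constructor <;> grind [Function.update_apply]

/-- Unlabelled states stay in the table, so the move with `x = lab v` still finds the state of the
solution from which it has to start. -/
theorem LabelPhase.step {x : ℕ} (h : LabelPhase arc T F sl q v x S) :
    LabelPhase arc T F sl q v (x + 1) (addMoves (LabelMove q x) S) where
  ok := h.ok
  sep := h.sep
  empty := h.empty
  not_seen := h.not_seen
  sound := h.sound.addMoves fun d d' lab M hp hR =>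
    ⟨_, _, hp.labelMove (v := v) (h.ok.update_some h.not_seen) (by simp) hR⟩
  complete lab M g := by
    obtain ⟨h1, h2⟩ := h.complete lab M g
    refine ⟨Or.inl h1, fun hx => ?_⟩
    rcases Nat.lt_succ_iff_lt_or_eq.1 hx with hx | rfl
    · exact Or.inl (h2 hx)
    · refine Or.inr ⟨_, h1, labelMove_stateOf g h.empty h.not_seen ?_ ?_⟩
      · rintro e u w ⟨-, hu, hw⟩
        constructor <;> rintro rfl
        · exact h.not_seen hu
        · exact h.not_seen hw
      · rintro e ⟨hv, -⟩
        exact h.not_seen (Or.inl hv)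

theorem LabelPhase.arcPhase (h : LabelPhase arc T F sl q v (k + l + 1) S) :
    ArcPhase arc T F (Function.update sl q (some v)) q v (fun _ u w => u ≠ v ∧ w ≠ v) S where
  ok := h.ok.update_some h.not_seen
  sep x hx u hu := h.sep x hx u fun hu' => hu ((seen_update_some h.empty u).2 (Or.inl hu'))
  slot := by simp
  adj x hx := h.sep x hx v h.not_seen
  sound := h.sound
  old e u w hu hw := ⟨hu, hw⟩
  complete lab M g := by
    have hseen := seen_update_some (F := F) (v := v) h.empty
    refine ⟨seenArcs F sl M, ?_, ?_, ?_⟩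
    · rintro e u w ⟨h1, h2, h3⟩
      exact ⟨h1, (hseen u).2 (Or.inl h2), (hseen w).2 (Or.inl h3)⟩
    · rintro e u w ⟨h1, h2, h3⟩ ⟨hu, hw⟩
      exact ⟨h1, ((hseen u).1 h2).resolve_right hu, ((hseen w).1 h3).resolve_right hw⟩
    · have := g.le v
      rw [stateOf_congr (A' := fun u => Seen F sl u ∨ u = v) hseen (fun _ _ _ => Iff.rfl)
        (fun _ _ => Iff.rfl)]
      exact (h.complete lab M g).2 (by omega)

variable {done done' : Fin l → Fin n → Fin n → Prop}

/-- The chosen arcs `X` are only bounded below by `done`, and only on arcs of `T` between seen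
vertices. The order of the moves and repeated attempts are therefore immaterial. -/
theorem ArcPhase.mono (h : ArcPhase arc T F sl q v done S)
    (old : ∀ e u w, u ≠ v → w ≠ v → done' e u w)
    (hd : ∀ e u w, T.Adj u w → Seen F sl u → Seen F sl w → done' e u w → done e u w) :
    ArcPhase arc T F sl q v done' S :=
  { h with
    old := old
    complete := fun lab M g => by
      obtain ⟨X, h1, h2, h3⟩ := h.complete lab M g
      exact ⟨X, h1, fun e u w hM hdone => h2 e u w hM
        (hd e u w (g.adj e u w hM.1).1 hM.2.1 hM.2.2 hdone), h3⟩ }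

theorem ArcPhase.correct (h : ArcPhase arc T F sl q v done S)
    (hd : ∀ e u w, T.Adj u w → Seen F sl u → Seen F sl w → done e u w) :
    Correct arc T F sl S where
  ok := h.ok
  sep := h.sep
  sound := h.sound
  complete lab M g := by
    obtain ⟨X, h1, h2, h3⟩ := h.complete lab M g
    rwa [stateOf_congr (fun _ => Iff.rfl) (X' := seenArcs F sl M) (fun e u w => ⟨h1 e u w,
      fun hM => h2 e u w hM (hd e u w (g.adj e u w hM.1).1 hM.2.1 hM.2.2)⟩)
      (fun _ _ => Iff.rfl)] at h3

theorem ArcPhase.step (h : ArcPhase arc T F sl q v done S) {s s' : Fin m} {u w : Fin n}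
    (hs : sl s = some u) (hs' : sl s' = some w) (ha : T.Adj u w) (e : Fin l) :
    ArcPhase arc T F sl q v (addArc done e u w) (addMoves (ArcMove arc s s' e) S) where
  ok := h.ok
  sep := h.sep
  slot := h.slot
  adj := h.adj
  sound := h.sound.addMoves fun d d' lab M hp hR => ⟨_, _, hp.arcMove h.ok hs hs' ha hR⟩
  old e u w hu hw := Or.inl (h.old e u w hu hw)
  complete lab M g := by
    obtain ⟨X, h1, h2, h3⟩ := h.complete lab M g
    by_cases hX : M e u w ∧ ¬ X e u w
    · refine ⟨addArc X e u w, ?_, ?_, Or.inr ⟨_, h3, arcMove_stateOf g h.ok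
        (fun e u w hX => (h1 e u w hX).1) hs hs' hX.1 hX.2 fun hw => h.ok.disj s' w hs' hw.1⟩⟩
      · rintro e' a b (hab | ⟨rfl, rfl, rfl⟩)
        · exact h1 _ _ _ hab
        · exact ⟨hX.1, Or.inr ⟨s, hs⟩, Or.inr ⟨s', hs'⟩⟩
      · rintro e' a b hM (hd | hd)
        · exact Or.inl (h2 _ _ _ hM hd)
        · exact Or.inr hd
    · refine ⟨X, h1, ?_, Or.inl h3⟩
      rintro e' a b hM (hd | ⟨rfl, rfl, rfl⟩)
      · exact h2 _ _ _ hM hd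
      · by_contra hc
        exact hX ⟨hM.1, hc⟩

theorem ArcPhase.skip (h : ArcPhase arc T F sl q v done S) {u w : Fin n}
    (ha : ¬ T.Adj u w) (e : Fin l) : ArcPhase arc T F sl q v (addArc done e u w) S :=
  h.mono (fun e u w hu hw => Or.inl (h.old e u w hu hw)) (by
    rintro e' a b hab - - (hd | ⟨rfl, rfl, rfl⟩)
    · exact hd
    · exact absurd hab ha)

/-- One pass deals with all arcs from `v` into `F`, as the solution has at most one for `e`.
Chordlessness enters through `cross`: no other vertex of `F` can be waiting, since `v` and every
unseen vertex dominate all of `F`. -/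
theorem ArcPhase.take (h : ArcPhase arc T F sl q v done S) (e : Fin l) :
    ArcPhase arc T F sl q v (fun e' a b => done e' a b ∨ e' = e ∧ a = v ∧ b ∈ F)
      (addMoves (TakeMove arc q e) S) where
  ok := h.ok
  sep := h.sep
  slot := h.slot
  adj := h.adj
  sound := h.sound.addMoves fun d d' lab M hp hR =>
    ⟨_, hp.takeMove h.ok h.slot (fun x hx => (h.adj x hx).1) hR⟩
  old e u w hu hw := Or.inl (h.old e u w hu hw)
  complete lab M g := by
    obtain ⟨X, h1, h2, h3⟩ := h.complete lab M g
    by_cases hX : ∃ x ∈ F, M e v x ∧ ¬ X e v x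
    · obtain ⟨x, hx, hM, hn⟩ := hX
      refine ⟨addArc X e v x, ?_, ?_, Or.inr ⟨_, h3, takeMove_stateOf g
        (fun e u w hX => (h1 e u w hX).1) h.slot h.ok.inj hM hn ⟨hx, v, hM⟩ ?_⟩⟩
      · rintro e' a b (hab | ⟨rfl, rfl, rfl⟩)
        · exact h1 _ _ _ hab
        · exact ⟨hM, Or.inr ⟨q, h.slot⟩, Or.inl hx⟩
      · rintro e' a b hM' (hd | ⟨rfl, rfl, hb⟩)
        · exact Or.inl (h2 _ _ _ hM' hd)
        · exact Or.inr ⟨rfl, rfl, g.func _ _ _ _ hM'.1 hM⟩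
      · rintro x' ⟨hx', u', hu'⟩ hn'
        by_cases huv : u' = v
        · subst huv
          exact g.func _ _ _ _ hu' hM
        · have hu'A : ¬ Seen F sl u' := by
            intro hA
            -- If `u'` has been seen, the arc joins seen vertices other than `v`; it is old and
            -- hence chosen, so `x'` is not waiting.
            refine hn' u' (h2 _ _ _ ⟨hu', hA, Or.inl hx'⟩ (h.old _ _ _ huv ?_))
            rintro rfl
            exact h.ok.disj q _ h.slot hx'
          rcases g.cross e v x u' x' hM hu' (Ne.symm huv) with hc | hc
          · exact absurd (h.adj x' hx').1 hc
          · exact absurd (h.sep x hx u' hu'A).1 hc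
    · refine ⟨X, h1, ?_, Or.inl h3⟩
      rintro e' a b hM (hd | ⟨rfl, rfl, hb⟩)
      · exact h2 _ _ _ hM hd
      · by_contra hc
        exact hX ⟨b, hb, hM.1, hc⟩

theorem Correct.leavePhase (h : Correct arc T F sl S) (hs : sl s = some v)
    (ha : ∀ u, ¬ Seen F sl u → T.Adj u v ∧ ¬ T.Adj v u) :
    LeavePhase arc T F sl s v (fun _ => False) S where
  ok := h.ok
  sep := h.sep
  slot := hs
  adj := ha
  sound d hd := by
    obtain ⟨lab, M, hp⟩ := h.sound d hd
    exact ⟨lab, M, hp.mono_right (Set.subset_insert _ _)⟩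
  complete lab M g := by
    rw [stateOf_congr (fun _ => Iff.rfl) (fun _ _ _ => Iff.rfl) (Y' := promises F M)
      (by simp)]
    exact h.complete lab M g

/-- If the solution has no arc of `e` into `v`, or `e` was considered before, nothing changes. If
the tail has been seen, the arc is already chosen and a promise of it does not show in the state. If
the tail is unseen, a proper move is needed, and `cross` shows that no other promise of `e` is
outstanding. -/
theorem LeavePhase.step {done : Fin l → Prop} (h : LeavePhase arc T F sl s v done S) (e : Fin l) :
    LeavePhase arc T F sl s v (fun e' => done e' ∨ e' = e) (addMoves (LeaveMove arc s e) S) where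
  ok := h.ok
  sep := h.sep
  slot := h.slot
  adj := h.adj
  sound := h.sound.addMoves fun d d' lab M hp hR =>
    ⟨_, _, hp.leaveMove h.slot (Set.mem_insert _ _) hR⟩
  complete lab M g := by
    have hc := h.complete lab M g
    set Y : Fin l → Fin n → Prop :=
      fun e x => promises F M e x ∨ x = v ∧ done e ∧ ∃ u, M e u v with hY
    by_cases hold : done e ∨ ¬ ∃ u, M e u v
    · left
      rw [stateOf_congr (fun _ => Iff.rfl) (fun _ _ _ => Iff.rfl) (Y' := Y)]
      · exact hc
      · intro e' x
        simp only [hY]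
        constructor
        · rintro (h | ⟨rfl, h | rfl, hu⟩)
          · exact Or.inl h
          · exact Or.inr ⟨rfl, h, hu⟩
          · exact Or.inr ⟨rfl, hold.resolve_right (not_not.2 hu), hu⟩
        · rintro (h | ⟨rfl, h, hu⟩)
          · exact Or.inl h
          · exact Or.inr ⟨rfl, Or.inl h, hu⟩
    · push Not at hold
      obtain ⟨hnd, u, hu⟩ := hold
      have hY' : ∀ e' x, (promises F M e' x ∨ x = v ∧ (done e' ∨ e' = e) ∧ ∃ u, M e' u v) ↔
          addPromise Y e v e' x := by
        intro e' x
        simp only [hY, addPromise]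
        constructor
        · rintro (h | ⟨rfl, h | rfl, hu⟩)
          · exact Or.inl (Or.inl h)
          · exact Or.inl (Or.inr ⟨rfl, h, hu⟩)
          · exact Or.inr ⟨rfl, rfl⟩
        · rintro ((h | ⟨rfl, h, hu⟩) | ⟨rfl, rfl⟩)
          · exact Or.inl h
          · exact Or.inr ⟨rfl, Or.inl h, hu⟩
          · exact Or.inr ⟨rfl, Or.inr rfl, u, hu⟩
      rw [stateOf_congr (fun _ => Iff.rfl) (fun _ _ _ => Iff.rfl) hY']
      have hvF : v ∉ F := h.ok.disj s v h.slot
      by_cases huA : Seen F sl u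
      · left
        rw [stateOf_addPromise (u := u) ⟨hu, huA, Or.inr ⟨s, h.slot⟩⟩]
        exact hc
      · refine Or.inr ⟨_, hc, leaveMove_stateOf g h.slot h.ok.inj hu ?_ ?_ ?_⟩
        · rintro u' ⟨hu', hA, -⟩
          exact huA (g.inj _ _ _ _ hu' hu ▸ hA)
        · rintro (⟨hv, -⟩ | ⟨-, hd, -⟩)
          · exact hvF hv
          · exact hnd hd
        · rintro x (⟨hx, u', hu'⟩ | ⟨-, hd, -⟩)
          · refine ⟨u', hu', ?_, Or.inl hx⟩
            by_contra hA
            -- Two distinct unseen tails `u` and `u'` would both dominate `v` and `x`, against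
            -- `cross`; equal tails would have equal heads, but `v` is not forgotten.
            have hne : u ≠ u' := by
              rintro rfl
              exact hvF (g.func _ _ _ _ hu hu' ▸ hx)
            rcases g.cross e u v u' x hu hu' hne with hc | hc
            · exact hc (h.sep x hx u huA).1
            · exact hc (h.adj u' hA).1
          · exact absurd hd hnd

/-- The state of a solution passes the test of `ClearMove`: no arc leads from `v` to an unseen
vertex, so the successor of an internal `v` has been seen and the arc to it is chosen. -/
theorem LeavePhase.correct {done : Fin l → Prop} (h : LeavePhase arc T F sl s v done S)
    (hd : ∀ e, done e) :
    Correct arc T (insert v F) (Function.update sl s none) (applyMoves (ClearMove s) S) where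
  ok := by
    obtain ⟨h1, h2⟩ := h.ok
    have := h.slot
    constructor <;> grind [Function.update_apply]
  sep x hx u hu := by
    rw [seen_update_none h.slot] at hu
    rcases hx with rfl | hx
    · exact h.adj u hu
    · exact h.sep x hx u hu
  sound := by
    rintro d' ⟨d, hd, hm⟩
    obtain ⟨lab, M, hp⟩ := h.sound d hd
    exact ⟨lab, M, PartialSol.clearMove h.ok h.slot hp hm⟩
  complete lab M g := by
    have hseen := seen_update_none (F := F) h.slot
    refine ⟨_, h.complete lab M g, ?_⟩
    rw [stateOf_congr (A := Seen (insert v F) (Function.update sl s none)) hseen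
      (X' := seenArcs F sl M)
      (Y' := fun e x => promises F M e x ∨ x = v ∧ done e ∧ ∃ u, M e u v)]
    · refine clearMove_stateOf h.slot fun e he => ?_
      obtain ⟨w, hw⟩ := g.out v e he
      refine ⟨w, hw, Or.inr ⟨s, h.slot⟩, ?_⟩
      by_contra hA
      exact (h.adj w hA).2 (g.adj _ _ _ hw).1
    · intro e u w
      simp only [seenArcs, hseen]
    · intro e x
      unfold promises
      constructor
      · rintro ⟨rfl | hx, hu⟩
        · exact Or.inr ⟨rfl, hd e, hu⟩
        · exact Or.inl ⟨hx, hu⟩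
      · rintro (⟨hx, hu⟩ | ⟨rfl, -, hu⟩)
        · exact ⟨Or.inr hx, hu⟩
        · exact ⟨Or.inl rfl, hu⟩

end

end TopDP

/-! ### Expansions, chordless paths and labellings -/

namespace TopDP

section Paths
variable {V : Type*} {G : Digraph V} {a b : V} {P : List V}

theorem IsDirPath.mem_internal_iff (h : IsDirPath G a b P) {x : V} :
    x ∈ internalVertices P ↔ x ∈ P ∧ x ≠ a ∧ x ≠ b := by
  obtain ⟨-, hn, hf, hl⟩ := h
  unfold internalVertices
  cases P with
  | nil => simp at hf
  | cons c t =>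
    obtain rfl : c = a := by simpa using hf
    rcases List.eq_nil_or_concat t with rfl | ⟨t', d, rfl⟩
    · simpa using fun h h' => absurd h h'
    · simp only [List.concat_eq_append] at *
      obtain rfl : d = b := by
        rw [← List.cons_append, List.getLast?_append] at hl
        simpa using hl
      simp only [List.tail_cons, List.dropLast_concat, List.mem_cons, List.mem_append]
      simp only [List.nodup_cons, List.mem_append, List.nodup_append] at hn
      grind

/-- A forward chord allows a shortcut that uses fewer vertices of the same path. Induction on the
length. -/
theorem IsDirPath.exists_chordless (h : IsDirPath G a b P) :
    ∃ Q, IsDirPath G a b Q ∧ (∀ x ∈ Q, x ∈ P) ∧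
      ∀ i j x y, i + 1 < j → Q[i]? = some x → Q[j]? = some y → ¬ G.Adj x y := by
  induction hn : P.length using Nat.strong_induction_on generalizing P with
  | _ N ih =>
    by_cases hc : ∃ i j x y, i + 1 < j ∧ P[i]? = some x ∧ P[j]? = some y ∧ G.Adj x y
    · obtain ⟨i, j, x, y, hij, hx, hy, ha⟩ := hc
      obtain ⟨hi, hx'⟩ := List.getElem?_eq_some_iff.1 hx
      obtain ⟨hj, hy'⟩ := List.getElem?_eq_some_iff.1 hy
      have hsub : (P.take (i + 1) ++ P.drop j).Sublist P := by
        conv_rhs => rw [← List.take_append_drop (i + 1) P]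
        refine List.Sublist.append (List.Sublist.refl _) ?_
        exact List.drop_sublist_drop_left P (by omega)
      have hQ : IsDirPath G a b (P.take (i + 1) ++ P.drop j) := by
        refine ⟨?_, h.nodup.sublist hsub, ?_, ?_⟩
        · rw [List.isChain_append]
          refine ⟨h.chain.take _, h.chain.drop _, ?_⟩
          intro u hu w hw
          have hu' : u = x := by
            rw [List.getLast?_take] at hu
            simpa [hx, eq_comm] using hu
          have hw' : w = y := by
            rw [List.head?_drop] at hw
            simpa [hy, eq_comm] using hw
          rwa [hu', hw']
        · rw [List.head?_append, List.head?_take]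
          simp [h.first]
        · rw [List.getLast?_append, List.getLast?_drop, if_neg (by omega)]
          simp [h.last]
      obtain ⟨Q, h1, h2, h3⟩ := ih _ (by
        rw [← hn, List.length_append, List.length_take, List.length_drop]; omega) hQ rfl
      exact ⟨Q, h1, fun x hx => hsub.subset (h2 x hx), h3⟩
    · push Not at hc
      exact ⟨P, h, fun _ => id, hc⟩

/-- Following the arcs of an injective relation from `a` leads to `b`, if the relation can be left
only there. -/
theorem exists_isDirPath_of_rel [Finite V] {M : V → V → Prop} {p : V → Prop}
    (hG : ∀ u w, M u w → G.Adj u w) (inj : ∀ u u' w, M u w → M u' w → u = u')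
    (start : ∃ w, M a w) (step : ∀ v, p v → ∃ w, M v w) (next : ∀ u w, M u w → p w ∨ w = b)
    (ha : ¬ p a) (hab : a ≠ b) :
    ∃ P, IsDirPath G a b P ∧ ∀ x ∈ internalVertices P, p x := by
  classical
  have hf : ∀ v, ∃ w, v = a ∨ p v → M v w := by
    intro v
    by_cases hv : v = a ∨ p v
    · rcases hv with rfl | hv
      · obtain ⟨w, hw⟩ := start; exact ⟨w, fun _ => hw⟩
      · obtain ⟨w, hw⟩ := step v hv; exact ⟨w, fun _ => hw⟩
    · exact ⟨v, fun h => absurd h hv⟩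
  choose f hf using hf
  set x : ℕ → V := fun i => f^[i] a with hx
  have hx0 : x 0 = a := rfl
  have hxs : ∀ i, x (i + 1) = f (x i) := fun i => Function.iterate_succ_apply' f i a
  have hp : ∀ j, (∀ i, 0 < i → i < j → x i ≠ b) → ∀ i, i < j → x i = a ∧ i = 0 ∨ p (x i) := by
    intro j hj i
    induction i with
    | zero => exact fun _ => Or.inl ⟨rfl, rfl⟩
    | succ i ih =>
      intro hi
      have hM := hf (x i) ((ih (by omega)).imp And.left id)
      rw [← hxs] at hM
      exact Or.inr ((next _ _ hM).resolve_right (hj _ (Nat.succ_pos i) hi))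
  have hM : ∀ j, (∀ i, 0 < i → i < j → x i ≠ b) → ∀ i, i < j → M (x i) (x (i + 1)) := by
    intro j hj i hi
    rw [hxs]
    exact hf _ ((hp j hj i hi).imp And.left id)
  -- A coincidence of two positions is traced back along the injective relation until one of them is
  -- the start. But the walk cannot return to `a`, which differs from `b` and violates `p`.
  have hinj : ∀ j, (∀ i, 0 < i → i < j → x i ≠ b) → ∀ i' ≤ j, (x i' = b ∨ i' < j) →
      ∀ i, i < i' → x i ≠ x i' := by
    intro j hj i'
    induction i' with
    | zero => intro _ _ i hi; omega
    | succ i' ih =>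
      intro hi' hb i hi he
      cases i with
      | zero =>
        rcases hb with hb | hb
        · exact hab (by rw [← hx0, he, hb])
        · rcases hp j hj _ hb with ⟨-, h⟩ | h
          · omega
          · rw [← he] at h; exact ha h
      | succ i =>
        refine ih (by omega) (Or.inr (by omega)) i (by omega) (inj _ _ (x (i' + 1)) ?_ ?_)
        · rw [← he]; exact hM j hj i (by omega)
        · exact hM j hj i' (by omega)
  -- A walk that never met `b` would be an injective sequence in a finite type.
  have hex : ∃ j, 0 < j ∧ x j = b := by
    by_contra hc
    push Not at hc
    refine not_injective_infinite_finite x fun i i' he => ?_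
    rcases lt_trichotomy i i' with h | h | h
    · exact absurd he (hinj (i' + 1) (fun i hi _ => hc i hi) i' (by omega) (Or.inr (by omega)) i h)
    · exact h
    · exact absurd he.symm
        (hinj (i + 1) (fun i hi _ => hc i hi) i (by omega) (Or.inr (by omega)) i' h)
  obtain ⟨hj0, hjb⟩ := Nat.find_spec hex
  set j := Nat.find hex with hj
  have hmin : ∀ i, 0 < i → i < j → x i ≠ b := fun i h0 hi he => Nat.find_min hex hi ⟨h0, he⟩
  have hpath : IsDirPath G a b ((List.range (j + 1)).map x) := by
    refine ⟨?_, ?_, ?_, ?_⟩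
    · rw [List.isChain_map, List.isChain_range]
      intro i hi
      exact hG _ _ (hM j hmin i (by omega))
    · refine List.Nodup.map_on ?_ List.nodup_range
      intro i hi i' hi' he
      rw [List.mem_range] at hi hi'
      have key : ∀ i' < j + 1, ∀ i < i', x i ≠ x i' := fun i' hi' i hi => by
        refine hinj j hmin i' (by omega) ?_ i hi
        rcases Nat.lt_succ_iff_lt_or_eq.1 hi' with h | h
        · exact Or.inr h
        · exact Or.inl (by rw [h, hjb])
      rcases lt_trichotomy i i' with h | h | h
      · exact absurd he (key i' hi' i h)
      · exact h
      · exact absurd he.symm (key i hi i' h)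
    · simp [List.range_succ_eq_map, hx0]
    · simp [List.range_succ, hjb]
  refine ⟨_, hpath, fun y hy => ?_⟩
  obtain ⟨hy, hya, hyb⟩ := hpath.mem_internal_iff.1 hy
  obtain ⟨i, hi, rfl⟩ := List.mem_map.1 hy
  rw [List.mem_range] at hi
  have hij : i ≠ j := by rintro rfl; exact hyb hjb
  rcases hp j hmin i (by omega) with ⟨h, -⟩ | h
  · exact absurd h hya
  · exact h

end Paths

variable {k l m n : ℕ} {arc : Fin l → Fin k × Fin k} {H : Digraph (Fin k)} {T : Digraph (Fin n)}

/-- The arcs of `H` are listed by `arc`. -/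
structure ArcList (H : Digraph (Fin k)) (arc : Fin l → Fin k × Fin k) : Prop where
  simple : Simple H
  inj : Function.Injective arc
  adj : ∀ u v, H.Adj u v ↔ ∃ e, arc e = (u, v)

theorem ArcList.ne (h : ArcList H arc) (e : Fin l) : (arc e).1 ≠ (arc e).2 := by
  intro he
  refine h.simple (arc e).1 ((h.adj _ _).2 ⟨e, ?_⟩)
  exact Prod.ext rfl he.symm

theorem ArcList.adj_arc (h : ArcList H arc) (e : Fin l) : H.Adj (arc e).1 (arc e).2 :=
  (h.adj _ _).2 ⟨e, rfl⟩

/-- Labels and arcs that satisfy the following conditions describe an expansion. -/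
theorem topologicallyContained_of_labels (hH : ArcList H arc) {lab : Fin n → ℕ}
    {M : Fin l → Fin n → Fin n → Prop}
    (adj : ∀ e u w, M e u w → T.Adj u w ∧ OutLabel arc e (lab u) ∧ InLabel arc e (lab w))
    (inj : ∀ e u u' w, M e u w → M e u' w → u = u')
    (uniq : ∀ u w, lab u = lab w → l < lab u → u = w)
    (surj : ∀ h : Fin k, ∃ v, lab v = l + 1 + h)
    (out : ∀ v, ∀ e : Fin l, lab v = e + 1 → ∃ w, M e v w)
    (start : ∀ e, ∃ v w, lab v = l + 1 + (arc e).1 ∧ M e v w) :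
    TopologicallyContained H T := by
  classical
  choose vert hvert using surj
  have hvu : ∀ v, ∀ h : Fin k, lab v = l + 1 + h → v = vert h := fun v h hv =>
    uniq _ _ (hv.trans (hvert h).symm) (by omega)
  have hpath : ∀ e, ∃ P, IsDirPath T (vert (arc e).1) (vert (arc e).2) P ∧
      ∀ x ∈ internalVertices P, lab x = e + 1 := by
    intro e
    refine exists_isDirPath_of_rel (M := M e) (fun u w h => (adj e u w h).1) (inj e) ?_
      (fun v hv => out v e hv) ?_ ?_ ?_
    · obtain ⟨v, w, hv, hM⟩ := start e
      rw [← hvu v _ hv]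
      exact ⟨w, hM⟩
    · intro u w hM
      exact (adj e u w hM).2.2.imp id fun h => hvu _ _ h
    · rw [hvert]; omega
    · intro he
      have := congrArg lab he
      rw [hvert, hvert] at this
      exact hH.ne e (Fin.ext (by omega))
  choose path hpath hint using hpath
  -- An expansion indexes paths by pairs of vertices, here they are indexed by positions in the arc
  -- list. The labels of the internal vertices determine the position, and this yields disjointness.
  refine ⟨⟨vert, fun u v => if h : ∃ e, arc e = (u, v) then path h.choose else [], ?_, ?_, ?_, ?_⟩⟩
  · intro h h' he
    have := congrArg lab he
    rw [hvert, hvert] at this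
    exact Fin.ext (by omega)
  · intro u v huv
    have h := (hH.adj u v).1 huv
    rw [dif_pos h]
    have := hpath h.choose
    rwa [h.choose_spec] at this
  · intro u v huv x hx z hz
    have h := (hH.adj u v).1 huv
    rw [dif_pos h] at hx
    have := hint _ x hx
    rw [← hz, hvert] at this
    omega
  · intro u v u' v' huv huv' hne x hx hx'
    have h := (hH.adj u v).1 huv
    have h' := (hH.adj u' v').1 huv'
    rw [dif_pos h] at hx
    rw [dif_pos h'] at hx'
    have h1 := hint _ x hx
    have h2 := hint _ x hx'
    have he : h.choose = h'.choose := Fin.ext (by omega)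
    exact hne (by rw [← h.choose_spec, he, h'.choose_spec])

/-- An expansion yields a solution. -/
theorem exists_solution (hH : ArcList H arc) (h : TopologicallyContained H T) :
    ∃ lab M, Solution arc T lab M := by
  classical
  obtain ⟨E⟩ := h
  -- Shortening keeps the ends and adds no vertices, so internal vertices of the new path were
  -- internal before, and disjointness persists.
  have hQ : ∀ e, ∃ Q, IsDirPath T (E.vert (arc e).1) (E.vert (arc e).2) Q ∧
      (∀ x ∈ internalVertices Q, x ∈ internalVertices (E.path (arc e).1 (arc e).2)) ∧
      ∀ i j x y, i + 1 < j → Q[i]? = some x → Q[j]? = some y → ¬ T.Adj x y := by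
    intro e
    have hP := E.isDirPath _ _ (hH.adj_arc e)
    obtain ⟨Q, h1, h2, h3⟩ := hP.exists_chordless
    refine ⟨Q, h1, fun x hx => ?_, h3⟩
    rw [h1.mem_internal_iff] at hx
    rw [hP.mem_internal_iff]
    exact ⟨h2 x hx.1, hx.2⟩
  choose Q hQ hQi hQc using hQ
  have hdis : ∀ e e' x, x ∈ internalVertices (Q e) → x ∈ internalVertices (Q e') → e = e' := by
    intro e e' x hx hx'
    by_contra hne
    exact E.internal_disjoint _ _ _ _ (hH.adj_arc e) (hH.adj_arc e')
      (fun h => hne (hH.inj (by simpa using h))) x (hQi e x hx) (hQi e' x hx')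
  have hvi : ∀ e h, E.vert h ∉ internalVertices (Q e) := fun e h hx =>
    E.internal_not_vert _ _ (hH.adj_arc e) _ (hQi e _ hx) h rfl
  have hlab : ∀ v, ∃ x : ℕ, x ≤ l + k ∧ (∀ h, x = l + 1 + h.val ↔ v = E.vert h) ∧
      ∀ e : Fin l, x = e + 1 ↔ v ∈ internalVertices (Q e) := by
    intro v
    by_cases h1 : ∃ h, v = E.vert h
    · obtain ⟨h, rfl⟩ := h1
      refine ⟨l + 1 + h, by omega, fun h' => ?_, fun e => ?_⟩
      · rw [E.vert_injective.eq_iff, Fin.ext_iff]; omega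
      · exact ⟨fun h => by omega, fun hx => absurd hx (hvi e h)⟩
    by_cases h2 : ∃ e, v ∈ internalVertices (Q e)
    · obtain ⟨e, he⟩ := h2
      refine ⟨e + 1, by omega, fun h' => ?_, fun e' => ?_⟩
      · exact ⟨fun h => by omega, fun h => absurd ⟨h', h⟩ h1⟩
      · constructor
        · intro hee
          obtain rfl : e = e' := Fin.ext (by omega)
          exact he
        · intro he'
          rw [hdis e e' v he he']
    · push Not at h1 h2
      exact ⟨0, by omega, fun h => ⟨fun h => by omega, fun hv => absurd hv (h1 h)⟩,
        fun e => ⟨fun h => by omega, fun hv => absurd hv (h2 e)⟩⟩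
  choose lab hle hlv hli using hlab
  have hidx : ∀ (e : Fin l) (i j : ℕ) (x : Fin n), (Q e)[i]? = some x → (Q e)[j]? = some x → i = j := by
    intro e i j x hi hj
    obtain ⟨hi', -⟩ := List.getElem?_eq_some_iff.1 hi
    exact (List.getElem?_inj hi' (hQ e).nodup).1 (hi.trans hj.symm)
  have hfirst : ∀ e, (Q e)[0]? = some (E.vert (arc e).1) := fun e => by
    rw [← List.head?_eq_getElem?]; exact (hQ e).first
  have hlast : ∀ e, (Q e)[(Q e).length - 1]? = some (E.vert (arc e).2) := fun e => by
    rw [← List.getLast?_eq_getElem?]; exact (hQ e).last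
  have hlen : ∀ e, 2 ≤ (Q e).length := by
    intro e
    by_contra hc
    obtain ⟨h0, -⟩ := List.getElem?_eq_some_iff.1 (hfirst e)
    have h1 := hlast e
    rw [show (Q e).length - 1 = 0 by omega, hfirst e] at h1
    exact hH.ne e (E.vert_injective (by simpa using h1))
  have hsome : ∀ (e : Fin l) (i : ℕ), i < (Q e).length → ∃ x, (Q e)[i]? = some x := fun e i hi =>
    ⟨_, List.getElem?_eq_getElem hi⟩
  refine ⟨lab, fun e u w => ∃ i, (Q e)[i]? = some u ∧ (Q e)[i + 1]? = some w,
    ?_, ?_, ?_, ?_, ?_, hle, ?_, ?_, ?_, ?_⟩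
  · rintro e u w ⟨i, hu, hw⟩
    obtain ⟨hi, hu'⟩ := List.getElem?_eq_some_iff.1 hu
    obtain ⟨hi', hw'⟩ := List.getElem?_eq_some_iff.1 hw
    refine ⟨?_, ?_, ?_⟩
    · rw [← hu', ← hw']
      exact (hQ e).chain.getElem i hi'
    · by_cases hua : u = E.vert (arc e).1
      · exact Or.inr ((hlv u _).2 hua)
      · refine Or.inl ((hli u e).2 ((hQ e).mem_internal_iff.2
          ⟨List.mem_iff_getElem?.2 ⟨i, hu⟩, hua, ?_⟩))
        rintro rfl
        have := hidx e _ _ _ hu (hlast e)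
        omega
    · by_cases hwb : w = E.vert (arc e).2
      · exact Or.inr ((hlv w _).2 hwb)
      · refine Or.inl ((hli w e).2 ((hQ e).mem_internal_iff.2
          ⟨List.mem_iff_getElem?.2 ⟨i + 1, hw⟩, ?_, hwb⟩))
        rintro rfl
        have := hidx e _ _ _ hw (hfirst e)
        omega
  · rintro e u w w' ⟨i, hu, hw⟩ ⟨i', hu', hw'⟩
    obtain rfl := hidx e _ _ _ hu hu'
    exact Option.some_injective _ (hw.symm.trans hw')
  · rintro e u u' w ⟨i, hu, hw⟩ ⟨i', hu', hw'⟩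
    obtain rfl : i = i' := by have := hidx e _ _ _ hw hw'; omega
    exact Option.some_injective _ (hu.symm.trans hu')
  · intro u w huw hu
    have h1 := hle u
    have h2 := (hlv u ⟨lab u - (l + 1), by omega⟩).1 (by simp only; omega)
    have h3 := (hlv w ⟨lab u - (l + 1), by omega⟩).1 (by simp only; omega)
    exact h2.trans h3.symm
  · exact fun h => ⟨E.vert h, (hlv _ h).2 rfl⟩
  · intro v e hv
    obtain ⟨hv1, hva, hvb⟩ := (hQ e).mem_internal_iff.1 ((hli v e).1 hv)
    obtain ⟨i, hi⟩ := List.mem_iff_getElem?.1 hv1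
    obtain ⟨hi', -⟩ := List.getElem?_eq_some_iff.1 hi
    have hne : i ≠ (Q e).length - 1 := by
      rintro rfl
      exact hvb (Option.some_injective _ (hi.symm.trans (hlast e)))
    obtain ⟨w, hw⟩ := hsome e (i + 1) (by omega)
    exact ⟨w, i, hi, hw⟩
  · intro v e hv
    obtain rfl := (hlv v _).1 hv
    obtain ⟨w, hw⟩ := hsome e 1 (hlen e)
    exact ⟨w, 0, hfirst e, hw⟩
  · intro v e hv
    obtain rfl := (hlv v _).1 hv
    have := hlen e
    obtain ⟨u, hu⟩ := hsome e ((Q e).length - 2) (by omega)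
    refine ⟨u, _, hu, ?_⟩
    rw [show (Q e).length - 2 + 1 = (Q e).length - 1 by omega]
    exact hlast e
  -- If the arc at position i precedes the one at i', the pair (u, x') skips from i to i' + 1, so as
  -- an arc it would be a forward chord.
  · rintro e u x u' x' ⟨i, hu, hx⟩ ⟨i', hu', hx'⟩ hne
    rcases lt_trichotomy i i' with h | rfl | h
    · exact Or.inl (hQc e i (i' + 1) u x' (by omega) hu hx')
    · exact absurd (Option.some_injective _ (hu.symm.trans hu')) hne
    · exact Or.inr (hQc e i' (i + 1) u' x (by omega) hu' hx)

/-- When all vertices are forgotten, the accepting state decides topological containment. -/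
theorem Correct.accept_iff (hH : ArcList H arc) {F : Set (Fin n)} {sl : Fin m → Option (Fin n)}
    {S : Set (DState k l m)} (h : Correct arc T F sl S) (hF : ∀ v, v ∈ F) {d : DState k l m}
    (hd : ∀ a, d a = match a with | .start _ => 1 | .fin _ => 1 | .placed _ => 1 | _ => 0) :
    d ∈ S ↔ TopologicallyContained H T := by
  constructor
  · intro hdS
    obtain ⟨lab, M, hp⟩ := h.sound d hdS
    exact topologicallyContained_of_labels hH hp.adj hp.inj hp.uniq
      (fun h => hp.placed h (by simp [hd])) (fun v e hv => hp.outF v (hF v) e hv)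
      (fun e => hp.start e (by simp [hd]))
  · intro hT
    obtain ⟨lab, M, g⟩ := exists_solution hH hT
    have := h.complete lab M g
    convert this using 1
    have hseen : ∀ v, Seen F sl v := fun v => Or.inl (hF v)
    have hsl : ∀ s v, sl s ≠ some v := fun s v hs => h.ok.disj s v hs (hF v)
    funext a
    rw [hd]
    cases a with
    | start e =>
      obtain ⟨v, hv⟩ := g.surj (arc e).1
      obtain ⟨w, hw⟩ := g.start v e hv
      exact (ind_of ⟨v, w, hv, hw, hseen _, hseen _⟩).symm
    | fin e =>
      obtain ⟨v, hv⟩ := g.surj (arc e).2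
      exact (ind_of ⟨v, hv, Or.inl ⟨hF v, g.fin v e hv⟩⟩).symm
    | placed h =>
      obtain ⟨v, hv⟩ := g.surj h
      exact (ind_of ⟨v, hseen v, hv⟩).symm
    | pend e =>
      refine (ind_of_not ?_).symm
      rintro ⟨x, ⟨-, u, hu⟩, hx⟩
      -- When everything has been seen, all arcs of the solution are chosen, so no promise is
      -- outstanding.
      exact hx u ⟨hu, hseen _, hseen _⟩
    | inn s => exact (ind_of_not fun ⟨v, _, hs, _⟩ => hsl s v hs).symm
    | out s => exact (ind_of_not fun ⟨v, _, _, hs, _⟩ => hsl s v hs).symm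
    | lab s =>
      have : sl s = none := Option.eq_none_iff_forall_ne_some.2 (hsl s)
      simp [stateOf, this]

/-- Initially, the zero state is the only one. -/
theorem correct_init : Correct arc T ∅ (fun _ : Fin m => none) {fun _ => 0} where
  ok := ⟨by simp, by simp⟩
  sep := by simp [Separated]
  sound := by
    rintro d rfl
    refine ⟨fun _ => 0, fun _ _ _ => False, ?_⟩
    constructor <;> simp
    omega
  complete lab M g := by
    have hseen : ∀ v, ¬ Seen (∅ : Set (Fin n)) (fun _ : Fin m => none) v := by simp [Seen]
    rw [Set.mem_singleton_iff]
    funext a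
    cases a <;> simp only [stateOf, seenArcs, promises, hseen] <;> first
      | exact ind_of_not (by simp)
      | rfl

end TopDP

/-! ### Programs for the moves, and the arithmetic of reading digits -/

namespace TopDP

open WordRAM

/-- The bit of the code in variable `c` at position `i`. -/
def bitEx (i : Ex) : Ex := (Var.c / .get .wt i) % 2

/-- The label of slot `s` in the code in variable `c`. -/
def labEx (s : Var) : Ex := (Var.c / .get .wt (Var.nb + s)) % Var.R

/-- If the vertex in slot `s` may be the tail of an arc of the path of `e`, the flag `f` is set, and the
position of the relevant digit is stored in `i`. -/
def selectOut (s : Var) : Stmt :=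
  .set .f 0 ;; .set .x (labEx s) ;;
  .ite (.ne Var.x (Var.e + 1))
    (.ite (.ne Var.x (Var.l + 1 + .get .arcs (2 * Var.e))) .skip (.set .i Var.e ;; .set .f 1))
    (.set .i (3 * Var.l + Var.k + Var.m + s) ;; .set .f 1)

/-- If the vertex in slot `s` may be the head of an arc of the path of `e`, the flag `g` is set, and the
position of the relevant digit is stored in `j`. -/
def selectIn (s : Var) : Stmt :=
  .set .g 0 ;; .set .y (labEx s) ;;
  .ite (.ne Var.y (Var.e + 1))
    (.ite (.ne Var.y (Var.l + 1 + .get .arcs (2 * Var.e + 1))) .skip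
      (.set .j (Var.l + Var.e) ;; .set .g 1))
    (.set .j (3 * Var.l + Var.k + s) ;; .set .g 1)

/-- The position of the digit `pend e`. -/
def pendEx : Ex := 2 * Var.l + Var.k + Var.e

def arcBody : Stmt :=
  .set .d Var.N ;; selectOut .s1 ;; selectIn .s2 ;;
  .ite Var.f (.ite Var.g (.ite (bitEx Var.i) .skip (.ite (bitEx Var.j) .skip
    (.set .d (Var.c + .get .wt Var.i + .get .wt Var.j)))) .skip) .skip

def takeBody : Stmt :=
  .set .d Var.N ;; selectOut .s1 ;;
  .ite Var.f (.ite (bitEx Var.i) .skip (.ite (bitEx pendEx)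
    (.set .d (Var.c + .get .wt Var.i - .get .wt pendEx)) .skip)) .skip

def leaveBody : Stmt :=
  .set .d Var.N ;; selectIn .s2 ;;
  .ite Var.g (.ite (bitEx Var.j) .skip (.ite (bitEx pendEx) .skip
    (.set .d (Var.c + .get .wt Var.j + .get .wt pendEx)))) .skip

def labelBody : Stmt :=
  .set .d Var.N ;;
  .ite (labEx .s1) .skip (.ite (.lt Var.l Var.lam)
    (.set .i (2 * Var.l + (Var.lam - (Var.l + 1))) ;;
      .ite (bitEx Var.i) .skip
        (.set .d (Var.c + Var.lam * .get .wt (Var.nb + Var.s1) + .get .wt Var.i)))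
    (.set .d (Var.c + Var.lam * .get .wt (Var.nb + Var.s1))))

def clearBody : Stmt :=
  .set .d Var.N ;; .set .x (labEx .s2) ;;
  .set .i (3 * Var.l + Var.k + Var.s2) ;; .set .j (3 * Var.l + Var.k + Var.m + Var.s2) ;;
  .ite Var.x (.ite (.lt Var.l Var.x) (.set .f 1) (.set .f (bitEx Var.j))) (.set .f 1) ;;
  .ite Var.f (.set .d (Var.c - Var.x * .get .wt (Var.nb + Var.s2) -
    bitEx Var.i * .get .wt Var.i - bitEx Var.j * .get .wt Var.j)) .skip

/-- For every code in the table, the body computes the code of the resulting state, which is then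
entered into the table. If `keep` is zero, the given code is removed. -/
def pass (keep : ℕ) (body : Stmt) : Stmt :=
  .for_ .c .N (.ite (.get .tab Var.c)
    (body ;; .put .tab Var.c (.lit keep) ;; .put .tab Var.d 1) .skip)

variable {k l m n : ℕ}

/-- The variables and arrays that do not change after the preparation. -/
structure Ctx (arc : Fin l → Fin k × Fin k) (T : Digraph (Fin n)) (m : ℕ) (σ : HState) : Prop where
  regk : σ.reg .k = k
  regl : σ.reg .l = l
  regn : σ.reg .n = n
  regm : σ.reg .m = m
  regnb : σ.reg .nb = numBits k l m
  regN : σ.reg .N = numCodes k l m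
  regR : σ.reg .R = k + l + 1
  tail : ∀ e : Fin l, σ.mem .arcs (2 * e) = (arc e).1
  head : ∀ e : Fin l, σ.mem .arcs (2 * e + 1) = (arc e).2
  mat : ∀ u v : Fin n, σ.mem .mat (u * n + v) ≠ 0 ↔ T.Adj u v
  wt : ∀ i ≤ numBits k l m + m, σ.mem .wt i = weight (radix k l m) i

/-- Words are large enough. -/
structure WordOK (k l n m B : ℕ) : Prop where
  codes : 4 * (numCodes k l m + numBits k l m + m + k + l + 10) ≤ B
  mat : (n + 1) * (n + 1) ≤ B

/-- `S` does not change the context. -/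
def keepsCtx (S : Stmt) : Bool :=
  [Var.k, .l, .n, .m, .nb, .N, .R].all (fun x => !S.wr x) &&
    [Arr.arcs, .mat, .wt].all (fun a => !S.st a)

section
variable {arc : Fin l → Fin k × Fin k} {T : Digraph (Fin n)} {σ σ' : HState} {B : ℕ}

theorem Ctx.congr (h : Ctx arc T m σ)
    (hr : ∀ x ∈ [Var.k, .l, .n, .m, .nb, .N, .R], σ'.reg x = σ.reg x)
    (hm : ∀ a ∈ [Arr.arcs, .mat, .wt], σ'.mem a = σ.mem a) : Ctx arc T m σ' := by
  simp only [List.mem_cons, List.not_mem_nil, or_false, forall_eq_or_imp, forall_eq] at hr hm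
  obtain ⟨r1, r2, r3, r4, r5, r6, r7⟩ := hr
  obtain ⟨m1, m2, m3⟩ := hm
  constructor <;> simp only [r1, r2, r3, r4, r5, r6, r7, m1, m2, m3]
  exacts [h.regk, h.regl, h.regn, h.regm, h.regnb, h.regN, h.regR, h.tail, h.head, h.mat, h.wt]

theorem Ctx.same (h : Ctx arc T m σ) {S : Stmt} (hs : Same S σ σ') (hS : keepsCtx S = true) :
    Ctx arc T m σ' := by
  simp only [keepsCtx, Bool.and_eq_true, List.all_eq_true, Bool.not_eq_true'] at hS
  exact h.congr (fun x hx => hs.reg x (hS.1 x hx)) fun a ha => hs.mem a (hS.2 a ha)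

theorem Ctx.setReg (h : Ctx arc T m σ) {x : Var} {a : ℕ}
    (hx : x ∉ [Var.k, .l, .n, .m, .nb, .N, .R]) : Ctx arc T m (σ.setReg x a) :=
  h.congr (fun y hy => by
    have : y ≠ x := by rintro rfl; exact hx hy
    simp [this]) fun _ _ => rfl

theorem Ctx.wt_num (h : Ctx arc T m σ) (a : Ix k l m) : σ.mem .wt a.num = a.weight :=
  h.wt _ a.num_lt.le

theorem val_bitEx (h : Ctx arc T m σ) {i : Ex} {a : Ix k l m} (hi : i.val σ = a.num)
    (ha : a.rad = 2) : (bitEx i).val σ = view k l m (σ.reg .c) a := by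
  simp only [bitEx, Ex.val_mod, Ex.val_div, Ex.val_get, Ex.val_var, Ex.val_two, hi, h.wt_num,
    view_apply, ha]

theorem ok_bitEx (hB : WordOK k l n m B) (hc : σ.reg .c < numCodes k l m) {i : Ex}
    (hi : i.ok B σ) : (bitEx i).ok B σ := by
  have := hB.codes
  have h1 := Nat.div_le_self (σ.reg .c) (σ.mem .wt (i.val σ))
  have h2 := Nat.mod_lt (σ.reg .c / σ.mem .wt (i.val σ)) (show 0 < 2 by norm_num)
  simp only [bitEx, Ex.ok_mod, Ex.ok_div, Ex.ok_get, Ex.ok_var, Ex.ok_two, hi, Ex.val_div,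
    Ex.val_get, Ex.val_var, Ex.val_two, true_and]
  omega

theorem val_labEx (h : Ctx arc T m σ) {x : Var} {s : Fin m} (hx : σ.reg x = s) :
    (labEx x).val σ = view k l m (σ.reg .c) (.lab s) := by
  have h1 := h.wt_num (.lab s)
  simp only [Ix.num] at h1
  simp only [labEx, Ex.val_mod, Ex.val_div, Ex.val_get, Ex.val_var, Ex.val_add, h.regnb, hx, h.regR,
    view_apply, numBits, h1, Ix.rad_lab]

theorem ok_labEx (hB : WordOK k l n m B) (h : Ctx arc T m σ) (hc : σ.reg .c < numCodes k l m)
    {x : Var} {s : Fin m} (hx : σ.reg x = s) : (labEx x).ok B σ := by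
  have := hB.codes
  have hs := s.2
  have h1 := Nat.div_le_self (σ.reg .c) (σ.mem .wt (numBits k l m + s))
  have h2 := Nat.mod_lt (σ.reg .c / σ.mem .wt (numBits k l m + s)) (show 0 < k + l + 1 by omega)
  simp only [labEx, Ex.ok_mod, Ex.ok_div, Ex.ok_get, Ex.ok_var, Ex.ok_add, Ex.val_div,
    Ex.val_get, Ex.val_var, Ex.val_add, true_and, h.regnb, hx, h.regR]
  omega

/-- The arbitrary postcondition `Q` lets the bodies below continue after the selection knowing only
the changed registers, the flag and the position. -/
theorem wp_selectOut (hB : WordOK k l n m B) (h : Ctx arc T m σ)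
    (hc : σ.reg .c < numCodes k l m) {x : Var} {s : Fin m} (hx : σ.reg x = s)
    (hxs : x ∉ [Var.x, .i, .f, .c]) {e : Fin l} (he : σ.reg .e = e) {Q : HState → Prop}
    (hQ : ∀ σ', (∀ y, y ∉ [Var.x, .i, .f] → σ'.reg y = σ.reg y) → σ'.mem = σ.mem →
      (σ'.reg .f = 0 ∧ (∀ a, ¬ OutAt arc (view k l m (σ.reg .c)) s e a) ∨
        σ'.reg .f ≠ 0 ∧ ∃ a, OutAt arc (view k l m (σ.reg .c)) s e a ∧ σ'.reg .i = a.num) → Q σ') :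
    (selectOut x).wp B Q σ := by
  have hb := hB.codes
  have hxf : x ≠ .f := by rintro rfl; simp at hxs
  have hxx : x ≠ .x := by rintro rfl; simp at hxs
  have hs := s.2
  have h1 := (arc e).1.2
  have he' := e.2
  have hnb : numBits k l m = 3 * l + k + 2 * m := rfl
  have hl := val_labEx (h.setReg (x := .f) (a := 0) (by simp)) (x := x) (s := s) (by simp [hx, hxf])
  have hlo := ok_labEx hB (h.setReg (x := .f) (a := 0) (by simp)) (by simpa using hc) (x := x)
    (s := s) (by simp [hx, hxf])
  simp only [HState.reg_setReg, reduceCtorEq, if_false] at hl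
  simp only [selectOut, Stmt.wp, Ex.ok_ne _ _ _ _ (show 1 < B by omega), hl, hlo, true_and,
    Ex.val_ne_eq_zero, Ex.ok_zero, Ex.ok_add, Ex.ok_mul, Ex.ok_var, Ex.ok_get, Ex.ok_one, Ex.ok_two,
    Ex.ok_three, Ex.val_add, Ex.val_mul, Ex.val_var, Ex.val_zero, Ex.val_one, Ex.val_two,
    Ex.val_three, Ex.val_get, HState.reg_setReg, HState.mem_setReg, reduceCtorEq, if_false,
    if_true, he, h.regl, h.regk, h.regm, h.tail, hx, hxf, hxx, ne_eq]
  refine ⟨by omega, ⟨by omega, by omega⟩, fun hne => ⟨by omega, fun hne' => ?_, fun heq => ?_⟩,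
    fun heq => ?_⟩
  · refine hQ _ ?_ rfl (Or.inl ⟨by simp, ?_⟩)
    · intro y hy
      simp only [List.mem_cons, List.not_mem_nil, or_false, not_or] at hy
      simp [hy]
    · rintro a (⟨ha, -⟩ | ⟨ha, -⟩)
      · exact hne ha
      · exact hne' ha
  · refine ⟨by omega, hQ _ ?_ rfl (Or.inr ⟨by simp, .start e, Or.inr ⟨heq, rfl⟩, by simp [Ix.num]⟩)⟩
    intro y hy
    simp only [List.mem_cons, List.not_mem_nil, or_false, not_or] at hy
    simp [hy]
  · refine ⟨by omega, by omega, hQ _ ?_ rfl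
      (Or.inr ⟨by simp, .out s, Or.inl ⟨heq, rfl⟩, by simp [Ix.num]⟩)⟩
    intro y hy
    simp only [List.mem_cons, List.not_mem_nil, or_false, not_or] at hy
    simp [hy]

theorem wp_selectIn (hB : WordOK k l n m B) (h : Ctx arc T m σ)
    (hc : σ.reg .c < numCodes k l m) {x : Var} {s : Fin m} (hx : σ.reg x = s)
    (hxs : x ∉ [Var.y, .j, .g, .c]) {e : Fin l} (he : σ.reg .e = e) {Q : HState → Prop}
    (hQ : ∀ σ', (∀ y, y ∉ [Var.y, .j, .g] → σ'.reg y = σ.reg y) → σ'.mem = σ.mem →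
      (σ'.reg .g = 0 ∧ (∀ a, ¬ InAt arc (view k l m (σ.reg .c)) s e a) ∨
        σ'.reg .g ≠ 0 ∧ ∃ a, InAt arc (view k l m (σ.reg .c)) s e a ∧ σ'.reg .j = a.num) → Q σ') :
    (selectIn x).wp B Q σ := by
  have hb := hB.codes
  have hxf : x ≠ .g := by rintro rfl; simp at hxs
  have hxx : x ≠ .y := by rintro rfl; simp at hxs
  have hs := s.2
  have h1 := (arc e).2.2
  have he' := e.2
  have hnb : numBits k l m = 3 * l + k + 2 * m := rfl
  have hl := val_labEx (h.setReg (x := .g) (a := 0) (by simp)) (x := x) (s := s) (by simp [hx, hxf])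
  have hlo := ok_labEx hB (h.setReg (x := .g) (a := 0) (by simp)) (by simpa using hc) (x := x)
    (s := s) (by simp [hx, hxf])
  simp only [HState.reg_setReg, reduceCtorEq, if_false] at hl
  simp only [selectIn, Stmt.wp, Ex.ok_ne _ _ _ _ (show 1 < B by omega), hl, hlo, true_and,
    Ex.val_ne_eq_zero, Ex.ok_zero, Ex.ok_add, Ex.ok_mul, Ex.ok_var, Ex.ok_get, Ex.ok_one, Ex.ok_two,
    Ex.ok_three, Ex.val_add, Ex.val_mul, Ex.val_var, Ex.val_zero, Ex.val_one, Ex.val_two,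
    Ex.val_three, Ex.val_get, HState.reg_setReg, HState.mem_setReg, reduceCtorEq, if_false,
    if_true, he, h.regl, h.regk, h.head, hx, hxf, hxx, ne_eq]
  refine ⟨by omega, ⟨by omega, by omega⟩, fun hne => ⟨by omega, fun hne' => ?_, fun heq => ?_⟩,
    fun heq => ?_⟩
  · refine hQ _ ?_ rfl (Or.inl ⟨by simp, ?_⟩)
    · intro y hy
      simp only [List.mem_cons, List.not_mem_nil, or_false, not_or] at hy
      simp [hy]
    · rintro a (⟨ha, -⟩ | ⟨ha, -⟩)
      · exact hne ha
      · exact hne' ha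
  · refine ⟨by omega, by omega,
      hQ _ ?_ rfl (Or.inr ⟨by simp, .fin e, Or.inr ⟨heq, rfl⟩, by simp [Ix.num]⟩)⟩
    intro y hy
    simp only [List.mem_cons, List.not_mem_nil, or_false, not_or] at hy
    simp [hy]
  · refine ⟨by omega, by omega, hQ _ ?_ rfl
      (Or.inr ⟨by simp, .inn s, Or.inl ⟨heq, rfl⟩, by simp [Ix.num]⟩)⟩
    intro y hy
    simp only [List.mem_cons, List.not_mem_nil, or_false, not_or] at hy
    simp [hy]

end

end TopDP

/-! ### Correctness of the loop-free bodies -/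

namespace TopDP

open WordRAM

variable {k l m n : ℕ} {arc : Fin l → Fin k × Fin k} {T : Digraph (Fin n)} {σ σ' : HState} {B : ℕ}

/-- Variable `d` holds the code of a result of a move of the state with code `c`, if there is one. -/
def IsResult (m : ℕ) (R : DState k l m → DState k l m → Prop) (c : ℕ) (σ : HState) : Prop :=
  σ.reg .d < numCodes k l m ∧ R (view k l m c) (view k l m (σ.reg .d)) ∨
    σ.reg .d = numCodes k l m ∧ ∀ d', ¬ R (view k l m c) d'

theorem OutAt.rad {d : DState k l m} {s : Fin m} {e : Fin l} {a : Ix k l m}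
    (h : OutAt arc d s e a) : a.rad = 2 := by
  rcases h with ⟨-, rfl⟩ | ⟨-, rfl⟩ <;> simp

theorem InAt.rad {d : DState k l m} {s : Fin m} {e : Fin l} {a : Ix k l m}
    (h : InAt arc d s e a) : a.rad = 2 := by
  rcases h with ⟨-, rfl⟩ | ⟨-, rfl⟩ <;> simp

theorem OutAt.unique {d : DState k l m} {s : Fin m} {e : Fin l} {a b : Ix k l m}
    (h : OutAt arc d s e a) (h' : OutAt arc d s e b) : a = b := by
  rcases h with ⟨h, rfl⟩ | ⟨h, rfl⟩ <;> rcases h' with ⟨h', rfl⟩ | ⟨h', rfl⟩ <;> first | rfl | omega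

theorem InAt.unique {d : DState k l m} {s : Fin m} {e : Fin l} {a b : Ix k l m}
    (h : InAt arc d s e a) (h' : InAt arc d s e b) : a = b := by
  rcases h with ⟨h, rfl⟩ | ⟨h, rfl⟩ <;> rcases h' with ⟨h', rfl⟩ | ⟨h', rfl⟩ <;> first | rfl | omega

/-- Outgoing arcs are recorded in `out` and `start`, incoming ones in `inn` and `fin`. The two
digits of an arc never coincide, so they can be set one after the other. -/
theorem outAt_ne_inAt {d d' : DState k l m} {s s' : Fin m} {e e' : Fin l} {a b : Ix k l m}
    (h : OutAt arc d s e a) (h' : InAt arc d' s' e' b) : b ≠ a := by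
  rcases h with ⟨h, rfl⟩ | ⟨h, rfl⟩ <;> rcases h' with ⟨h', rfl⟩ | ⟨h', rfl⟩ <;> simp

theorem OutAt.ne_pend {d : DState k l m} {s : Fin m} {e e' : Fin l} {a : Ix k l m}
    (h : OutAt arc d s e a) : .pend e' ≠ a := by
  rcases h with ⟨-, rfl⟩ | ⟨-, rfl⟩ <;> simp

theorem InAt.ne_pend {d : DState k l m} {s : Fin m} {e e' : Fin l} {a : Ix k l m}
    (h : InAt arc d s e a) : .pend e' ≠ a := by
  rcases h with ⟨-, rfl⟩ | ⟨-, rfl⟩ <;> simp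

theorem view_set_one {c : ℕ} {a : Ix k l m} (h : view k l m c a = 0) (ha : a.rad = 2) :
    view k l m (c + a.weight) = Function.update (view k l m c) a 1 := by
  have := view_add (c := c) (x := 1) (a := a) (by omega)
  simpa [h] using this

theorem set_one_lt {c : ℕ} {a : Ix k l m} (h : view k l m c a = 0) (ha : a.rad = 2)
    (hc : c < numCodes k l m) : c + a.weight < numCodes k l m := by
  have := add_lt_numCodes (c := c) (x := 1) (a := a) (by omega) hc
  simpa using this

theorem view_set_two {c : ℕ} {a b : Ix k l m} (h : view k l m c a = 0) (ha : a.rad = 2)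
    (h' : view k l m c b = 0) (hb : b.rad = 2) (hab : b ≠ a) (hc : c < numCodes k l m) :
    view k l m (c + a.weight + b.weight) =
        Function.update (Function.update (view k l m c) a 1) b 1 ∧
      c + a.weight < numCodes k l m ∧ c + a.weight + b.weight < numCodes k l m := by
  have h1 := view_set_one h ha
  have h2 := set_one_lt h ha hc
  have h3 : view k l m (c + a.weight) b = 0 := by
    rw [h1, Function.update_of_ne hab, h']
  exact ⟨by rw [view_set_one h3 hb, h1], h2, set_one_lt h3 hb h2⟩

/-- As in the other bodies, `d` starts as the number of codes, which is the code of no state, and is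
overwritten only if the move applies. Adding the weight of a binary digit that is zero sets it to
one. -/
theorem wp_arcBody (hB : WordOK k l n m B) (h : Ctx arc T m σ) {c : ℕ}
    (hc : c < numCodes k l m) (hrc : σ.reg .c = c) {s s' : Fin m} (hs : σ.reg .s1 = s)
    (hs' : σ.reg .s2 = s') {e : Fin l} (he : σ.reg .e = e) :
    arcBody.wp B (IsResult m (ArcMove arc s s' e) c) σ := by
  have hb := hB.codes
  refine ⟨trivial, wp_selectOut hB (h.setReg (by simp)) (by simpa [hrc] using hc) (s := s)
    (by simpa using hs) (by simp) (e := e) (by simpa using he) fun σ₁ hr₁ hm₁ hf₁ => ?_⟩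
  have h₁ : Ctx arc T m σ₁ := (h.setReg (x := .d) (by simp)).congr (fun x hx => hr₁ x (by
    simp only [List.mem_cons, List.not_mem_nil, or_false] at hx
    rcases hx with rfl | rfl | rfl | rfl | rfl | rfl | rfl <;> simp)) fun a _ => by rw [hm₁]
  have hc₁ : σ₁.reg .c = c := by rw [hr₁ _ (by simp)]; simpa using hrc
  refine wp_selectIn hB h₁ (by omega) (s := s') (by rw [hr₁ _ (by simp)]; simpa using hs')
    (by simp) (e := e) (by rw [hr₁ _ (by simp)]; simpa using he) fun σ₂ hr₂ hm₂ hf₂ => ?_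
  have h₂ : Ctx arc T m σ₂ := h₁.congr (fun x hx => hr₂ x (by
    simp only [List.mem_cons, List.not_mem_nil, or_false] at hx
    rcases hx with rfl | rfl | rfl | rfl | rfl | rfl | rfl <;> simp)) fun a _ => by rw [hm₂]
  have hc₂ : σ₂.reg .c = c := by rw [hr₂ _ (by simp), hc₁]
  have hd₂ : σ₂.reg .d = numCodes k l m := by
    rw [hr₂ _ (by simp), hr₁ _ (by simp)]; simpa using h.regN
  simp only [HState.reg_setReg, reduceCtorEq, if_false, hrc, hc₁] at hf₁ hf₂
  rw [← hr₂ .f (by simp)] at hf₁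
  have hokb : ∀ x : Var, (bitEx x).ok B σ₂ := fun x => ok_bitEx hB (by omega) trivial
  simp only [Stmt.wp, Ex.ok_var, Ex.val_var, hokb, true_and]
  rcases hf₁ with ⟨hf₁, hn⟩ | ⟨hf₁, a, ha, hia⟩
  · refine ⟨fun h => absurd hf₁ h, fun _ => Or.inr ⟨hd₂, ?_⟩⟩
    rintro d' ⟨i, j, hi, -⟩
    exact hn i hi
  refine ⟨fun _ => ?_, fun h => absurd h hf₁⟩
  rcases hf₂ with ⟨hf₂, hn⟩ | ⟨hf₂, b, hb', hib⟩
  · refine ⟨fun h => absurd hf₂ h, fun _ => Or.inr ⟨hd₂, ?_⟩⟩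
    rintro d' ⟨i, j, -, hj, -⟩
    exact hn j hj
  refine ⟨fun _ => ?_, fun h => absurd h hf₂⟩
  rw [← hr₂ .i (by simp)] at hia
  rw [val_bitEx h₂ (i := .var .i) hia ha.rad, val_bitEx h₂ (i := .var .j) hib hb'.rad, hc₂]
  refine ⟨fun hne => Or.inr ⟨hd₂, ?_⟩, fun hz => ⟨fun hne => Or.inr ⟨hd₂, ?_⟩, fun hz' => ?_⟩⟩
  · rintro d' ⟨i, j, hi, -, hi0, -⟩
    exact hne (ha.unique hi ▸ hi0)
  · rintro d' ⟨i, j, -, hj, -, hj0, -⟩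
    exact hne (hb'.unique hj ▸ hj0)
  · obtain ⟨h3, h4, h5⟩ := view_set_two hz ha.rad hz' hb'.rad (outAt_ne_inAt ha hb') hc
    simp only [Ex.ok_add, Ex.ok_var, Ex.ok_get, Ex.val_add, Ex.val_var, Ex.val_get, hia, hib,
      h₂.wt_num, hc₂]
    refine ⟨⟨⟨trivial, trivial, by omega⟩, trivial, by omega⟩, Or.inl ?_⟩
    simp only [HState.reg_setReg, if_true]
    exact ⟨h5, a, b, ha, hb', hz, hz', h3⟩

theorem wp_takeBody (hB : WordOK k l n m B) (h : Ctx arc T m σ) {c : ℕ}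
    (hc : c < numCodes k l m) (hrc : σ.reg .c = c) {s : Fin m} (hs : σ.reg .s1 = s)
    {e : Fin l} (he : σ.reg .e = e) :
    takeBody.wp B (IsResult m (TakeMove arc s e) c) σ := by
  have hb := hB.codes
  have hnb : numBits k l m = 3 * l + k + 2 * m := rfl
  have hel := e.2
  refine ⟨trivial, wp_selectOut hB (h.setReg (by simp)) (by simpa [hrc] using hc) (s := s)
    (by simpa using hs) (by simp) (e := e) (by simpa using he) fun σ₁ hr₁ hm₁ hf₁ => ?_⟩
  have h₁ : Ctx arc T m σ₁ := (h.setReg (x := .d) (by simp)).congr (fun x hx => hr₁ x (by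
    simp only [List.mem_cons, List.not_mem_nil, or_false] at hx
    rcases hx with rfl | rfl | rfl | rfl | rfl | rfl | rfl <;> simp)) fun a _ => by rw [hm₁]
  have hc₁ : σ₁.reg .c = c := by rw [hr₁ _ (by simp)]; simpa using hrc
  have he₁ : σ₁.reg .e = e := by rw [hr₁ _ (by simp)]; simpa using he
  have hd₁ : σ₁.reg .d = numCodes k l m := by
    rw [hr₁ _ (by simp)]; simpa using h.regN
  simp only [HState.reg_setReg, reduceCtorEq, if_false, hrc] at hf₁
  have hpok : pendEx.ok B σ₁ := by
    simp only [pendEx, Ex.ok_add, Ex.ok_mul, Ex.ok_var, Ex.ok_two, Ex.val_add, Ex.val_mul,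
      Ex.val_two, Ex.val_var, he₁, h₁.regl, h₁.regk, true_and]
    omega
  have hpv : pendEx.val σ₁ = (Ix.pend e : Ix k l m).num := by
    simp only [pendEx, Ex.val_add, Ex.val_mul, Ex.val_two, Ex.val_var, he₁, h₁.regl, h₁.regk,
      Ix.num]
  have hokb : ∀ x : Var, (bitEx x).ok B σ₁ := fun x => ok_bitEx hB (by omega) trivial
  have hokp : (bitEx pendEx).ok B σ₁ := ok_bitEx hB (by omega) hpok
  simp only [Stmt.wp, Ex.ok_var, Ex.val_var, hokb, hokp, true_and]
  rcases hf₁ with ⟨hf₁, hn⟩ | ⟨hf₁, a, ha, hia⟩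
  · refine ⟨fun h => absurd hf₁ h, fun _ => Or.inr ⟨hd₁, ?_⟩⟩
    rintro d' ⟨i, hi, -⟩
    exact hn i hi
  refine ⟨fun _ => ?_, fun h => absurd h hf₁⟩
  rw [val_bitEx h₁ (i := .var .i) hia ha.rad, val_bitEx h₁ hpv (by simp), hc₁]
  refine ⟨fun hne => Or.inr ⟨hd₁, ?_⟩, fun hz => ⟨fun hne => ?_, fun hz' => Or.inr ⟨hd₁, ?_⟩⟩⟩
  · rintro d' ⟨i, hi, hi0, -⟩
    exact hne (ha.unique hi ▸ hi0)
  · have h3 := view_set_one hz ha.rad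
    have h4 := set_one_lt hz ha.rad hc
    have h6 : view k l m c (.pend e) = 1 := by
      have := view_lt (k := k) (l := l) (m := m) c (.pend e)
      rw [Ix.rad_pend] at this
      omega
    -- The addition concerns another digit, so `pend e` is still one and the truncated subtraction
    -- is exact.
    have h5 : view k l m (c + a.weight) (.pend e) = 1 := by
      rw [h3, Function.update_of_ne ha.ne_pend, h6]
    have h7 := view_sub (c := c + a.weight) (y := 1) (a := .pend e) h5.ge
    rw [h5, h3, Nat.one_mul] at h7
    simp only [Ex.ok_add, Ex.ok_sub, Ex.ok_var, Ex.ok_get, Ex.val_add, Ex.val_sub, Ex.val_var,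
      Ex.val_get, hia, hpok, hpv, h₁.wt_num, hc₁]
    refine ⟨⟨⟨trivial, trivial, by omega⟩, trivial, by omega⟩, Or.inl ?_⟩
    simp only [HState.reg_setReg, if_true]
    exact ⟨by omega, a, ha, hz, by omega, h7⟩
  · rintro d' ⟨i, -, -, hp, -⟩
    exact hp hz'

theorem wp_leaveBody (hB : WordOK k l n m B) (h : Ctx arc T m σ) {c : ℕ}
    (hc : c < numCodes k l m) (hrc : σ.reg .c = c) {s : Fin m} (hs : σ.reg .s2 = s)
    {e : Fin l} (he : σ.reg .e = e) :
    leaveBody.wp B (IsResult m (LeaveMove arc s e) c) σ := by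
  have hb := hB.codes
  have hnb : numBits k l m = 3 * l + k + 2 * m := rfl
  have hel := e.2
  refine ⟨trivial, wp_selectIn hB (h.setReg (by simp)) (by simpa [hrc] using hc) (s := s)
    (by simpa using hs) (by simp) (e := e) (by simpa using he) fun σ₁ hr₁ hm₁ hf₁ => ?_⟩
  have h₁ : Ctx arc T m σ₁ := (h.setReg (x := .d) (by simp)).congr (fun x hx => hr₁ x (by
    simp only [List.mem_cons, List.not_mem_nil, or_false] at hx
    rcases hx with rfl | rfl | rfl | rfl | rfl | rfl | rfl <;> simp)) fun a _ => by rw [hm₁]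
  have hc₁ : σ₁.reg .c = c := by rw [hr₁ _ (by simp)]; simpa using hrc
  have he₁ : σ₁.reg .e = e := by rw [hr₁ _ (by simp)]; simpa using he
  have hd₁ : σ₁.reg .d = numCodes k l m := by
    rw [hr₁ _ (by simp)]; simpa using h.regN
  simp only [HState.reg_setReg, reduceCtorEq, if_false, hrc] at hf₁
  have hpok : pendEx.ok B σ₁ := by
    simp only [pendEx, Ex.ok_add, Ex.ok_mul, Ex.ok_var, Ex.ok_two, Ex.val_add, Ex.val_mul,
      Ex.val_two, Ex.val_var, he₁, h₁.regl, h₁.regk, true_and]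
    omega
  have hpv : pendEx.val σ₁ = (Ix.pend e : Ix k l m).num := by
    simp only [pendEx, Ex.val_add, Ex.val_mul, Ex.val_two, Ex.val_var, he₁, h₁.regl, h₁.regk,
      Ix.num]
  have hokb : ∀ x : Var, (bitEx x).ok B σ₁ := fun x => ok_bitEx hB (by omega) trivial
  have hokp : (bitEx pendEx).ok B σ₁ := ok_bitEx hB (by omega) hpok
  simp only [Stmt.wp, Ex.ok_var, Ex.val_var, hokb, hokp, true_and]
  rcases hf₁ with ⟨hf₁, hn⟩ | ⟨hf₁, a, ha, hia⟩
  · refine ⟨fun h => absurd hf₁ h, fun _ => Or.inr ⟨hd₁, ?_⟩⟩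
    rintro d' ⟨i, hi, -⟩
    exact hn i hi
  refine ⟨fun _ => ?_, fun h => absurd h hf₁⟩
  rw [val_bitEx h₁ (i := .var .j) hia ha.rad, val_bitEx h₁ hpv (by simp), hc₁]
  refine ⟨fun hne => Or.inr ⟨hd₁, ?_⟩, fun hz => ⟨fun hne => Or.inr ⟨hd₁, ?_⟩, fun hz' => ?_⟩⟩
  · rintro d' ⟨i, hi, hi0, -⟩
    exact hne (ha.unique hi ▸ hi0)
  · rintro d' ⟨i, -, -, hp, -⟩
    exact hne hp
  · obtain ⟨h3, h4, h5⟩ := view_set_two hz ha.rad hz' (by simp) ha.ne_pend hc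
    simp only [Ex.ok_add, Ex.ok_var, Ex.ok_get, Ex.val_add, Ex.val_var,
      Ex.val_get, hia, hpok, hpv, h₁.wt_num, hc₁]
    refine ⟨⟨⟨trivial, trivial, by omega⟩, trivial, by omega⟩, Or.inl ?_⟩
    simp only [HState.reg_setReg, if_true]
    exact ⟨h5, a, ha, hz, hz', h3⟩

theorem wp_labelBody (hB : WordOK k l n m B) (h : Ctx arc T m σ) {c : ℕ}
    (hc : c < numCodes k l m) (hrc : σ.reg .c = c) {s : Fin m} (hs : σ.reg .s1 = s)
    {x : ℕ} (hx : σ.reg .lam = x) (hxl : x < k + l + 1) :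
    labelBody.wp B (IsResult (k := k) (l := l) m (LabelMove s x) c) σ := by
  have hb := hB.codes
  have hnb : numBits k l m = 3 * l + k + 2 * m := rfl
  have hsm := s.2
  have h₁ : Ctx arc T m (σ.setReg .d (σ.reg .N)) := h.setReg (by simp)
  have hl := val_labEx h₁ (x := .s1) (s := s) (by simpa using hs)
  have hlo := ok_labEx hB h₁ (x := .s1) (s := s) (by simpa [hrc] using hc) (by simpa using hs)
  have hw : σ.mem .wt (numBits k l m + s) = (Ix.lab s : Ix k l m).weight := h.wt_num (.lab s)
  simp only [HState.reg_setReg, reduceCtorEq, if_false, hrc] at hl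
  refine ⟨trivial, hlo, fun hne => Or.inr ⟨by simpa using h.regN, ?_⟩, fun hz => ?_⟩
  · rintro d' ⟨h0, -⟩
    exact hne (by rw [← h0, ← hl]; rfl)
  have hz : view k l m c (.lab s) = 0 := by rw [← hl]; exact hz
  have hxw := mul_weight_lt_numCodes (k := k) (l := l) (m := m) (x := x) (a := .lab s)
    (by rw [Ix.rad_lab]; omega)
  have hv1 := view_add (c := c) (x := x) (a := .lab s) (by rw [hz, Ix.rad_lab]; omega)
  have hv2 := add_lt_numCodes (c := c) (x := x) (a := .lab s) (by rw [hz, Ix.rad_lab]; omega) hc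
  rw [hz, Nat.zero_add] at hv1
  refine ⟨?_, fun hlt => ?_, fun hlt => ?_⟩
  · rw [Ex.ok_lt _ _ _ _ (by omega)]
    exact ⟨trivial, trivial⟩
  · have hlt : l < x := by
      by_contra hc
      refine hlt ?_
      simp [h.regl, hx, hc]
    have hih : x - (l + 1) < k := by omega
    set y : Fin k := ⟨x - (l + 1), hih⟩ with hy
    have hyv : (y : ℕ) = x - (l + 1) := rfl
    have hnum : 2 * l + (x - (l + 1)) = (Ix.placed y : Ix k l m).num := rfl
    set σ₂ := (σ.setReg .d (σ.reg .N)).setReg .i (2 * l + (x - (l + 1))) with hσ₂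
    have h₂ : Ctx arc T m σ₂ := h₁.setReg (by simp)
    have hc₂ : σ₂.reg .c = c := by simpa [hσ₂] using hrc
    have hi₂ : σ₂.reg .i = (Ix.placed y : Ix k l m).num := by simp [hσ₂, hnum]
    have hl₂ : σ₂.reg .lam = x := by simpa [hσ₂] using hx
    have hs₂ : σ₂.reg .s1 = s := by simpa [hσ₂] using hs
    have hd₂ : σ₂.reg .d = numCodes k l m := by simpa [hσ₂] using h.regN
    have hset : ∀ Q : HState → Prop, Q σ₂ → (Stmt.set .i (2 * Var.l + (Var.lam - (Var.l + 1)))).wp B Q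
        (σ.setReg .d (σ.reg .N)) := by
      intro Q hQ
      simp only [Stmt.wp, Ex.ok_add, Ex.ok_mul, Ex.ok_sub, Ex.ok_var, Ex.ok_two, Ex.ok_one,
        Ex.val_add, Ex.val_mul, Ex.val_sub, Ex.val_var, Ex.val_two, Ex.val_one, HState.reg_setReg,
        reduceCtorEq, if_false, h.regl, hx, true_and]
      exact ⟨by omega, hQ⟩
    refine hset _ ⟨ok_bitEx hB (by omega) trivial, fun hne => Or.inr ⟨hd₂, ?_⟩, fun hz' => ?_⟩
    · rw [val_bitEx h₂ (i := .var .i) hi₂ (by simp), hc₂] at hne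
      rintro d' ⟨-, ⟨hx', -⟩ | ⟨h', hxh, hp, -⟩⟩
      · omega
      · have : h' = y := Fin.ext (by omega)
        exact hne (this ▸ hp)
    · rw [val_bitEx h₂ (i := .var .i) hi₂ (by simp), hc₂] at hz'
      have hz'' : view k l m (c + x * (Ix.lab s : Ix k l m).weight) (.placed y) = 0 := by
        rw [hv1, Function.update_of_ne (by simp), hz']
      have h3 := view_set_one hz'' (by simp)
      have h4 := set_one_lt hz'' (by simp) hv2
      have hw₂ : σ₂.mem .wt (numBits k l m + s) = (Ix.lab s : Ix k l m).weight := hw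
      simp only [Stmt.wp, Ex.ok_add, Ex.ok_mul, Ex.ok_var, Ex.ok_get, Ex.val_add, Ex.val_mul,
        Ex.val_var, Ex.val_get, hi₂, h₂.wt_num, hc₂, hl₂, hs₂, h₂.regnb, hw₂, true_and]
      refine ⟨by omega, Or.inl ?_⟩
      simp only [HState.reg_setReg, if_true]
      exact ⟨h4, hz, Or.inr ⟨y, by omega, hz', by rw [h3, hv1]⟩⟩
  · have hlt : x ≤ l := by
      by_contra hc
      simp [h.regl, hx, Nat.lt_of_not_le hc] at hlt
    simp only [Stmt.wp, Ex.ok_add, Ex.ok_mul, Ex.ok_var, Ex.ok_get, Ex.val_add, Ex.val_mul,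
      Ex.val_var, Ex.val_get, HState.reg_setReg, HState.mem_setReg, reduceCtorEq, if_false, hrc, hx,
      hs, h.regnb, hw, true_and]
    refine ⟨by omega, Or.inl ?_⟩
    simp only [HState.reg_setReg, if_true]
    exact ⟨hv2, hz, Or.inl ⟨hlt, hv1⟩⟩

end TopDP

/-! ### The clearing body, and passes over the table in place -/

namespace TopDP

open WordRAM

section
variable {k l m n : ℕ} {arc : Fin l → Fin k × Fin k} {T : Digraph (Fin n)} {σ σ' : HState} {B : ℕ}

theorem wp_clearBody (hB : WordOK k l n m B) (h : Ctx arc T m σ) {c : ℕ}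
    (hc : c < numCodes k l m) (hrc : σ.reg .c = c) {s : Fin m} (hs : σ.reg .s2 = s) :
    clearBody.wp B (IsResult (k := k) (l := l) m (ClearMove s) c) σ := by
  have hb := hB.codes
  have hnb : numBits k l m = 3 * l + k + 2 * m := rfl
  have hsm := s.2
  have h₁ : Ctx arc T m (σ.setReg .d (σ.reg .N)) := h.setReg (by simp)
  have hl := val_labEx h₁ (x := .s2) (s := s) (by simpa using hs)
  have hlo := ok_labEx hB h₁ (x := .s2) (s := s) (by simpa [hrc] using hc) (by simpa using hs)
  simp only [HState.reg_setReg, reduceCtorEq, if_false, hrc] at hl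
  refine ⟨trivial, hlo, ?_⟩
  rw [Ex.val_var, hl]
  set y := view k l m c (.lab s) with hy
  set σ₄ := (((σ.setReg .d (σ.reg .N)).setReg .x y).setReg .i (3 * l + k + s)).setReg .j
    (3 * l + k + m + s) with hσ₄
  have h₄ : Ctx arc T m σ₄ := ((h₁.setReg (by simp)).setReg (by simp)).setReg (by simp)
  have hset : ∀ Q : HState → Prop, Q σ₄ →
      (Stmt.set .i (3 * Var.l + Var.k + Var.s2) ;;
        .set .j (3 * Var.l + Var.k + Var.m + Var.s2)).wp B Q
        ((σ.setReg .d (σ.reg .N)).setReg .x y) := by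
    intro Q hQ
    simp only [Stmt.wp, Ex.ok_add, Ex.ok_mul, Ex.ok_var, Ex.ok_three,
      Ex.val_add, Ex.val_mul, Ex.val_var, Ex.val_three, HState.reg_setReg,
      reduceCtorEq, if_false, h.regl, h.regk, h.regm, hs, true_and]
    exact ⟨by omega, by omega, hQ⟩
  -- The common end of the three branches that compute the flag; only whether the flag is zero
  -- matters.
  have key : ∀ φ, (φ ≠ 0 ↔ y = 0 ∨ l < y ∨ view k l m c (.out s) ≠ 0) → Stmt.wp B
      (.ite Var.f (.set .d (Var.c - Var.x * .get .wt (Var.nb + Var.s2) -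
        bitEx Var.i * .get .wt Var.i - bitEx Var.j * .get .wt Var.j)) .skip)
      (IsResult (k := k) (l := l) m (ClearMove s) c) (σ₄.setReg .f φ) := by
    intro φ hφ
    have h₅ : Ctx arc T m (σ₄.setReg .f φ) := h₄.setReg (by simp)
    have hi := val_bitEx h₅ (i := .var .i) (a := .inn s) (by simp [hσ₄, Ix.num]) (by simp)
    have hj := val_bitEx h₅ (i := .var .j) (a := .out s) (by simp [hσ₄, Ix.num]) (by simp)
    have hio : ∀ x : Var, (bitEx x).ok B (σ₄.setReg .f φ) := fun x =>
      ok_bitEx hB (by simpa [hσ₄, hrc] using hc) trivial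
    have hw1 := h₅.wt_num (.lab s)
    have hw2 := h₅.wt_num (.inn s)
    have hw3 := h₅.wt_num (.out s)
    simp only [HState.mem_setReg] at hw1 hw2 hw3
    have hci : (σ₄.setReg .f φ).reg .c = c := by simp [hσ₄, hrc]
    rw [hci] at hi hj
    -- Each of the three subtractions removes exactly the share of one digit. Hence none is
    -- truncated, and the digits still to be removed are unaffected.
    have e1 : y * (Ix.lab s : Ix k l m).weight ≤ c := mul_weight_le_of_le_view le_rfl
    have v1 := view_sub (c := c) (y := y) (a := .lab s) le_rfl
    have a2 : view k l m (c - y * (Ix.lab s : Ix k l m).weight) (.inn s) =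
        view k l m c (.inn s) := by rw [v1, Function.update_of_ne (by simp)]
    have e2 := mul_weight_le_of_le_view a2.ge
    have v2 := view_sub a2.ge
    have a3 : view k l m (c - y * (Ix.lab s : Ix k l m).weight - view k l m c (.inn s) *
        (Ix.inn s : Ix k l m).weight) (.out s) = view k l m c (.out s) := by
      rw [v2, Function.update_of_ne (by simp), v1, Function.update_of_ne (by simp)]
    have e3 := mul_weight_le_of_le_view a3.ge
    have v3 := view_sub a3.ge
    rw [a3, v2, a2, v1, Nat.sub_self, Nat.sub_self, Nat.sub_self] at v3
    have hnl : numBits k l m + s = (Ix.lab s : Ix k l m).num := rfl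
    have hni : 3 * l + k + s = (Ix.inn s : Ix k l m).num := rfl
    have hno : 3 * l + k + m + s = (Ix.out s : Ix k l m).num := rfl
    have rx : (σ₄.setReg .f φ).reg .x = y := by simp [hσ₄]
    have ri : (σ₄.setReg .f φ).reg .i = 3 * l + k + s := by simp [hσ₄]
    have rj : (σ₄.setReg .f φ).reg .j = 3 * l + k + m + s := by simp [hσ₄]
    have rs : (σ₄.setReg .f φ).reg .s2 = s := by simp [hσ₄, hs]
    have rf : (σ₄.setReg .f φ).reg .f = φ := by simp
    simp only [Stmt.wp, Ex.ok_var, Ex.ok_sub, Ex.ok_mul, Ex.ok_get, Ex.ok_add, hio, Ex.val_var,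
      Ex.val_sub, Ex.val_mul, Ex.val_get, Ex.val_add, hi, hj, HState.mem_setReg, hci, rx, ri, rj,
      rs, rf, h₅.regnb, hnl, hni, hno, hw1, hw2, hw3, true_and]
    refine ⟨fun hne => ⟨?_, Or.inl ?_⟩, fun hz => Or.inr ⟨?_, ?_⟩⟩
    · have : (Ix.lab s : Ix k l m).num < B := by have := (Ix.lab s : Ix k l m).num_lt; omega
      omega
    · simp only [HState.reg_setReg, if_true]
      exact ⟨by omega, hφ.1 hne, v3⟩
    · simpa [hσ₄] using h.regN
    · rintro d' ⟨h0, -⟩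
      exact hφ.2 h0 hz
  refine hset _ ⟨trivial, fun hne => ⟨?_, fun hlt => ⟨?_, ?_⟩, fun hlt => ⟨?_, ?_⟩⟩,
    fun hz => ⟨?_, ?_⟩⟩
  · rw [Ex.ok_lt _ _ _ _ (by omega)]
    exact ⟨trivial, trivial⟩
  · rw [Ex.ok_one]; omega
  · refine key _ ?_
    have : l < y := by
      by_contra hc
      exact hlt (by simp [hσ₄, h.regl, hc])
    simp [this]
  · exact ok_bitEx hB (by simpa [hσ₄, hrc] using hc) trivial
  · refine key _ ?_
    have hj := val_bitEx h₄ (i := .var .j) (a := .out s) (by simp [hσ₄, Ix.num]) (by simp)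
    have hci : σ₄.reg .c = c := by simp [hσ₄, hrc]
    have : ¬ l < y := by
      intro hc
      simp [hσ₄, h.regl, hc] at hlt
    have hy0 : y ≠ 0 := by simpa [hσ₄] using hne
    rw [hj, hci]
    simp [this, hy0]
  · rw [Ex.ok_one]; omega
  · refine key _ ?_
    have hy0 : y = 0 := by simpa [hσ₄] using hz
    simp [hy0]

/-- The set of states that is stored in the table. -/
def absTab (k l m : ℕ) (σ : HState) : Set (DState k l m) :=
  {d | ∃ c < numCodes k l m, σ.mem .tab c ≠ 0 ∧ view k l m c = d}

theorem absTab_congr (h : σ'.mem .tab = σ.mem .tab) : absTab k l m σ' = absTab k l m σ := by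
  simp [absTab, h]

/-- A relation is suitable for an update of the table in place. -/
structure InPlace (keep : ℕ) (R : DState k l m → DState k l m → Prop) : Prop where
  functional : ∀ a b b', R a b → R a b' → b' = b
  idem : ∀ a b b', R a b → R b b' → b' = b
  fixed : keep = 0 → ∀ a b, R a b → R b b

/-- The set of states after a pass. -/
def passResult (keep : ℕ) (R : DState k l m → DState k l m → Prop) (S : Set (DState k l m)) :
    Set (DState k l m) := if keep = 0 then applyMoves R S else addMoves R S

/-- The scan also meets codes that it has entered itself. By `idem` such a code can only lead to
itself, so no chains of moves arise. If `keep` is zero, each code is erased when it is met, and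
`fixed` ensures that a result is written back. If no move applies, `d` points to the cell just
behind the table, where a write does no harm. -/
theorem run_pass {w keep : ℕ} (hw : 1 < 2 ^ w) (hk : keep = 0 ∨ keep = 1) {body : Stmt}
    (hwc : body.wr .c = false) (hwN : body.wr .N = false) (hst : ∀ a, body.st a = false)
    {R : DState k l m → DState k l m → Prop} (hR : InPlace keep R)
    (hN : σ.reg .N = numCodes k l m)
    (hbody : ∀ c < numCodes k l m, ∀ σ₁, Same (pass keep body) σ σ₁ → σ₁.reg .c = c →
      body.wp (2 ^ w) (IsResult m R c) σ₁) :
    Run w (pass keep body) σ (9 + numCodes k l m * (body.cost + 40))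
      (fun σ' => absTab k l m σ' = passResult keep R (absTab k l m σ)) := by
  set t0 := σ.mem .tab with ht0
  -- An entry is present if it is original and not yet erased, or the result of an original code
  -- scanned before. The second clause says that results of moves have codes at all, as the moves
  -- are relations on arbitrary states.
  let I : ℕ → HState → Prop := fun i σ₁ =>
    (∀ x < numCodes k l m, σ₁.mem .tab x ≠ 0 ↔ (t0 x ≠ 0 ∧ (i ≤ x ∨ keep ≠ 0)) ∨
      ∃ c < i, t0 c ≠ 0 ∧ R (view k l m c) (view k l m x)) ∧
    ∀ c < i, t0 c ≠ 0 → ∀ d', R (view k l m c) d' → ∃ x < numCodes k l m, view k l m x = d'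
  have hloop := Run.ofLoop (x := .c) (y := .N) (w := w) (σ := σ) (t := body.cost + 28)
    (S := .ite (.get .tab Var.c) (body ;; .put .tab Var.c (.lit keep) ;; .put .tab Var.d 1) .skip)
    hw (by simp) hN (by simp [Stmt.wr, hwc]) (by simp [Stmt.wr, hwN]) I
    (by simp [I, ht0]) ?_
  · refine hloop.mono le_rfl ?_
    rintro σ' ⟨h1, h2⟩
    ext d
    have hmem : d ∈ absTab k l m σ' ↔ ∃ x < numCodes k l m, ((t0 x ≠ 0 ∧ keep ≠ 0) ∨
        ∃ c < numCodes k l m, t0 c ≠ 0 ∧ R (view k l m c) (view k l m x)) ∧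
        view k l m x = d := by
      constructor
      · rintro ⟨x, hx, hne, hv⟩
        rw [h1 x hx] at hne
        refine ⟨x, hx, ?_, hv⟩
        rcases hne with ⟨h, h' | h'⟩ | h
        · omega
        · exact Or.inl ⟨h, h'⟩
        · exact Or.inr h
      · rintro ⟨x, hx, hne, hv⟩
        refine ⟨x, hx, (h1 x hx).2 ?_, hv⟩
        rcases hne with ⟨h, h'⟩ | h
        · exact Or.inl ⟨h, Or.inr h'⟩
        · exact Or.inr h
    rw [hmem]
    have hstep : (∃ d₀ ∈ absTab k l m σ, R d₀ d) ↔ ∃ x < numCodes k l m,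
        (∃ c < numCodes k l m, t0 c ≠ 0 ∧ R (view k l m c) (view k l m x)) ∧
          view k l m x = d := by
      constructor
      · rintro ⟨d₀, ⟨c, hc, hne, rfl⟩, hd⟩
        obtain ⟨x, hx, rfl⟩ := h2 c hc hne d hd
        exact ⟨x, hx, ⟨c, hc, hne, hd⟩, rfl⟩
      · rintro ⟨x, hx, ⟨c, hc, hne, hr⟩, rfl⟩
        exact ⟨_, ⟨c, hc, hne, rfl⟩, hr⟩
    unfold passResult
    split_ifs with hk0
    · rw [applyMoves, Set.mem_ofPred_eq, hstep]
      simp [hk0]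
    · rw [addMoves, Set.mem_union, Set.mem_ofPred_eq, hstep]
      constructor
      · rintro ⟨x, hx, ⟨h, -⟩ | h, hv⟩
        · exact Or.inl ⟨x, hx, h, hv⟩
        · exact Or.inr ⟨x, hx, h, hv⟩
      · rintro (⟨x, hx, h, hv⟩ | ⟨x, hx, h, hv⟩)
        · exact ⟨x, hx, Or.inl ⟨h, hk0⟩, hv⟩
        · exact ⟨x, hx, Or.inr h, hv⟩
  · rintro i hi σ₁ hs hc ⟨h1, h2⟩
    have hcost : (Ex.get .tab Var.c).cost = 3 := rfl
    have hput : (Stmt.put .tab Var.c (.lit keep) ;; Stmt.put .tab Var.d 1).cost = 8 := rfl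
    refine (Run.of_ite (t := body.cost + 8) (by simp) (fun hne => ?_) (fun hz => ?_)).mono
      (by rw [hcost]; omega) fun _ => id
    · replace hne : σ₁.mem .tab i ≠ 0 := by simpa [hc] using hne
      refine Run.andThen (Run.of_wp (hbody i hi σ₁ hs hc)) (t' := 8) fun σ₂ hs₂ hres => ?_
      refine Run.of_wp (S := Stmt.put .tab Var.c (.lit keep) ;; .put .tab Var.d 1) ?_
      have hc₂ : σ₂.reg .c = i := by rw [hs₂.reg _ hwc, hc]
      have hm₂ : σ₂.mem .tab = σ₁.mem .tab := hs₂.mem _ (hst _)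
      refine ⟨trivial, show keep < 2 ^ w by omega, trivial, hw, ?_⟩
      have hi0 := (h1 i hi).1 hne
      have hd : ∀ d', R (view k l m i) d' → σ₂.reg .d < numCodes k l m ∧
          view k l m (σ₂.reg .d) = d' := by
        intro d' hd'
        rcases hres with ⟨h, hr⟩ | ⟨-, h⟩
        · exact ⟨h, hR.functional _ _ _ hd' hr⟩
        · exact absurd hd' (h d')
      refine ⟨fun x hx => ?_, fun c hci hne' d' hd' => ?_⟩
      · have hx1 := h1 x hx
        simp only [HState.mem_setReg, HState.mem_setMem, HState.reg_setMem, Ex.val_var,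
          Ex.val_lit, Ex.val_one, true_and, hc₂, hm₂]
        by_cases hxi : x = i
        · subst hxi
          by_cases hxd : x = σ₂.reg .d
          · rw [if_pos hxd]
            refine iff_of_true one_ne_zero (Or.inr ?_)
            have hr : R (view k l m x) (view k l m x) := by
              rcases hres with ⟨h, hr⟩ | ⟨h, -⟩
              · rwa [← hxd] at hr
              · omega
            rcases hi0 with ⟨h, -⟩ | ⟨c, hcx, h⟩
            · exact ⟨x, by omega, h, hr⟩
            · exact ⟨c, by omega, h⟩
          · rw [if_neg hxd, if_pos rfl]
            have hnr : ¬ R (view k l m x) (view k l m x) := by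
              intro hr
              obtain ⟨h, hv⟩ := hd _ hr
              exact hxd (view_injOn hx h hv.symm)
            rcases hk with rfl | rfl
            · refine iff_of_false (by simp) ?_
              rintro (⟨-, h | h⟩ | ⟨c, -, -, h⟩)
              · omega
              · exact h rfl
              · exact hnr (hR.fixed rfl _ _ h)
            · refine iff_of_true (by simp) ?_
              rcases hi0 with ⟨h, -⟩ | ⟨c, hcx, h⟩
              · exact Or.inl ⟨h, Or.inr (by simp)⟩
              · exact Or.inr ⟨c, by omega, h⟩
        · have hold : σ₁.mem .tab x ≠ 0 ↔ (t0 x ≠ 0 ∧ (i + 1 ≤ x ∨ keep ≠ 0)) ∨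
              ∃ c < i, t0 c ≠ 0 ∧ R (view k l m c) (view k l m x) := by
            rw [hx1]
            have : i ≤ x ↔ i + 1 ≤ x := by omega
            rw [this]
          by_cases hxd : x = σ₂.reg .d
          · rw [if_pos hxd]
            refine iff_of_true one_ne_zero (Or.inr ?_)
            have hr : R (view k l m i) (view k l m x) := by
              rcases hres with ⟨h, hr⟩ | ⟨h, -⟩
              · rwa [← hxd] at hr
              · omega
            rcases hi0 with ⟨h, -⟩ | ⟨c, hcx, -, h⟩
            · exact ⟨i, by omega, h, hr⟩
            -- Here `i` is in the table only as the result of an earlier code, so its own result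
            -- would be `i` again.
            · exact absurd (view_injOn hx hi (hR.idem _ _ _ h hr)) hxi
          · rw [if_neg hxd, if_neg hxi, hold]
            refine or_congr_right ⟨fun ⟨c, hc', h⟩ => ⟨c, by omega, h⟩, fun ⟨c, hc', h⟩ => ?_⟩
            refine ⟨c, lt_of_le_of_ne (by omega) ?_, h⟩
            rintro rfl
            obtain ⟨h', hv⟩ := hd _ h.2
            exact hxd (view_injOn hx h' hv.symm)
      · rcases Nat.lt_succ_iff_lt_or_eq.1 hci with h | rfl
        · exact h2 c h hne' d' hd'
        · exact ⟨_, hd d' hd'⟩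
    · replace hz : σ₁.mem .tab i = 0 := by simpa [hc] using hz
      have hi0 : ¬ _ := fun h => ((h1 i hi).2 h) hz
      have ht : t0 i = 0 := by
        by_contra h
        exact hi0 (Or.inl ⟨h, Or.inl le_rfl⟩)
      refine Run.mono (Run.of_wp (S := .skip) (show Stmt.wp _ .skip _ _ from ?_)) (Nat.zero_le _)
        fun _ => id
      refine ⟨fun x hx => ?_, fun c hci hne' => ?_⟩
      · rw [HState.mem_setReg, h1 x hx]
        constructor
        · rintro (⟨h, h'⟩ | ⟨c, hc', h⟩)
          · refine Or.inl ⟨h, h'.imp_left fun h' => ?_⟩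
            rcases Nat.lt_or_eq_of_le h' with h' | rfl
            · exact h'
            · exact absurd ht h
          · exact Or.inr ⟨c, by omega, h⟩
        · rintro (⟨h, h'⟩ | ⟨c, hc', h⟩)
          · exact Or.inl ⟨h, h'.imp_left fun h' => by omega⟩
          · refine Or.inr ⟨c, lt_of_le_of_ne (by omega) ?_, h⟩
            rintro rfl
            exact h.1 ht
      · refine h2 c (lt_of_le_of_ne (by omega) ?_) hne'
        rintro rfl
        exact hne' ht

theorem OutAt.lab_ne {d : DState k l m} {s s' : Fin m} {e : Fin l} {a : Ix k l m}
    (h : OutAt arc d s e a) : .lab s' ≠ a := by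
  rcases h with ⟨-, rfl⟩ | ⟨-, rfl⟩ <;> simp

theorem InAt.lab_ne {d : DState k l m} {s s' : Fin m} {e : Fin l} {a : Ix k l m}
    (h : InAt arc d s e a) : .lab s' ≠ a := by
  rcases h with ⟨-, rfl⟩ | ⟨-, rfl⟩ <;> simp

theorem OutAt.congr {d d' : DState k l m} {s : Fin m} {e : Fin l} {a : Ix k l m}
    (h : OutAt arc d s e a) (hd : d' (.lab s) = d (.lab s)) : OutAt arc d' s e a := by
  unfold OutAt at *
  rwa [hd]

/-- The digit for the outgoing arc is now one, which blocks a second move. For `TakeMove` and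
`LeaveMove` the changed bit `pend` does the same. -/
theorem inPlace_arcMove (s s' : Fin m) (e : Fin l) : InPlace 1 (ArcMove arc s s' e) where
  functional := by
    rintro a b b' ⟨i, j, hi, hj, -, -, rfl⟩ ⟨i', j', hi', hj', -, -, rfl⟩
    rw [hi.unique hi', hj.unique hj']
  idem := by
    rintro a b b' ⟨i, j, hi, hj, -, -, rfl⟩ ⟨i', j', hi', hj', h, -⟩
    have := hi'.congr (d' := a) (by
      rw [Function.update_of_ne hj.lab_ne, Function.update_of_ne hi.lab_ne])
    obtain rfl := hi.unique this
    rw [Function.update_of_ne (outAt_ne_inAt hi hj).symm, Function.update_self] at h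
    exact absurd h one_ne_zero
  fixed h := absurd h one_ne_zero

theorem inPlace_takeMove (s : Fin m) (e : Fin l) : InPlace 1 (TakeMove arc s e) where
  functional := by
    rintro a b b' ⟨i, hi, -, -, rfl⟩ ⟨i', hi', -, -, rfl⟩
    rw [hi.unique hi']
  idem := by
    rintro a b b' ⟨i, hi, -, -, rfl⟩ ⟨i', hi', h, h', -⟩
    simp at h'
  fixed h := absurd h one_ne_zero

theorem inPlace_leaveMove (s : Fin m) (e : Fin l) : InPlace 1 (LeaveMove arc s e) where
  functional := by
    rintro a b b' ⟨i, hi, -, -, rfl⟩ ⟨i', hi', -, -, rfl⟩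
    rw [hi.unique hi']
  idem := by
    rintro a b b' ⟨i, hi, -, -, rfl⟩ ⟨i', hi', h, h', -⟩
    simp at h'
  fixed h := absurd h one_ne_zero

/-- A nonzero label blocks a second move, and the label 0 changes nothing. -/
theorem inPlace_labelMove (s : Fin m) (x : ℕ) :
    InPlace 1 (LabelMove s x : DState k l m → DState k l m → Prop) where
  functional := by
    rintro a b b' ⟨-, ⟨h, rfl⟩ | ⟨y, h, -, rfl⟩⟩ ⟨-, ⟨h', rfl⟩ | ⟨y', h', -, rfl⟩⟩
    · rfl
    · omega
    · omega
    · obtain rfl : y = y' := Fin.ext (by omega)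
      rfl
  idem := by
    rintro a b b' ⟨h0, ⟨h, rfl⟩ | ⟨y, h, -, rfl⟩⟩ ⟨h1, h2⟩
    · rw [Function.update_self] at h1
      subst h1
      rcases h2 with ⟨-, rfl⟩ | ⟨y', h', -⟩
      · simp
      · omega
    · rw [Function.update_of_ne (by simp), Function.update_self] at h1
      omega
  fixed h := absurd h one_ne_zero

theorem inPlace_clearMove (s : Fin m) :
    InPlace 0 (ClearMove s : DState k l m → DState k l m → Prop) where
  functional := by
    rintro a b b' ⟨-, rfl⟩ ⟨-, rfl⟩
    rfl
  idem := by
    rintro a b b' ⟨-, rfl⟩ ⟨-, rfl⟩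
    funext i
    simp only [Function.update_apply]
    split_ifs <;> rfl
  fixed := by
    rintro - a b ⟨-, rfl⟩
    refine ⟨Or.inl (by simp), ?_⟩
    funext i
    simp only [Function.update_apply]
    split_ifs <;> rfl

end

end TopDP

namespace WordRAM

theorem Run.of_skip {w t : ℕ} {σ : HState} {Q : HState → Prop} (h : Q σ) : Run w .skip σ t Q :=
  (Run.of_wp (S := .skip) (Q := Q) h).mono (Nat.zero_le _) fun _ => id

end WordRAM

/-! ### Programs by which one vertex enters or leaves -/

namespace TopDP

open WordRAM

/-- The vertex in variable `v` enters the empty slot in variable `q`. -/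
def introStmt : Stmt :=
  .put .slot Var.q (Var.v + 1) ;; .set .s1 Var.q ;; .for_ .lam .R (pass 1 labelBody) ;;
  .for_ .e .l (.set .s1 Var.q ;; pass 1 takeBody ;;
    .for_ .h .m (.ite (.get .slot Var.h)
      (.set .u (.get .slot Var.h - 1) ;;
        .ite (.get .mat (Var.v * Var.n + Var.u))
          (.set .s1 Var.q ;; .set .s2 Var.h ;; pass 1 arcBody) .skip ;;
        .ite (.get .mat (Var.u * Var.n + Var.v))
          (.set .s1 Var.h ;; .set .s2 Var.q ;; pass 1 arcBody) .skip) .skip))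

/-- The vertex in the slot in variable `s2` is forgotten. -/
def forgetStmt : Stmt :=
  .for_ .e .l (pass 1 leaveBody) ;; pass 0 clearBody ;; .put .slot Var.s2 0

/-- A bound for the running time of a pass. -/
def passTime (N : ℕ) : ℕ := 9 + N * 400

section
variable {k l m n : ℕ} {arc : Fin l → Fin k × Fin k} {T : Digraph (Fin n)} {σ σ' : HState}
  {w : ℕ}

theorem WordOK.one_lt {B : ℕ} (hB : WordOK k l n m B) : 1 < B := by
  have := hB.codes
  omega

theorem WordOK.n_lt {B : ℕ} (hB : WordOK k l n m B) : n + 1 < B := by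
  have h1 := hB.codes
  have h2 := hB.mat
  rcases Nat.eq_zero_or_pos n with rfl | h
  · omega
  · nlinarith

/-- The time bound comes from evaluating the cost of the loop-free body: together with the overhead
of the pass it is at most 400 per code. The other four passes are treated alike. -/
theorem run_arc (hB : WordOK k l n m (2 ^ w)) (h : Ctx arc T m σ) {s s' : Fin m} {e : Fin l}
    (hs : σ.reg .s1 = s) (hs' : σ.reg .s2 = s') (he : σ.reg .e = e) :
    Run w (pass 1 arcBody) σ (passTime (numCodes k l m)) (fun σ' => absTab k l m σ' =
      addMoves (ArcMove arc s s' e) (absTab k l m σ)) :=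
  (run_pass hB.one_lt (Or.inr rfl) rfl rfl (by rintro ⟨⟩ <;> rfl) (inPlace_arcMove s s' e) h.regN
    fun c hc σ₁ hs₁ hc₁ => wp_arcBody hB (h.same hs₁ rfl) hc hc₁
      (by rw [hs₁.reg _ rfl, hs]) (by rw [hs₁.reg _ rfl, hs'])
      (by rw [hs₁.reg _ rfl, he])).mono
    (Nat.add_le_add_left (Nat.mul_le_mul_left _ (by decide)) _) fun _ h => h

theorem run_take (hB : WordOK k l n m (2 ^ w)) (h : Ctx arc T m σ) {s : Fin m} {e : Fin l}
    (hs : σ.reg .s1 = s) (he : σ.reg .e = e) :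
    Run w (pass 1 takeBody) σ (passTime (numCodes k l m)) (fun σ' => absTab k l m σ' =
      addMoves (TakeMove arc s e) (absTab k l m σ)) :=
  (run_pass hB.one_lt (Or.inr rfl) rfl rfl (by rintro ⟨⟩ <;> rfl) (inPlace_takeMove s e) h.regN
    fun c hc σ₁ hs₁ hc₁ => wp_takeBody hB (h.same hs₁ rfl) hc hc₁
      (by rw [hs₁.reg _ rfl, hs]) (by rw [hs₁.reg _ rfl, he])).mono
    (Nat.add_le_add_left (Nat.mul_le_mul_left _ (by decide)) _) fun _ h => h

theorem run_leave (hB : WordOK k l n m (2 ^ w)) (h : Ctx arc T m σ) {s : Fin m} {e : Fin l}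
    (hs : σ.reg .s2 = s) (he : σ.reg .e = e) :
    Run w (pass 1 leaveBody) σ (passTime (numCodes k l m)) (fun σ' => absTab k l m σ' =
      addMoves (LeaveMove arc s e) (absTab k l m σ)) :=
  (run_pass hB.one_lt (Or.inr rfl) rfl rfl (by rintro ⟨⟩ <;> rfl) (inPlace_leaveMove s e) h.regN
    fun c hc σ₁ hs₁ hc₁ => wp_leaveBody hB (h.same hs₁ rfl) hc hc₁
      (by rw [hs₁.reg _ rfl, hs]) (by rw [hs₁.reg _ rfl, he])).mono
    (Nat.add_le_add_left (Nat.mul_le_mul_left _ (by decide)) _) fun _ h => h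

theorem run_label (hB : WordOK k l n m (2 ^ w)) (h : Ctx arc T m σ) {s : Fin m} {x : ℕ}
    (hs : σ.reg .s1 = s) (hx : σ.reg .lam = x) (hxl : x < k + l + 1) :
    Run w (pass 1 labelBody) σ (passTime (numCodes k l m)) (fun σ' => absTab k l m σ' =
      addMoves (LabelMove s x) (absTab k l m σ)) :=
  (run_pass hB.one_lt (Or.inr rfl) rfl rfl (by rintro ⟨⟩ <;> rfl) (inPlace_labelMove s x) h.regN
    fun c hc σ₁ hs₁ hc₁ => wp_labelBody hB (h.same hs₁ rfl) hc hc₁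
      (by rw [hs₁.reg _ rfl, hs]) (by rw [hs₁.reg _ rfl, hx]) hxl).mono
    (Nat.add_le_add_left (Nat.mul_le_mul_left _ (by decide)) _) fun _ h => h

theorem run_clear (hB : WordOK k l n m (2 ^ w)) (h : Ctx arc T m σ) {s : Fin m}
    (hs : σ.reg .s2 = s) :
    Run w (pass 0 clearBody) σ (passTime (numCodes k l m)) (fun σ' => absTab k l m σ' =
      applyMoves (ClearMove s) (absTab k l m σ)) :=
  (run_pass hB.one_lt (Or.inl rfl) rfl rfl (by rintro ⟨⟩ <;> rfl) (inPlace_clearMove s) h.regN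
    fun c hc σ₁ hs₁ hc₁ => wp_clearBody hB (h.same hs₁ rfl) hc hc₁
      (by rw [hs₁.reg _ rfl, hs])).mono
    (Nat.add_le_add_left (Nat.mul_le_mul_left _ (by decide)) _) fun _ h => h

/-- The entry of a slot: zero if the slot is empty, otherwise the successor of the vertex. -/
def slotVal : Option (Fin n) → ℕ
  | none => 0
  | some v => v + 1

/-- The array `slot` holds the vertices of the slots. -/
def SlotRep (sl : Fin m → Option (Fin n)) (σ : HState) : Prop :=
  ∀ s : Fin m, σ.mem .slot s = slotVal (sl s)

theorem SlotRep.congr {sl : Fin m → Option (Fin n)} (h : SlotRep sl σ)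
    (hm : σ'.mem .slot = σ.mem .slot) : SlotRep sl σ' := fun s => by rw [hm, h s]

theorem SlotRep.update {sl : Fin m → Option (Fin n)} (h : SlotRep sl σ) (q : Fin m)
    (o : Option (Fin n)) : SlotRep (Function.update sl q o) (σ.setMem .slot q (slotVal o)) := by
  intro s
  by_cases hs : s = q
  · simp [hs]
  · have : (s : ℕ) ≠ q := fun h => hs (Fin.ext h)
    simpa [hs, this] using h s

variable {F : Set (Fin n)} {sl : Fin m → Option (Fin n)}

/-- A bound for the running time of `forgetStmt`. -/
def forgetTime (l N : ℕ) : ℕ := 9 + l * (passTime N + 12) + (passTime N + 10)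

theorem run_forget (hB : WordOK k l n m (2 ^ w)) (h : Ctx arc T m σ) (hsl : SlotRep sl σ)
    (hC : Correct arc T F sl (absTab k l m σ)) {s : Fin m} (hs : σ.reg .s2 = s) {v : Fin n}
    (hv : sl s = some v) (ha : ∀ u, ¬ Seen F sl u → T.Adj u v ∧ ¬ T.Adj v u) :
    Run w forgetStmt σ (forgetTime l (numCodes k l m)) (fun σ' =>
      SlotRep (Function.update sl s none) σ' ∧
      Correct arc T (insert v F) (Function.update sl s none) (absTab k l m σ')) := by
  refine Run.andThen (t' := passTime (numCodes k l m) + 10)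
    (Run.ofLoop hB.one_lt (by simp) h.regl rfl rfl
    (fun i σ₁ => LeavePhase arc T F sl s v (fun e => (e : ℕ) < i) (absTab k l m σ₁)) ?_
    fun i hi σ₁ hs₁ hi₁ hI => ?_) fun σ₁ hs₁ hQ => ?_
  · have := hC.leavePhase hv ha
    simpa [absTab] using this
  · refine (run_leave hB (h.same hs₁ rfl) (s := s) (e := ⟨i, hi⟩) (by rw [hs₁.reg _ rfl, hs])
      hi₁).mono le_rfl fun σ₂ h₂ => ?_
    have := hI.step ⟨i, hi⟩
    rw [← h₂] at this
    have he : (fun e : Fin l => (e : ℕ) < i + 1) =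
        fun e : Fin l => (e : ℕ) < i ∨ e = ⟨i, hi⟩ := by
      funext e
      rw [Fin.ext_iff, eq_iff_iff]
      exact Nat.lt_succ_iff_lt_or_eq
    show LeavePhase arc T F sl s v (fun e => (e : ℕ) < i + 1) (absTab k l m σ₂)
    rw [he]
    exact this
  · refine Run.andThen (run_clear hB (h.same hs₁ rfl) (s := s) (by rw [hs₁.reg _ rfl, hs]))
      (t' := 10) fun σ₂ hs₂ hQ₂ => ?_
    refine (Run.of_wp (S := .put .slot Var.s2 0) ?_).mono (by decide) fun _ => id
    have hr : σ₂.reg .s2 = s := by rw [hs₂.reg _ rfl, hs₁.reg _ rfl, hs]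
    refine ⟨trivial, (by positivity : 0 < 2 ^ w), ?_, ?_⟩
    · rw [Ex.val_var, hr]
      exact (hsl.congr (by rw [hs₂.mem _ rfl, hs₁.mem _ rfl])).update s none
    · have := hQ.correct fun e => e.2
      rw [← hQ₂] at this
      exact this

/-- The arcs that have been tried when `v` has entered its slot, the arcs `e' < e` have been dealt
with, and so have the slots `s < h` for the arc `e`. -/
def doneArcs (F : Set (Fin n)) (sl : Fin m → Option (Fin n)) (v : Fin n) (e h : ℕ) (e' : Fin l)
    (a b : Fin n) : Prop :=
  (a ≠ v ∧ b ≠ v) ∨ (e' : ℕ) < e ∨ (e' : ℕ) = e ∧ (a = v ∧ b ∈ F ∨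
    ∃ s : Fin m, (s : ℕ) < h ∧ (a = v ∧ sl s = some b ∨ b = v ∧ sl s = some a))

theorem ArcPhase.doneArcs_zero {S : Set (DState k l m)} {q : Fin m} {v : Fin n} {e : Fin l}
    (h : ArcPhase arc T F sl q v (fun e' a b => (a ≠ v ∧ b ≠ v) ∨ (e' : ℕ) < e) S) :
    ArcPhase arc T F sl q v (doneArcs F sl v e 0) (addMoves (TakeMove arc q e) S) := by
  refine (h.take e).mono (fun _ _ _ h h' => Or.inl ⟨h, h'⟩) ?_
  rintro e' a b - - - (h | h | ⟨h, h' | ⟨s, hs, -⟩⟩)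
  · exact Or.inl (Or.inl h)
  · exact Or.inl (Or.inr h)
  · exact Or.inr ⟨Fin.ext h, h'⟩
  · exact absurd hs (Nat.not_lt_zero _)

theorem ArcPhase.doneArcs_none {S : Set (DState k l m)} {q s : Fin m} {v : Fin n} {e : ℕ}
    (h : ArcPhase arc T F sl q v (doneArcs F sl v e s) S) (hs : sl s = none) :
    ArcPhase arc T F sl q v (doneArcs F sl v e (s + 1)) S := by
  refine h.mono (fun _ _ _ h h' => Or.inl ⟨h, h'⟩) ?_
  rintro e' a b - - - (h | h | ⟨h, h' | ⟨s', hs', h'⟩⟩)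
  · exact Or.inl h
  · exact Or.inr (Or.inl h)
  · exact Or.inr (Or.inr ⟨h, Or.inl h'⟩)
  · have : s' ≠ s := by rintro rfl; simp [hs] at h'
    have : (s' : ℕ) ≠ s := fun h => this (Fin.ext h)
    exact Or.inr (Or.inr ⟨h, Or.inr ⟨s', by omega, h'⟩⟩)

theorem ArcPhase.doneArcs_some {S : Set (DState k l m)} {q s : Fin m} {u v : Fin n} {e : Fin l}
    (h : ArcPhase arc T F sl q v (addArc (addArc (doneArcs F sl v e s) e v u) e u v) S)
    (hs : sl s = some u) : ArcPhase arc T F sl q v (doneArcs F sl v e (s + 1)) S := by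
  refine h.mono (fun _ _ _ h h' => Or.inl ⟨h, h'⟩) ?_
  rintro e' a b - - - (hd | hd | ⟨hd, h' | ⟨s', hs', h'⟩⟩)
  · exact Or.inl (Or.inl (Or.inl hd))
  · exact Or.inl (Or.inl (Or.inr (Or.inl hd)))
  · exact Or.inl (Or.inl (Or.inr (Or.inr ⟨hd, Or.inl h'⟩)))
  · by_cases hss : s' = s
    · subst hss
      rw [hs] at h'
      rcases h' with ⟨rfl, h'⟩ | ⟨rfl, h'⟩
      · exact Or.inl (Or.inr ⟨Fin.ext hd, rfl, (Option.some.inj h').symm⟩)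
      · exact Or.inr ⟨Fin.ext hd, (Option.some.inj h').symm, rfl⟩
    · have : (s' : ℕ) ≠ s := fun h => hss (Fin.ext h)
      exact Or.inl (Or.inl (Or.inr (Or.inr ⟨hd, Or.inr ⟨s', by omega, h'⟩⟩)))

/-- Arcs from forgotten vertices to `v` were never tried, but there are none, because `v` was unseen
when those vertices were forgotten. -/
theorem ArcPhase.doneArcs_end {S : Set (DState k l m)} {q : Fin m} {v : Fin n} {e : ℕ}
    (h : ArcPhase arc T F sl q v (doneArcs F sl v e m) S) :
    ArcPhase arc T F sl q v (fun e' a b => (a ≠ v ∧ b ≠ v) ∨ (e' : ℕ) < e + 1) S := by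
  refine h.mono (fun _ _ _ h h' => Or.inl ⟨h, h'⟩) ?_
  rintro e' a b hab ha hb (h' | h')
  · exact Or.inl h'
  rcases Nat.lt_succ_iff_lt_or_eq.1 h' with h' | h'
  · exact Or.inr (Or.inl h')
  by_cases hav : a = v
  · rcases hb with hb | ⟨s, hs⟩
    · exact Or.inr (Or.inr ⟨h', Or.inl ⟨hav, hb⟩⟩)
    · exact Or.inr (Or.inr ⟨h', Or.inr ⟨s, s.2, Or.inl ⟨hav, hs⟩⟩⟩)
  by_cases hbv : b = v
  · subst hbv
    rcases ha with ha | ⟨s, hs⟩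
    · exact absurd hab (h.adj a ha).2
    · exact Or.inr (Or.inr ⟨h', Or.inr ⟨s, s.2, Or.inr ⟨rfl, hs⟩⟩⟩)
  · exact Or.inl ⟨hav, hbv⟩

/-- Bounds for the running times of the loops of `introStmt`. -/
def slotTime (N : ℕ) : ℕ := 2 * passTime N + 60

def arcTime (m N : ℕ) : ℕ := 4 + (passTime N + (9 + m * (slotTime N + 12)))

def introTime (k l m N : ℕ) : ℕ :=
  12 + (9 + (k + l + 1) * (passTime N + 12) + (9 + l * (arcTime m N + 12)))

theorem run_slot (hB : WordOK k l n m (2 ^ w)) (h : Ctx arc T m σ) (hsl : SlotRep sl σ)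
    {q s : Fin m} {v : Fin n} {e : Fin l} (hq : σ.reg .q = q) (hv : σ.reg .v = v)
    (he : σ.reg .e = e) (hs : σ.reg .h = s)
    (hA : ArcPhase arc T F sl q v (doneArcs F sl v e s) (absTab k l m σ)) :
    Run w (.ite (.get .slot Var.h)
      (.set .u (.get .slot Var.h - 1) ;;
        .ite (.get .mat (Var.v * Var.n + Var.u))
          (.set .s1 Var.q ;; .set .s2 Var.h ;; pass 1 arcBody) .skip ;;
        .ite (.get .mat (Var.u * Var.n + Var.v))
          (.set .s1 Var.h ;; .set .s2 Var.q ;; pass 1 arcBody) .skip) .skip) σ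
      (slotTime (numCodes k l m)) (fun σ' =>
        ArcPhase arc T F sl q v (doneArcs F sl v e (s + 1)) (absTab k l m σ')) := by
  have hB1 := hB.one_lt
  have hBn := hB.n_lt
  have hBm := hB.mat
  have hsv := hsl s
  have hc1 : (Ex.get .slot Var.h).cost = 3 := rfl
  refine (Run.of_ite (c := Ex.get .slot Var.h) (t := 2 * passTime (numCodes k l m) + 56)
    trivial (fun hne => ?_)
    fun hz => ?_).mono (by rw [hc1]; unfold slotTime; omega) fun _ => id
  · rw [Ex.val_get, Ex.val_var, hs, hsv] at hne
    obtain ⟨u, hu⟩ : ∃ u, sl s = some u := by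
      cases hsl' : sl s with
      | none => simp [hsl', slotVal] at hne
      | some u => exact ⟨u, rfl⟩
    have hidx : ∀ a b : Fin n, a * n + b < 2 ^ w ∧ a * n < 2 ^ w := by
      intro a b
      have := a.2
      have := b.2
      have : (a : ℕ) * n ≤ n * n := Nat.mul_le_mul_right _ a.2.le
      constructor <;> nlinarith
    have hset : Run w (.set .u (.get .slot Var.h - 1)) σ 7 (fun σ₁ => σ₁ = σ.setReg .u u) := by
      refine Run.of_set (e := .get .slot Var.h - 1) ?_ ?_
      · rw [Ex.ok_sub, Ex.ok_get, Ex.ok_one, Ex.val_get, Ex.val_var, hs, hsv, hu]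
        have := u.2
        exact ⟨trivial, hB1, by simp only [slotVal, Ex.val_one]; omega⟩
      · rw [Ex.val_sub, Ex.val_get, Ex.val_var, hs, hsv, hu]
        simp [slotVal]
    -- Both directions between `u` and `v` at once. If the matrix has no arc, the attempt counts as
    -- made.
    have hab : ∀ (x y x' y' : Var) (a b : Fin n) (t t' : Fin m)
        (done : Fin l → Fin n → Fin n → Prop) (σ₁ : HState), Ctx arc T m σ₁ → σ₁.reg x = a →
        σ₁.reg y = b → σ₁.reg x' = t → σ₁.reg y' = t' → y' ≠ .s1 → σ₁.reg .e = e →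
        sl t = some a → sl t' = some b → ArcPhase arc T F sl q v done (absTab k l m σ₁) →
        Run w (.ite (.get .mat (x * Var.n + y))
          (.set .s1 x' ;; .set .s2 y' ;; pass 1 arcBody) .skip) σ₁
          (passTime (numCodes k l m) + 20) (fun σ' =>
            ArcPhase arc T F sl q v (addArc done e a b) (absTab k l m σ')) := by
      intro x y x' y' a b t t' done σ₁ h₁ hx hy hx' hy' hne' he hsa hsb hAP
      have hc2 : (Ex.get .mat (x * Var.n + y)).cost = 9 := rfl
      have hval : (Ex.get .mat (x * Var.n + y)).val σ₁ = σ₁.mem .mat (a * n + b) := by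
        simp only [Ex.val_get, Ex.val_add, Ex.val_mul, Ex.val_var, hx, hy, h₁.regn]
      refine (Run.of_ite (t := passTime (numCodes k l m) + 8) ?_ (fun hne => ?_) fun hz => ?_).mono
        (by rw [hc2]; omega) fun _ => id
      · simp only [Ex.ok_get, Ex.ok_add, Ex.ok_mul, Ex.ok_var, Ex.val_mul, Ex.val_var, hx, hy,
          h₁.regn, true_and]
        exact ⟨(hidx a b).2, (hidx a b).1⟩
      · rw [hval, h₁.mat] at hne
        have hrun : Run w (pass 1 arcBody) ((σ₁.setReg .s1 t).setReg .s2 t')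
            (passTime (numCodes k l m)) (fun σ' =>
            ArcPhase arc T F sl q v (addArc done e a b) (absTab k l m σ')) := by
          refine (run_arc hB ((h₁.setReg (by simp)).setReg (by simp)) (s := t) (s' := t') (e := e)
            (by simp) (by simp) (by simpa using he)).mono le_rfl fun σ₃ h₃ => ?_
          rw [h₃]
          exact hAP.step hsa hsb hne e
        refine (Run.andThen (t := 4) (t' := passTime (numCodes k l m) + 4) (Run.of_set (e := x')
          (Q := fun σ₂ => σ₂ = σ₁.setReg .s1 t) trivial (by simp [hx'])) ?_).mono (by omega)
          fun _ => id
        rintro σ₂ - rfl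
        refine (Run.andThen (t := 4) (t' := passTime (numCodes k l m)) (Run.of_set (e := y')
          (Q := fun σ₂ => σ₂ = (σ₁.setReg .s1 t).setReg .s2 t') trivial (by simp [hy', hne'])) ?_).mono
          (by omega) fun _ => id
        rintro σ₂ - rfl
        exact hrun
      · rw [hval] at hz
        exact Run.of_skip (hAP.skip (fun hadj => (h₁.mat a b).2 hadj hz) e)
    refine (Run.andThen hset (t' := 2 * passTime (numCodes k l m) + 40) ?_).mono (by omega)
      fun _ => id
    rintro σ₁ - rfl
    refine (Run.andThen (hab .v .u .q .h v u q s _ (σ.setReg .u u) (h.setReg (by simp))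
      (by simpa using hv) (by simp) (by simpa using hq) (by simpa using hs) (by simp)
      (by simpa using he) hA.slot hu hA) (t' := passTime (numCodes k l m) + 20) ?_).mono (by omega)
      fun _ => id
    intro σ₂ hs₂ h₂
    refine (hab .u .v .h .q u v s q _ σ₂ ((h.setReg (by simp)).same hs₂ rfl)
      (by rw [hs₂.reg _ rfl]; simp) (by rw [hs₂.reg _ rfl]; simpa using hv)
      (by rw [hs₂.reg _ rfl]; simpa using hs) (by rw [hs₂.reg _ rfl]; simpa using hq) (by simp)
      (by rw [hs₂.reg _ rfl]; simpa using he) hu hA.slot h₂).mono le_rfl fun σ₃ h₃ => ?_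
    exact h₃.doneArcs_some hu
  · rw [Ex.val_get, Ex.val_var, hs, hsv] at hz
    have hu : sl s = none := by
      cases hsl' : sl s with
      | none => rfl
      | some u => simp [hsl', slotVal] at hz
    exact Run.of_skip (hA.doneArcs_none hu)

theorem run_intro (hB : WordOK k l n m (2 ^ w)) (h : Ctx arc T m σ) (hsl : SlotRep sl σ)
    (hC : Correct arc T F sl (absTab k l m σ)) {q : Fin m} (hq : σ.reg .q = q) {v : Fin n}
    (hv : σ.reg .v = v) (hslq : sl q = none) (hnew : ¬ Seen F sl v) :
    Run w introStmt σ (introTime k l m (numCodes k l m)) (fun σ' =>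
      SlotRep (Function.update sl q (some v)) σ' ∧
      Correct arc T F (Function.update sl q (some v)) (absTab k l m σ')) := by
  set sl' := Function.update sl q (some v) with hsl'
  have hBn := hB.n_lt
  have hv2 := v.2
  set σ₀ := (σ.setMem .slot q (v + 1)).setReg .s1 q with hσ₀
  have hput : Run w (.put .slot Var.q (Var.v + 1)) σ 8
      (fun σ₁ => σ₁ = σ.setMem .slot q (v + 1)) := by
    refine Run.mono (Run.of_wp (S := .put .slot Var.q (Var.v + 1)) ?_) (by decide) fun _ => id
    refine ⟨trivial, ?_, ?_⟩
    · rw [Ex.ok_add, Ex.ok_one, Ex.val_var, hv, Ex.val_one]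
      exact ⟨trivial, by omega, by omega⟩
    · simp [hq, hv]
  have hset : Run w (.set .s1 Var.q) (σ.setMem .slot q (v + 1)) 4 (fun σ₁ => σ₁ = σ₀) :=
    Run.of_set (e := Var.q) trivial (by simp [hσ₀, hq])
  have h₀ : Ctx arc T m σ₀ := h.congr (fun x hx => by
    simp only [List.mem_cons, List.not_mem_nil, or_false] at hx
    rcases hx with rfl | rfl | rfl | rfl | rfl | rfl | rfl <;> simp [hσ₀]) (fun a ha => by
    simp only [List.mem_cons, List.not_mem_nil, or_false] at ha
    rw [hσ₀, HState.mem_setReg, HState.mem_setMem_of_ne]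
    rcases ha with rfl | rfl | rfl <;> simp)
  have hrep : SlotRep sl' σ₀ := hsl.update q (some v)
  have htab : absTab k l m σ₀ = absTab k l m σ := absTab_congr rfl
  have hmain : Run w (.for_ .lam .R (pass 1 labelBody) ;;
      .for_ .e .l (.set .s1 Var.q ;; pass 1 takeBody ;;
      .for_ .h .m (.ite (.get .slot Var.h)
      (.set .u (.get .slot Var.h - 1) ;;
        .ite (.get .mat (Var.v * Var.n + Var.u))
          (.set .s1 Var.q ;; .set .s2 Var.h ;; pass 1 arcBody) .skip ;;
        .ite (.get .mat (Var.u * Var.n + Var.v))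
          (.set .s1 Var.h ;; .set .s2 Var.q ;; pass 1 arcBody) .skip) .skip))) σ₀
      ((9 + (k + l + 1) * (passTime (numCodes k l m) + 12)) +
        (9 + l * (arcTime m (numCodes k l m) + 12))) (fun σ' =>
      Correct arc T F sl' (absTab k l m σ')) := by
    refine Run.andThen (Run.ofLoop hB.one_lt (by simp) h₀.regR rfl rfl
      (fun i σ₁ => LabelPhase arc T F sl q v i (absTab k l m σ₁)) ?_
      fun i hi σ₁ hs₁ hi₁ hI => ?_) fun σ₁ hs₁ hQ => ?_
    · have := hC.labelPhase hslq hnew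
      rw [← htab] at this
      exact this
    · refine (run_label hB (h₀.same hs₁ rfl) (s := q) (x := i)
        (by rw [hs₁.reg _ rfl]; simp [hσ₀]) hi₁ hi).mono le_rfl fun σ₂ h₂ => ?_
      have := hI.step
      rw [← h₂] at this
      exact this
    · have h₁ := h₀.same hs₁ rfl
      have hrep₁ : SlotRep sl' σ₁ := hrep.congr (hs₁.mem _ rfl)
      have hq₁ : σ₁.reg .q = q := by rw [hs₁.reg _ rfl]; simpa [hσ₀] using hq
      have hv₁ : σ₁.reg .v = v := by rw [hs₁.reg _ rfl]; simpa [hσ₀] using hv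
      refine (Run.ofLoop hB.one_lt (by simp) h₁.regl rfl rfl (fun i σ₂ =>
        ArcPhase arc T F sl' q v (fun e' a b => (a ≠ v ∧ b ≠ v) ∨ (e' : ℕ) < i)
          (absTab k l m σ₂)) ?_ fun i hi σ₂ hs₂ hi₂ hI => ?_).mono le_rfl fun σ₂ hI =>
          hI.correct fun e _ _ _ _ _ => Or.inr e.2
      · have := hQ.arcPhase
        simpa [absTab] using this
      · have h₂ := h₁.same hs₂ rfl
        have hrep₂ : SlotRep sl' σ₂ := hrep₁.congr (hs₂.mem _ rfl)
        have hq₂ : σ₂.reg .q = q := by rw [hs₂.reg _ rfl, hq₁]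
        have hv₂ : σ₂.reg .v = v := by rw [hs₂.reg _ rfl, hv₁]
        refine Run.andThen (Run.of_set (e := Var.q) (Q := fun σ₃ => σ₃ = σ₂.setReg .s1 q) trivial
          (by simp [hq₂])) ?_
        rintro σ₃ - rfl
        refine Run.andThen (run_take hB (h₂.setReg (by simp)) (s := q) (e := ⟨i, hi⟩) (by simp)
          (by simpa using hi₂)) fun σ₃ hs₃ hQ₃ => ?_
        have h₃ := (h₂.setReg (x := .s1) (a := q) (by simp)).same hs₃ rfl
        refine (Run.ofLoop hB.one_lt (by simp) h₃.regm rfl rfl (fun j σ₄ =>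
          ArcPhase arc T F sl' q v (doneArcs F sl' v i j) (absTab k l m σ₄)) ?_
          fun j hj σ₄ hs₄ hj₄ hI₄ => ?_).mono le_rfl fun σ₄ hI₄ => hI₄.doneArcs_end
        · have := ArcPhase.doneArcs_zero (e := ⟨i, hi⟩) hI
          have hQ₄ : absTab k l m (σ₃.setReg .h 0) = addMoves (TakeMove arc q ⟨i, hi⟩)
            (absTab k l m σ₂) := hQ₃
          rw [hQ₄]
          exact this
        · exact (run_slot hB (h₃.same hs₄ rfl)
            (hrep₂.congr (by rw [hs₄.mem _ rfl, hs₃.mem _ rfl]; rfl)) (q := q) (s := ⟨j, hj⟩)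
            (v := v) (e := ⟨i, hi⟩) (by rw [hs₄.reg _ rfl, hs₃.reg _ rfl]; simpa using hq₂)
            (by rw [hs₄.reg _ rfl, hs₃.reg _ rfl]; simpa using hv₂)
            (by rw [hs₄.reg _ rfl, hs₃.reg _ rfl]; simpa using hi₂) hj₄ hI₄).mono le_rfl
              fun _ h => h
  refine (Run.andThen hput (t' := 4 + ((9 + (k + l + 1) * (passTime (numCodes k l m) + 12)) +
        (9 + l * (arcTime m (numCodes k l m) + 12)))) ?_).mono
          (by unfold introTime; omega) fun _ => id
  rintro σ₁ - rfl
  refine Run.andThen hset ?_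
  rintro σ₁ - rfl
  refine hmain.frame.mono le_rfl fun σ' h' => ⟨hrep.congr (h'.1.mem _ rfl), h'.2⟩

end

end TopDP

/-! ### The sweep over the bags -/

namespace TopDP

open WordRAM

/-- It is tested whether the vertex in the slot in variable `s2` is in the current bag. -/
def scanBagStmt : Stmt :=
  .set .u 0 ;; .for_ .h .sz
    (.ite (.ne (.get .bags (Var.pos + 1 + Var.h)) (.get .slot Var.s2 - 1)) .skip (.set .u 1))

/-- The vertices that are not in the current bag are forgotten. -/
def forgetPhase : Stmt :=
  .for_ .s2 .m (.ite (.get .slot Var.s2)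
    (scanBagStmt ;; .ite Var.u .skip forgetStmt) .skip)

/-- It is tested whether the vertex in variable `v` is in a slot, and an empty slot is sought. -/
def scanSlotsStmt : Stmt :=
  .set .u 0 ;; .for_ .h .m
    (.ite (.ne (.get .slot Var.h) (Var.v + 1))
      (.ite (.get .slot Var.h) .skip (.set .q Var.h)) (.set .u 1))

/-- The vertices of the current bag enter slots. -/
def introPhase : Stmt :=
  .for_ .ix .sz (.set .v (.get .bags (Var.pos + 1 + Var.ix)) ;;
    scanSlotsStmt ;; .ite Var.u .skip introStmt)

/-- The dynamic programme. -/
def sweepStmt : Stmt :=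
  .set .pos 0 ;; .set .D (Var.r + 1) ;;
  .for_ .b .D (.set .sz (.get .bags Var.pos) ;; forgetPhase ;; introPhase ;;
    .set .pos (Var.pos + Var.sz + 1))

section
variable {k l m n : ℕ} {arc : Fin l → Fin k × Fin k} {T : Digraph (Fin n)} {σ σ' : HState}
  {w : ℕ} {F : Set (Fin n)} {sl : Fin m → Option (Fin n)} {b : List (Fin n)}

/-- The current bag is `b`. -/
structure BagRep (w : ℕ) (b : List (Fin n)) (σ : HState) : Prop where
  sz : σ.reg .sz = b.length
  elt : ∀ j (h : j < b.length), σ.mem .bags (σ.reg .pos + 1 + j) = b[j]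
  fits : σ.reg .pos + b.length + 1 < 2 ^ w

theorem BagRep.same (h : BagRep w b σ) {S : Stmt} (hs : Same S σ σ') (h1 : S.wr .sz = false)
    (h2 : S.wr .pos = false) (h3 : S.st .bags = false) : BagRep w b σ' := by
  obtain ⟨g1, g2, g3⟩ := h
  constructor
  · rw [hs.reg _ h1, g1]
  · rwa [hs.reg _ h2, hs.mem _ h3]
  · rwa [hs.reg _ h2]

theorem run_scanBag (hB : WordOK k l n m (2 ^ w)) (hb : BagRep w b σ) {v : Fin n}
    (hv : σ.mem .slot (σ.reg .s2) = v + 1) :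
    Run w scanBagStmt σ (12 + b.length * 60) (fun σ' => σ'.reg .u ≠ 0 ↔ v ∈ b) := by
  have hB1 := hB.one_lt
  have hBn := hB.n_lt
  have hv2 := v.2
  refine (Run.andThen (t := 3) (t' := 9 + b.length * (48 + 12)) (Run.of_set (e := 0)
    (Q := fun σ' => σ' = σ.setReg .u 0) (by simp) rfl) ?_).mono (by omega) fun _ => id
  rintro σ₁ - rfl
  refine (Run.ofLoop (t := 48) hB1 (by simp) (L := b.length) (by simpa using hb.sz) rfl rfl
    (fun i σ₂ => σ₂.reg .u ≠ 0 ↔ ∃ j, ∃ h : j < b.length, j < i ∧ b[j] = v) (by simp)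
    fun i hi σ₂ hs₂ hi₂ hI => ?_).mono le_rfl fun σ₂ h => ?_
  · refine (Run.of_wp (S := .ite (.ne (.get .bags (Var.pos + 1 + Var.h)) (.get .slot Var.s2 - 1))
      .skip (.set .u 1)) ?_).mono (t' := 48) (by decide) fun _ => id
    have hfit := hb.fits
    have hval : σ₂.mem .bags (σ.reg .pos + 1 + i) = b[i] := by
      rw [hs₂.mem _ rfl]
      exact hb.elt i hi
    have hsv : σ₂.mem .slot (σ₂.reg .s2) = v + 1 := by
      rw [hs₂.mem _ rfl, hs₂.reg _ rfl]
      exact hv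
    have hpos : σ₂.reg .pos = σ.reg .pos := by
      rw [hs₂.reg _ rfl]; rfl
    simp only [Stmt.wp, Ex.ok_ne _ _ _ _ hB1, Ex.ok_get, Ex.ok_add, Ex.ok_sub, Ex.ok_var,
      Ex.ok_one, ne_eq, Ex.val_ne_eq_zero, Ex.val_get, Ex.val_add, Ex.val_sub, Ex.val_var,
      Ex.val_one, hval, hsv, hpos, hi₂, true_and, Nat.add_sub_cancel]
    refine ⟨⟨⟨⟨hB1, by omega⟩, by omega⟩, hB1, by omega⟩, fun hne => ?_, fun heq => ⟨hB1, ?_⟩⟩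
    · simp only [HState.reg_setReg, reduceCtorEq, if_false]
      rw [← ne_eq, hI]
      constructor
      · rintro ⟨j, h, hj, he⟩
        exact ⟨j, h, by omega, he⟩
      · rintro ⟨j, h, hj, he⟩
        refine ⟨j, h, lt_of_le_of_ne (by omega) ?_, he⟩
        rintro rfl
        exact hne (by rw [he])
    · simp only [HState.reg_setReg, reduceCtorEq, if_false, if_true]
      exact iff_of_true (by simp) ⟨i, hi, by omega, Fin.ext heq⟩
  · rw [h, List.mem_iff_getElem]
    constructor
    · rintro ⟨j, h, -, he⟩
      exact ⟨j, h, he⟩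
    · rintro ⟨j, h, he⟩
      exact ⟨j, h, h, he⟩

theorem slotVal_eq_zero {o : Option (Fin n)} : slotVal o = 0 ↔ o = none := by
  cases o <;> simp [slotVal]

theorem slotVal_eq_succ {o : Option (Fin n)} {v : Fin n} : slotVal o = v + 1 ↔ o = some v := by
  cases o <;> simp [slotVal, Fin.ext_iff]

/-- A bound for the running time of `forgetPhase`. -/
def forgetPhaseTime (l m N : ℕ) : ℕ := 9 + m * (m * 60 + forgetTime l N + 50)

theorem run_forgetPhase (hB : WordOK k l n m (2 ^ w)) (h : Ctx arc T m σ) (hsl : SlotRep sl σ)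
    (hC : Correct arc T F sl (absTab k l m σ)) (hb : BagRep w b σ) (hbm : b.length ≤ m)
    (ha : ∀ s v, sl s = some v → v ∉ b → ∀ u, ¬ Seen F sl u → T.Adj u v ∧ ¬ T.Adj v u) :
    Run w forgetPhase σ (forgetPhaseTime l m (numCodes k l m)) (fun σ' => ∃ F' sl',
      SlotRep sl' σ' ∧ Correct arc T F' sl' (absTab k l m σ') ∧
      (∀ v, Seen F' sl' v ↔ Seen F sl v) ∧ (∀ s v, sl' s = some v → v ∈ b) ∧
      ∀ v ∈ F', v ∈ F ∨ v ∉ b) := by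
  -- Slots from `i` on are untouched, so `ha` still applies to them; the slots before hold only
  -- vertices of the bag. Forgetting does not alter which vertices have been seen.
  refine (Run.ofLoop (t := b.length * 60 + forgetTime l (numCodes k l m) + 38)
    hB.one_lt (by simp) h.regm rfl rfl (fun i σ₁ => ∃ F' sl',
      SlotRep sl' σ₁ ∧ Correct arc T F' sl' (absTab k l m σ₁) ∧
      (∀ v, Seen F' sl' v ↔ Seen F sl v) ∧ (∀ s : Fin m, i ≤ s → sl' s = sl s) ∧
      (∀ s : Fin m, (s : ℕ) < i → ∀ v, sl' s = some v → v ∈ b) ∧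
      ∀ v ∈ F', v ∈ F ∨ v ∉ b) ?_ ?_).mono ?_ ?_
  · exact ⟨F, sl, hsl, hC, fun _ => Iff.rfl, fun _ _ => rfl, by simp, fun v hv => Or.inl hv⟩
  · rintro i hi σ₁ hs₁ hi₁ ⟨F', sl', hsl', hC', hseen, hge, hlt, hF'⟩
    have hr₁ := hsl' ⟨i, hi⟩
    have hc : (Ex.get .slot Var.s2).cost = 3 := rfl
    have hskip : (∀ v, sl' ⟨i, hi⟩ = some v → v ∈ b) → ∀ σ₂ : HState,
        σ₂.mem .slot = σ₁.mem .slot → σ₂.mem .tab = σ₁.mem .tab → ∃ F' sl',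
        SlotRep sl' σ₂ ∧ Correct arc T F' sl' (absTab k l m σ₂) ∧
        (∀ v, Seen F' sl' v ↔ Seen F sl v) ∧ (∀ s : Fin m, i + 1 ≤ s → sl' s = sl s) ∧
        (∀ s : Fin m, (s : ℕ) < i + 1 → ∀ v, sl' s = some v → v ∈ b) ∧
        ∀ v ∈ F', v ∈ F ∨ v ∉ b := by
      intro hin σ₂ hms hmt
      refine ⟨F', sl', hsl'.congr hms, by rwa [absTab_congr hmt], hseen,
        fun s hs => hge s (by omega), fun s hs v hv => ?_, hF'⟩
      rcases Nat.lt_succ_iff_lt_or_eq.1 hs with hs | hs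
      · exact hlt s hs v hv
      · obtain rfl : s = ⟨i, hi⟩ := Fin.ext hs
        exact hin v hv
    refine (Run.of_ite (c := Ex.get .slot Var.s2)
      (t := b.length * 60 + forgetTime l (numCodes k l m) + 34) trivial
      (fun hne => ?_) fun hz => ?_).mono (by rw [hc]; omega) fun _ => id
    · rw [Ex.val_get, Ex.val_var, hi₁] at hne
      obtain ⟨v, hv⟩ : ∃ v, sl' ⟨i, hi⟩ = some v := by
        rw [← Option.ne_none_iff_exists']
        intro hnone
        rw [hnone] at hr₁
        exact hne hr₁
      have hb₁ := hb.same hs₁ rfl rfl rfl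
      have hcu : (Ex.var .u).cost = 2 := rfl
      refine (Run.andThen (t' := forgetTime l (numCodes k l m) + 20) (run_scanBag hB hb₁ (v := v)
        (by rw [hi₁, hr₁, hv]; rfl)) fun σ₂ hs₂ hu₂ => ?_).mono (by omega) fun _ => id
      have hms : σ₂.mem .slot = σ₁.mem .slot := hs₂.mem _ rfl
      have hmt : σ₂.mem .tab = σ₁.mem .tab := hs₂.mem _ rfl
      refine (Run.of_ite (c := Ex.var .u) (t := forgetTime l (numCodes k l m)) trivial
        (fun hne₂ => ?_) fun hz₂ => ?_).mono (by rw [hcu]; omega) fun _ => id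
      · refine Run.of_skip (hskip ?_ (σ₂.setReg .s2 (i + 1)) hms hmt)
        intro v' hv'
        obtain rfl : v = v' := Option.some.inj (hv.symm.trans hv')
        exact hu₂.1 hne₂
      · have hvb : v ∉ b := fun hvb => hu₂.2 hvb hz₂
        have hvi := (hge ⟨i, hi⟩ le_rfl).symm.trans hv
        refine (run_forget hB ((h.same hs₁ rfl).same hs₂ rfl) (hsl'.congr hms)
          (by rwa [absTab_congr hmt]) (s := ⟨i, hi⟩) (by rw [hs₂.reg _ rfl, hi₁]) hv
          (fun u hu => ha _ v hvi hvb u fun hu' => hu ((hseen u).2 hu'))).mono le_rfl ?_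
        rintro σ₃ ⟨hsl₃, hC₃⟩
        refine ⟨insert v F', Function.update sl' ⟨i, hi⟩ none, hsl₃, hC₃, fun u => ?_,
          fun s hs => ?_, fun s hs u hu => ?_, fun u hu => ?_⟩
        · rw [seen_update_none hv, hseen]
        · have : s ≠ ⟨i, hi⟩ := by rintro rfl; simp at hs
          rw [Function.update_of_ne this, hge s (by omega)]
        · have : s ≠ ⟨i, hi⟩ := by rintro rfl; simp at hu
          rw [Function.update_of_ne this] at hu
          have : (s : ℕ) ≠ i := fun h => this (Fin.ext h)
          exact hlt s (by omega) u hu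
        · rcases hu with rfl | hu
          · exact Or.inr hvb
          · exact hF' u hu
    · rw [Ex.val_get, Ex.val_var, hi₁] at hz
      refine Run.of_skip (hskip ?_ (σ₁.setReg .s2 (i + 1)) rfl rfl)
      intro v hv
      rw [hv] at hr₁
      change σ₁.mem .slot i = v + 1 at hr₁
      omega
  · unfold forgetPhaseTime
    exact Nat.add_le_add_left (Nat.mul_le_mul le_rfl (by omega)) _
  · rintro σ₁ ⟨F', sl', h1, h2, h3, -, h5, h6⟩
    exact ⟨F', sl', h1, h2, h3, fun s v hv => h5 s s.2 v hv, h6⟩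

theorem run_scanSlots (hB : WordOK k l n m (2 ^ w)) (h : Ctx arc T m σ) (hsl : SlotRep sl σ)
    {v : Fin n} (hv : σ.reg .v = v) :
    Run w scanSlotsStmt σ (12 + m * 60) (fun σ' => (σ'.reg .u ≠ 0 ↔ ∃ s, sl s = some v) ∧
      ((∃ s, sl s = none) → ∃ s : Fin m, σ'.reg .q = s ∧ sl s = none)) := by
  have hB1 := hB.one_lt
  have hBn := hB.n_lt
  have hv2 := v.2
  refine (Run.andThen (t := 3) (t' := 9 + m * (48 + 12)) (Run.of_set (e := 0)
    (Q := fun σ' => σ' = σ.setReg .u 0) (by simp) rfl) ?_).mono (by omega) fun _ => id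
  rintro σ₁ - rfl
  refine (Run.ofLoop (t := 48) hB1 (by simp) (L := m) (by simpa using h.regm) rfl rfl
    (fun i σ₂ => (σ₂.reg .u ≠ 0 ↔ ∃ s : Fin m, (s : ℕ) < i ∧ sl s = some v) ∧
      ((∃ s : Fin m, (s : ℕ) < i ∧ sl s = none) → ∃ s : Fin m, σ₂.reg .q = s ∧ sl s = none))
    (by simp) ?_).mono le_rfl fun σ₂ h => ?_
  · rintro i hi σ₂ hs₂ hi₂ ⟨hI1, hI2⟩
    refine (Run.of_wp (S := .ite (.ne (.get .slot Var.h) (Var.v + 1))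
      (.ite (.get .slot Var.h) .skip (.set .q Var.h)) (.set .u 1)) ?_).mono (by decide) fun _ => id
    have hsv : σ₂.mem .slot i = slotVal (sl ⟨i, hi⟩) := by
      rw [hs₂.mem _ rfl]
      exact hsl ⟨i, hi⟩
    have hv₂ : σ₂.reg .v = v := by
      rw [hs₂.reg _ rfl]
      exact hv
    have hlt : ∀ s : Fin m, (s : ℕ) < i + 1 → (s : ℕ) < i ∨ s = ⟨i, hi⟩ := fun s hs =>
      (Nat.lt_succ_iff_lt_or_eq.1 hs).imp_right fun h => Fin.ext h
    simp only [Stmt.wp, Ex.ok_ne _ _ _ _ hB1, Ex.ok_get, Ex.ok_add, Ex.ok_var,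
      Ex.ok_one, ne_eq, Ex.val_ne_eq_zero, Ex.val_get, Ex.val_add, Ex.val_var,
      Ex.val_one, hsv, hv₂, hi₂, true_and, slotVal_eq_zero, slotVal_eq_succ, HState.reg_setReg,
      reduceCtorEq, if_false, if_true]
    refine ⟨⟨hB1, by omega⟩, fun hne => ⟨fun hne' => ⟨?_, ?_⟩, fun hz => ⟨?_, ?_⟩⟩,
      fun heq => ⟨hB1, ?_, ?_⟩⟩
    · rw [← ne_eq, hI1]
      refine exists_congr fun s => ⟨fun h => ⟨by omega, h.2⟩, fun h => ⟨?_, h.2⟩⟩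
      rcases hlt s h.1 with h' | rfl
      · exact h'
      · exact absurd h.2 hne
    · rintro ⟨s, hs, hn⟩
      rcases hlt s hs with h' | rfl
      · exact hI2 ⟨s, h', hn⟩
      · exact absurd hn hne'
    · rw [← ne_eq, hI1]
      refine exists_congr fun s => ⟨fun h => ⟨by omega, h.2⟩, fun h => ⟨?_, h.2⟩⟩
      rcases hlt s h.1 with h' | rfl
      · exact h'
      · exact absurd h.2 hne
    · exact fun _ => ⟨⟨i, hi⟩, rfl, hz⟩
    · exact iff_of_true (by simp) ⟨⟨i, hi⟩, by simp, heq⟩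
    · rintro ⟨s, hs, hn⟩
      rcases hlt s hs with h' | rfl
      · exact hI2 ⟨s, h', hn⟩
      · rw [heq] at hn
        exact absurd hn (by simp)
  · refine ⟨h.1.trans (exists_congr fun s => and_iff_right s.2), fun ⟨s, hs⟩ => h.2 ⟨s, s.2, hs⟩⟩

/-- The occupied slots hold distinct vertices of the bag other than `v`, so there are fewer of them
than `m`. -/
theorem exists_empty_slot (hnd : b.Nodup) (hbm : b.length ≤ m) (hok : SlotsOK F sl)
    (hsub : ∀ s v, sl s = some v → v ∈ b) {v : Fin n} (hv : v ∈ b) (hvs : ¬ ∃ s, sl s = some v) :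
    ∃ s, sl s = none := by
  classical
  by_contra! hne
  choose f hf using fun s => Option.ne_none_iff_exists'.1 (hne s)
  have hinj : Function.Injective f := fun s s' h => hok.inj s s' (f s) (hf s) (by rw [h, hf s'])
  have h1 : (Finset.univ.image f) ⊆ b.toFinset.erase v := by
    intro x hx
    obtain ⟨s, -, rfl⟩ := Finset.mem_image.1 hx
    refine Finset.mem_erase.2 ⟨?_, List.mem_toFinset.2 (hsub s _ (hf s))⟩
    rintro h
    exact hvs ⟨s, h ▸ hf s⟩
  have h2 := Finset.card_le_card h1
  rw [Finset.card_image_of_injective _ hinj, Finset.card_univ, Fintype.card_fin,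
    Finset.card_erase_of_mem (List.mem_toFinset.2 hv), List.toFinset_card_of_nodup hnd] at h2
  have := List.length_pos_of_mem hv
  omega

/-- A bound for the running time of `introPhase`. -/
def introPhaseTime (k l m N : ℕ) : ℕ := 9 + m * (m * 60 + introTime k l m N + 50)

theorem run_introPhase (hB : WordOK k l n m (2 ^ w)) (h : Ctx arc T m σ) (hsl : SlotRep sl σ)
    (hC : Correct arc T F sl (absTab k l m σ)) (hb : BagRep w b σ) (hbm : b.length ≤ m)
    (hnd : b.Nodup) (hsub : ∀ s v, sl s = some v → v ∈ b) (hF : ∀ v ∈ b, v ∉ F) :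
    Run w introPhase σ (introPhaseTime k l m (numCodes k l m)) (fun σ' => ∃ sl',
      SlotRep sl' σ' ∧ Correct arc T F sl' (absTab k l m σ') ∧
      (∀ v, Seen F sl' v ↔ Seen F sl v ∨ v ∈ b) ∧ ∀ s v, sl' s = some v → v ∈ b) := by
  refine (Run.ofLoop (t := m * 60 + introTime k l m (numCodes k l m) + 38)
    hB.one_lt (by simp) hb.sz rfl rfl (fun i σ₁ => ∃ sl',
      SlotRep sl' σ₁ ∧ Correct arc T F sl' (absTab k l m σ₁) ∧
      (∀ v, Seen F sl' v → Seen F sl v ∨ v ∈ b) ∧ (∀ v, Seen F sl v → Seen F sl' v) ∧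
      (∀ j (h : j < b.length), j < i → Seen F sl' b[j]) ∧
      ∀ s v, sl' s = some v → v ∈ b) ?_ ?_).mono ?_ ?_
  · exact ⟨sl, hsl, hC, fun _ => Or.inl, fun _ => id, by simp, hsub⟩
  · rintro i hi σ₁ hs₁ hi₁ ⟨sl', hsl', hC', hseen, hseen', hI, hsub'⟩
    have hb₁ := hb.same hs₁ rfl rfl rfl
    have hfit := hb₁.fits
    have hc : (Ex.get .bags (Var.pos + 1 + Var.ix) : Ex).cost = 8 := rfl
    have hB1 := hB.one_lt
    have hvb : b[i] ∈ b := List.getElem_mem hi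
    refine (Run.andThen (t' := m * 60 + introTime k l m (numCodes k l m) + 20)
      (Run.of_set (e := .get .bags (Var.pos + 1 + Var.ix))
      (Q := fun σ₂ => σ₂ = σ₁.setReg .v b[i]) ?_ ?_) ?_).mono (by rw [hc]; omega) fun _ => id
    · rw [Ex.ok_get, Ex.ok_add, Ex.ok_add, Ex.ok_one, Ex.val_add, Ex.val_var, Ex.val_var,
        Ex.val_one, hi₁]
      exact ⟨⟨trivial, hB1, by omega⟩, trivial, by omega⟩
    · rw [Ex.val_get, Ex.val_add, Ex.val_add, Ex.val_var, Ex.val_var, Ex.val_one, hi₁,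
        hb₁.elt i hi]
    rintro σ₂ - rfl
    have h₂ : Ctx arc T m (σ₁.setReg .v b[i]) := (h.same hs₁ rfl).setReg (by simp)
    have hcu : (Ex.var .u).cost = 2 := rfl
    refine (Run.andThen (t' := introTime k l m (numCodes k l m) + 3) (run_scanSlots hB h₂ hsl'
      (v := b[i]) (by simp)) fun σ₃ hs₃ hu₃ => ?_).mono (by omega) fun _ => id
    have hms : σ₃.mem .slot = σ₁.mem .slot := hs₃.mem _ rfl
    have hmt : σ₃.mem .tab = σ₁.mem .tab := hs₃.mem _ rfl
    refine (Run.of_ite (c := Ex.var .u) (t := introTime k l m (numCodes k l m)) trivial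
      (fun hne₂ => ?_) fun hz₂ => ?_).mono (by rw [hcu]; omega) fun _ => id
    · refine Run.of_skip ⟨sl', hsl'.congr hms, ?_, hseen, hseen', fun j hj hji => ?_, hsub'⟩
      · rw [absTab_congr (σ := σ₁) (σ' := σ₃.setReg .ix (i + 1)) hmt]
        exact hC'
      rcases Nat.lt_succ_iff_lt_or_eq.1 hji with hji | rfl
      · exact hI j hj hji
      · exact Or.inr (hu₃.1.1 hne₂)
    · have hvs : ¬ ∃ s, sl' s = some b[i] := fun hex => hu₃.1.2 hex hz₂
      obtain ⟨q, hq, hqn⟩ := hu₃.2 (exists_empty_slot hnd hbm hC'.ok hsub' hvb hvs)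
      have hns : ¬ Seen F sl' b[i] := by
        rintro (h | h)
        · exact hF _ hvb h
        · exact hvs h
      refine (run_intro hB (h₂.same hs₃ rfl) (hsl'.congr hms)
        (by rw [absTab_congr (σ := σ₁) hmt]; exact hC') hq
        (by rw [hs₃.reg _ rfl]; simp) hqn hns).mono le_rfl ?_
      rintro σ₄ ⟨hsl₄, hC₄⟩
      have hsu := seen_update_some (F := F) (v := b[i]) hqn
      refine ⟨_, hsl₄, hC₄, fun v hv => ?_, fun v hv => (hsu v).2 (Or.inl (hseen' v hv)),
        fun j hj hji => (hsu _).2 ?_, fun s v hs => ?_⟩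
      · rcases (hsu v).1 hv with hv | rfl
        · exact hseen v hv
        · exact Or.inr hvb
      · rcases Nat.lt_succ_iff_lt_or_eq.1 hji with hji | rfl
        · exact Or.inl (hI j hj hji)
        · exact Or.inr rfl
      · by_cases hsq : s = q
        · subst hsq
          rw [Function.update_self] at hs
          exact Option.some.inj hs ▸ hvb
        · rw [Function.update_of_ne hsq] at hs
          exact hsub' s v hs
  · unfold introPhaseTime
    exact Nat.add_le_add_left (Nat.mul_le_mul hbm (by omega)) _
  · rintro σ₁ ⟨sl', h1, h2, h3, h4, h5, h6⟩
    refine ⟨sl', h1, h2, fun v => ⟨h3 v, ?_⟩, h6⟩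
    rintro (hv | hv)
    · exact h4 v hv
    · obtain ⟨j, hj, rfl⟩ := List.mem_iff_getElem.1 hv
      exact h5 j hj hj

/-- The bags of a path decomposition, followed by empty bags. -/
structure IsBagSeq (T : Digraph (Fin n)) (r : ℕ) (bag : ℕ → List (Fin n)) : Prop where
  nodup : ∀ i, (bag i).Nodup
  empty : ∀ i, r ≤ i → bag i = []
  cover : ∀ v, ∃ i, v ∈ bag i
  interval : ∀ i j l, i < j → j < l → ∀ v, v ∈ bag i → v ∈ bag l → v ∈ bag j
  arc : ∀ u v, T.Adj u v → (∃ i, u ∈ bag i ∧ v ∈ bag i) ∨ ∃ i j, j < i ∧ u ∈ bag i ∧ v ∈ bag j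

section
variable {r : ℕ} {bag : ℕ → List (Fin n)}

theorem IsBagSeq.not_mem_of_le (hW : IsBagSeq T r bag) {i j i' : ℕ} {v : Fin n} (hj : v ∈ bag j)
    (hji : j < i) (hi : v ∉ bag i) (hi' : i ≤ i') : v ∉ bag i' := by
  intro h
  rcases Nat.lt_or_eq_of_le hi' with h' | rfl
  · exact hi (hW.interval j i i' hji h' v hj h)
  · exact hi h

/-- All bags with `v` come before `i`, all bags with `u` do not. An arc from `v` to `u` would need a
common bag or a bag of `v` after one of `u`. Semi-completeness then gives the reverse arc. -/
theorem IsBagSeq.separated (hT : SemiComplete T) (hW : IsBagSeq T r bag) {i j : ℕ} {u v : Fin n}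
    (hj : v ∈ bag j) (hji : j < i) (hi : v ∉ bag i) (hu : ∀ j < i, u ∉ bag j) :
    T.Adj u v ∧ ¬ T.Adj v u := by
  have hna : ¬ T.Adj v u := by
    intro hadj
    rcases hW.arc v u hadj with ⟨a, hva, hua⟩ | ⟨a, c, hca, hva, huc⟩
    · by_cases ha : a < i
      · exact hu a ha hua
      · exact hW.not_mem_of_le hj hji hi (by omega) hva
    · by_cases ha : a < i
      · exact hu c (by omega) huc
      · exact hW.not_mem_of_le hj hji hi (by omega) hva
  refine ⟨(hT.2 u v ?_).resolve_right hna, hna⟩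
  rintro rfl
  exact hu j hji hj

/-- A bound for the running time of one step of `sweepStmt`. -/
def bagTime (k l m N : ℕ) : ℕ := forgetPhaseTime l m N + introPhaseTime k l m N + 20

/-- The loop makes `r + 1` rounds. The last one deals with an empty bag, whose size 0 is read behind
the input, and forgets all remaining vertices. -/
theorem run_sweep (hB : WordOK k l n m (2 ^ w)) (hT : SemiComplete T) (hW : IsBagSeq T r bag)
    (hbm : ∀ i, (bag i).length ≤ m) (h : Ctx arc T m σ) (hr : σ.reg .r = r)
    {pos : ℕ → ℕ} (hpos0 : pos 0 = 0) (hpos : ∀ i, pos (i + 1) = pos i + (bag i).length + 1)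
    (hfit : pos (r + 1) < 2 ^ w) (hr1 : r + 1 < 2 ^ w)
    (hsz : ∀ i ≤ r, σ.mem .bags (pos i) = (bag i).length)
    (helt : ∀ i ≤ r, ∀ j (h : j < (bag i).length), σ.mem .bags (pos i + 1 + j) = (bag i)[j])
    (hslot : ∀ i, σ.mem .slot i = 0) (htab : absTab k l m σ = {fun _ => 0}) :
    Run w sweepStmt σ (18 + (r + 1) * (bagTime k l m (numCodes k l m) + 12)) (fun σ' => ∃ F sl,
      Correct (m := m) arc T F sl (absTab k l m σ') ∧ ∀ v, v ∈ F) := by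
  have hB1 := hB.one_lt
  have hmono : Monotone pos := monotone_nat_of_le_succ fun i => by rw [hpos]; omega
  refine (Run.andThen (t := 3) (t' := 15 + (r + 1) * (bagTime k l m (numCodes k l m) + 12))
    (Run.of_set (e := 0) (Q := fun σ₁ => σ₁ = σ.setReg .pos 0) (by simp) (by simp)) ?_).mono
    (by omega) fun _ => id
  rintro σ₁ - rfl
  refine (Run.andThen (t := 6) (t' := 9 + (r + 1) * (bagTime k l m (numCodes k l m) + 12))
    (Run.of_set (e := Var.r + 1) (Q := fun σ₁ => σ₁ = (σ.setReg .pos 0).setReg .D (r + 1)) ?_ ?_)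
    ?_).mono (by omega) fun _ => id
  · simp only [Ex.ok_add, Ex.ok_var, Ex.ok_one, Ex.val_var, Ex.val_one, HState.reg_setReg,
      reduceCtorEq, if_false, hr, true_and]
    exact ⟨hB1, hr1⟩
  · simp [hr]
  rintro σ₁ - rfl
  set σ₀ := (σ.setReg .pos 0).setReg .D (r + 1) with hσ₀
  have h₀ : Ctx arc T m σ₀ := (h.setReg (by simp)).setReg (by simp)
  -- Before bag `i`, the seen vertices are those of earlier bags, forgotten ones do not return, and
  -- the slots hold vertices of the preceding bag only.
  refine (Run.ofLoop (L := r + 1) hB1 (by simp) (by simp [hσ₀]) rfl rfl (fun i σ₁ => ∃ F sl,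
    SlotRep (m := m) sl σ₁ ∧ Correct arc T F sl (absTab k l m σ₁) ∧ σ₁.reg .pos = pos i ∧
    (∀ v, Seen F sl v ↔ ∃ j < i, v ∈ bag j) ∧ (∀ v ∈ F, ∀ j, i ≤ j → v ∉ bag j) ∧
    ∀ s v, sl s = some v → ∃ j, i = j + 1 ∧ v ∈ bag j) ?_ ?_).mono le_rfl ?_
  · refine ⟨∅, fun _ => none, fun s => hslot s, ?_, ?_, by simp [Seen], by simp, by simp⟩
    · have htab' : absTab k l m (σ₀.setReg .b 0) = {fun _ => 0} := htab
      rw [htab']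
      exact correct_init
    · simp [hσ₀, hpos0]
  · rintro i hi σ₁ hs₁ hi₁ ⟨F, sl, hsl, hC, hp₁, hseen, hF, hslb⟩
    have hir : i ≤ r := by omega
    have h₁ := h₀.same hs₁ rfl
    have hb₁ : σ₁.mem .bags = σ.mem .bags := hs₁.mem _ rfl
    have hposi : pos i + (bag i).length + 1 < 2 ^ w := by
      rw [← hpos]
      exact (hmono hi).trans_lt hfit
    have hc : (Ex.get .bags Var.pos : Ex).cost = 3 := rfl
    refine (Run.andThen (t' := forgetPhaseTime l m (numCodes k l m) +
      (introPhaseTime k l m (numCodes k l m) + 10)) (Run.of_set (e := .get .bags Var.pos)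
      (Q := fun σ₂ => σ₂ = σ₁.setReg .sz (bag i).length) trivial ?_) ?_).mono
      (by rw [hc]; unfold bagTime; omega) fun _ => id
    · rw [Ex.val_get, Ex.val_var, hp₁, hb₁, hsz i hir]
    rintro σ₂ - rfl
    have h₂ : Ctx arc T m (σ₁.setReg .sz (bag i).length) := h₁.setReg (by simp)
    have hrep : BagRep w (bag i) (σ₁.setReg .sz (bag i).length) := by
      constructor
      · simp
      · intro j hj
        simp only [HState.reg_setReg, HState.mem_setReg, reduceCtorEq, if_false, hp₁, hb₁]
        exact helt i hir j hj
      · simpa [hp₁] using hposi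
    have hold : ∀ v, Seen F sl v → v ∉ bag i → ∀ u, ¬ Seen F sl u →
        T.Adj u v ∧ ¬ T.Adj v u := by
      intro v hv hvi u hu
      obtain ⟨j, hj, hvj⟩ := (hseen v).1 hv
      exact hW.separated hT hvj hj hvi fun j' hj' huj => hu ((hseen u).2 ⟨j', hj', huj⟩)
    refine Run.andThen (run_forgetPhase hB h₂ hsl hC hrep (hbm i) fun s v hs hvi u hu =>
      hold v (Or.inr ⟨s, hs⟩) hvi u hu) ?_
    rintro σ₃ hs₃ ⟨F', sl', hsl', hC', hseen', hsub', hF'⟩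
    have hrep₃ := hrep.same hs₃ rfl rfl rfl
    have h₃ := h₂.same hs₃ rfl
    refine Run.andThen (run_introPhase hB h₃ hsl' hC' hrep₃ (hbm i) (hW.nodup i) hsub'
      fun v hv hvF => ?_) ?_
    · rcases hF' v hvF with h' | h'
      · exact hF v h' i le_rfl hv
      · exact h' hv
    rintro σ₄ hs₄ ⟨sl'', hsl'', hC'', hseen'', hsub''⟩
    have hrep₄ := hrep₃.same hs₄ rfl rfl rfl
    have hp₄ : σ₄.reg .pos = pos i := by
      rw [hs₄.reg _ rfl, hs₃.reg _ rfl]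
      simpa using hp₁
    refine (Run.of_set (e := Var.pos + Var.sz + 1) ?_
      ⟨F', sl'', hsl'', hC'', ?_, fun v => ?_, ?_, ?_⟩).mono
      (by decide) fun _ => id
    · simp only [Ex.ok_add, Ex.ok_var, Ex.ok_one, Ex.val_add, Ex.val_var, Ex.val_one, hp₄,
        hrep₄.sz, true_and]
      exact ⟨by omega, hB1, hposi⟩
    · simp only [HState.reg_setReg, reduceCtorEq, if_false, if_true, Ex.val_add, Ex.val_var,
        Ex.val_one, hp₄, hrep₄.sz, hpos]
    · rw [hseen'', hseen', hseen]
      constructor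
      · rintro (⟨j, hj, hv⟩ | hv)
        · exact ⟨j, by omega, hv⟩
        · exact ⟨i, by omega, hv⟩
      · rintro ⟨j, hj, hv⟩
        rcases Nat.lt_succ_iff_lt_or_eq.1 hj with hj | rfl
        · exact Or.inl ⟨j, hj, hv⟩
        · exact Or.inr hv
    · intro v hv j hj
      rcases hF' v hv with h' | h'
      · exact hF v h' j (by omega)
      · obtain ⟨j', hj', hv'⟩ := (hseen v).1 ((hseen' v).1 (Or.inl hv))
        exact hW.not_mem_of_le hv' hj' h' (by omega)
    · exact fun s v hs => ⟨i, rfl, hsub'' s v hs⟩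
  · rintro σ₁ ⟨F, sl, -, hC, -, hseen, -, hslb⟩
    refine ⟨F, sl, hC, fun v => ?_⟩
    obtain ⟨i, hv⟩ := hW.cover v
    have hir : i < r + 1 := by
      by_contra hc
      rw [hW.empty i (by omega)] at hv
      simp at hv
    rcases (hseen v).2 ⟨i, hir, hv⟩ with h' | ⟨s, hs⟩
    · exact h'
    · obtain ⟨j, hj, hvj⟩ := hslb s v hs
      obtain rfl : r = j := by omega
      rw [hW.empty r le_rfl] at hvj
      simp at hvj

end

end

end TopDP

/-! ### The whole program: number of slots, weights, sweep, answer -/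

namespace TopDP

open WordRAM

/-- The number of slots becomes the size of the largest bag. -/
def sizeStmt : Stmt :=
  .set .m 0 ;; .set .pos 0 ;;
  .for_ .b .r (.set .sz (.get .bags Var.pos) ;; .ite (.lt Var.m Var.sz) (.set .m Var.sz) .skip ;;
    .set .pos (Var.pos + Var.sz + 1))

/-- The weights of the digits are computed. -/
def weightStmt : Stmt :=
  .set .nb (3 * Var.l + Var.k + 2 * Var.m) ;; .set .R (Var.k + Var.l + 1) ;;
  .set .v 1 ;; .put .wt 0 1 ;;
  .for_ .i .nb (.set .v (Var.v * 2) ;; .put .wt (Var.i + 1) Var.v) ;;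
  .for_ .i .m (.set .v (Var.v * Var.R) ;; .put .wt (Var.nb + Var.i + 1) Var.v) ;;
  .set .N Var.v

/-- The answer is read off from the table. -/
def answerStmt : Stmt :=
  .set .k (.get .tab (.get .wt (2 * Var.l + Var.k) - 1)) ;; .ite Var.k (.set .k 1) .skip

/-- The algorithm. -/
def mainStmt : Stmt :=
  sizeStmt ;; weightStmt ;; .put .tab 0 1 ;; sweepStmt ;; answerStmt

section
variable {k l m n r : ℕ} {arc : Fin l → Fin k × Fin k} {T : Digraph (Fin n)} {σ σ' : HState}
  {w : ℕ} {bag : ℕ → List (Fin n)}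

/-- The position of a bag in the array of the bags. -/
def bagPos (bag : ℕ → List (Fin n)) (i : ℕ) : ℕ := ∑ j ∈ Finset.range i, ((bag j).length + 1)

theorem bagPos_succ (bag : ℕ → List (Fin n)) (i : ℕ) :
    bagPos bag (i + 1) = bagPos bag i + (bag i).length + 1 := by
  rw [bagPos, Finset.sum_range_succ, ← bagPos, Nat.add_assoc]

/-- The size of the largest bag. -/
def maxSize (r : ℕ) (bag : ℕ → List (Fin n)) : ℕ := (Finset.range r).sup fun i => (bag i).length

theorem bagPos_le (hm : ∀ i, (bag i).length ≤ m) (i : ℕ) : bagPos bag i ≤ i * (m + 1) := by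
  have := Finset.sum_le_card_nsmul (Finset.range i) (fun j => (bag j).length + 1) (m + 1)
    fun j _ => Nat.succ_le_succ (hm j)
  simpa [bagPos] using this

theorem run_size (hw : 1 < 2 ^ w) (hfit : bagPos bag r < 2 ^ w)
    (hr : σ.reg .r = r) (hsz : ∀ i < r, σ.mem .bags (bagPos bag i) = (bag i).length) :
    Run w sizeStmt σ (15 + r * 60) (fun σ' => σ'.reg .m = maxSize r bag) := by
  have hmono : Monotone (bagPos bag) := monotone_nat_of_le_succ fun i => by
    rw [bagPos_succ]; omega
  refine (Run.andThen (t := 3) (t' := 12 + r * 60) (Run.of_set (e := 0)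
    (Q := fun σ₁ => σ₁ = σ.setReg .m 0) (by simp) rfl) ?_).mono (by omega) fun _ => id
  rintro σ₁ - rfl
  refine (Run.andThen (t := 3) (t' := 9 + r * 60) (Run.of_set (e := 0)
    (Q := fun σ₁ => σ₁ = (σ.setReg .m 0).setReg .pos 0) (by simp) rfl) ?_).mono (by omega)
    fun _ => id
  rintro σ₁ - rfl
  refine (Run.ofLoop (L := r) (t := 48) hw (by simp) (by simpa using hr) rfl rfl
    (fun i σ₁ => σ₁.reg .m = maxSize i bag ∧ σ₁.reg .pos = bagPos bag i)
    ⟨by simp [maxSize], by simp [bagPos]⟩ ?_).mono le_rfl fun _ h => h.1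
  rintro i hi σ₁ hs₁ hi₁ ⟨h1, h2⟩
  have hb : σ₁.mem .bags (bagPos bag i) = (bag i).length := by
    rw [hs₁.mem _ rfl]
    exact hsz i hi
  have hle : bagPos bag (i + 1) < 2 ^ w := (hmono (by omega)).trans_lt hfit
  rw [bagPos_succ] at hle
  have hmax : maxSize (i + 1) bag = max (maxSize i bag) (bag i).length := by
    rw [maxSize, Finset.range_add_one, Finset.sup_insert, max_comm]; rfl
  refine (Run.of_wp (S := .set .sz (.get .bags Var.pos) ;;
    .ite (.lt Var.m Var.sz) (.set .m Var.sz) .skip ;; .set .pos (Var.pos + Var.sz + 1)) ?_).mono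
    (t' := 48) (by decide) fun _ => id
  simp only [Stmt.wp, Ex.ok_lt _ _ _ _ hw, Ex.ok_get, Ex.ok_add, Ex.ok_var, Ex.ok_one, ne_eq,
    Ex.val_get, Ex.val_add, Ex.val_var, Ex.val_one, Ex.val_lt, HState.reg_setReg, reduceCtorEq,
    if_false, if_true, h1, h2, hb, true_and, hmax, bagPos_succ]
  refine ⟨fun hlt => ⟨⟨by omega, hw, hle⟩, ?_, trivial⟩,
    fun hlt => ⟨⟨by omega, hw, hle⟩, ?_, trivial⟩⟩
  · have : maxSize i bag < (bag i).length := by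
      by_contra hc
      simp [hc] at hlt
    omega
  · have : ¬ maxSize i bag < (bag i).length := by
      intro hc
      simp [hc] at hlt
    omega

theorem weight_le_numCodes {i : ℕ} (hi : i ≤ numBits k l m + m) :
    weight (radix k l m) i ≤ numCodes k l m := weight_mono radix_pos hi

theorem run_weight (hB : WordOK k l n m (2 ^ w)) (hk : σ.reg .k = k) (hl : σ.reg .l = l)
    (hm : σ.reg .m = m) :
    Run w weightStmt σ (80 + (numBits k l m + m) * 60) (fun σ' => σ'.reg .nb = numBits k l m ∧
      σ'.reg .R = k + l + 1 ∧ σ'.reg .N = numCodes k l m ∧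
      ∀ i ≤ numBits k l m + m, σ'.mem .wt i = weight (radix k l m) i) := by
  have hB1 := hB.one_lt
  have hb := hB.codes
  have hnb : numBits k l m = 3 * l + k + 2 * m := rfl
  set σ₀ := (((σ.setReg .nb (numBits k l m)).setReg .R (k + l + 1)).setReg .v 1).setMem .wt 0 1
    with hσ₀
  have hpre : Run w (.set .nb (3 * Var.l + Var.k + 2 * Var.m) ;; .set .R (Var.k + Var.l + 1) ;;
      .set .v 1 ;; .put .wt 0 1) σ 50 (fun σ₁ => σ₁ = σ₀) := by
    refine (Run.of_wp (S := .set .nb (3 * Var.l + Var.k + 2 * Var.m) ;;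
      .set .R (Var.k + Var.l + 1) ;; .set .v 1 ;; .put .wt 0 1) ?_).mono (by decide) fun _ => id
    simp only [Stmt.wp, Ex.ok_add, Ex.ok_mul, Ex.ok_var, Ex.ok_zero, Ex.ok_one, Ex.ok_two,
      Ex.ok_three, Ex.val_add, Ex.val_mul, Ex.val_var, Ex.val_zero, Ex.val_one, Ex.val_two,
      Ex.val_three, HState.reg_setReg, reduceCtorEq, if_false, hk, hl, hm, true_and]
    refine ⟨by omega, by omega, by omega, by omega, by omega, ?_⟩
    rw [hσ₀, hnb]
  have h1 : Run w (.for_ .i .nb (.set .v (Var.v * 2) ;; .put .wt (Var.i + 1) Var.v)) σ₀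
      (9 + numBits k l m * (20 + 12)) (fun σ' => σ'.reg .v = weight (radix k l m) (numBits k l m) ∧
        ∀ j ≤ numBits k l m, σ'.mem .wt j = weight (radix k l m) j) := by
    refine Run.ofLoop (t := 20) hB1 (by simp) (by simp [hσ₀]) rfl rfl
      (fun i σ' => σ'.reg .v = weight (radix k l m) i ∧
        ∀ j ≤ i, σ'.mem .wt j = weight (radix k l m) j) ?_ ?_
    · refine ⟨by simp [hσ₀, weight], fun j hj => ?_⟩
      obtain rfl : j = 0 := by omega
      simp [hσ₀, weight]
    · rintro i hi σ₁ hs₁ hi₁ ⟨hv, hw⟩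
      refine (Run.of_wp (S := .set .v (Var.v * 2) ;; .put .wt (Var.i + 1) Var.v) ?_).mono
        (t' := 20) (by decide) fun _ => id
      have hle := weight_le_numCodes (k := k) (l := l) (m := m) (i := i + 1) (by omega)
      have hwt : weight (radix k l m) (i + 1) = weight (radix k l m) i * 2 := by
        rw [weight, radix, if_pos hi]
      simp only [Stmt.wp, Ex.ok_add, Ex.ok_mul, Ex.ok_var, Ex.ok_one, Ex.ok_two, Ex.val_add,
        Ex.val_mul, Ex.val_var, Ex.val_one, Ex.val_two, HState.reg_setReg, reduceCtorEq, if_false,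
        if_true, hv, hi₁, true_and, ← hwt, HState.reg_setMem, HState.mem_setReg, HState.mem_setMem]
      refine ⟨by omega, by omega, fun j hj => ?_⟩
      split_ifs with h
      · rw [h]
      · exact hw j (by omega)
  have h2 : ∀ σ₁, σ₁.reg .nb = numBits k l m → σ₁.reg .m = m → σ₁.reg .R = k + l + 1 →
      σ₁.reg .v = weight (radix k l m) (numBits k l m) →
      (∀ j ≤ numBits k l m, σ₁.mem .wt j = weight (radix k l m) j) →
      Run w (.for_ .i .m (.set .v (Var.v * Var.R) ;; .put .wt (Var.nb + Var.i + 1) Var.v)) σ₁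
      (9 + m * (20 + 12)) (fun σ' => σ'.reg .v = weight (radix k l m) (numBits k l m + m) ∧
        ∀ j ≤ numBits k l m + m, σ'.mem .wt j = weight (radix k l m) j) := by
    intro σ₁ hnb₁ hm₁ hR₁ hv₁ hw₁
    refine Run.ofLoop (t := 20) hB1 (by simp) hm₁ rfl rfl
      (fun i σ' => σ'.reg .v = weight (radix k l m) (numBits k l m + i) ∧
        ∀ j ≤ numBits k l m + i, σ'.mem .wt j = weight (radix k l m) j) ⟨hv₁, hw₁⟩ ?_
    rintro i hi σ₂ hs₂ hi₂ ⟨hv, hw⟩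
    refine (Run.of_wp (S := .set .v (Var.v * Var.R) ;; .put .wt (Var.nb + Var.i + 1) Var.v) ?_).mono
      (t' := 20) (by decide) fun _ => id
    have hle := weight_le_numCodes (k := k) (l := l) (m := m)
      (i := numBits k l m + i + 1) (by omega)
    have hwt : weight (radix k l m) (numBits k l m + i + 1) =
        weight (radix k l m) (numBits k l m + i) * (k + l + 1) := by
      rw [weight, radix, if_neg (by omega)]
    have hR₂ : σ₂.reg .R = k + l + 1 := by rw [hs₂.reg _ rfl, hR₁]
    have hnb₂ : σ₂.reg .nb = numBits k l m := by rw [hs₂.reg _ rfl, hnb₁]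
    simp only [Stmt.wp, Ex.ok_add, Ex.ok_mul, Ex.ok_var, Ex.ok_one, Ex.val_add,
      Ex.val_mul, Ex.val_var, Ex.val_one, HState.reg_setReg, reduceCtorEq, if_false,
      if_true, hv, hi₂, hR₂, hnb₂, true_and, ← hwt, HState.reg_setMem, HState.mem_setReg,
      HState.mem_setMem]
    refine ⟨by omega, by omega, rfl, fun j hj => ?_⟩
    split_ifs with h
    · rw [h]
    · exact hw j (by omega)
  have h3 : Run w (.for_ .i .nb (.set .v (Var.v * 2) ;; .put .wt (Var.i + 1) Var.v) ;;
      .for_ .i .m (.set .v (Var.v * Var.R) ;; .put .wt (Var.nb + Var.i + 1) Var.v) ;;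
      .set .N Var.v) σ₀ ((9 + numBits k l m * (20 + 12)) + ((9 + m * (20 + 12)) + 4))
      (fun σ' => σ'.reg .nb = numBits k l m ∧ σ'.reg .R = k + l + 1 ∧
        σ'.reg .N = numCodes k l m ∧
        ∀ i ≤ numBits k l m + m, σ'.mem .wt i = weight (radix k l m) i) := by
    refine Run.andThen h1 ?_
    rintro σ₁ hs₁ ⟨hv₁, hw₁⟩
    have hnb₁ : σ₁.reg .nb = numBits k l m := by rw [hs₁.reg _ rfl]; simp [hσ₀]
    have hR₁ : σ₁.reg .R = k + l + 1 := by rw [hs₁.reg _ rfl]; simp [hσ₀]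
    refine Run.andThen (h2 σ₁ hnb₁ (by rw [hs₁.reg _ rfl]; simpa [hσ₀] using hm) hR₁ hv₁ hw₁) ?_
    rintro σ₂ hs₂ ⟨hv₂, hw₂⟩
    refine Run.of_set (e := Var.v) trivial ⟨?_, ?_, ?_, hw₂⟩
    · simpa [hs₂.reg .nb rfl] using hnb₁
    · simpa [hs₂.reg .R rfl] using hR₁
    · rw [HState.reg_setReg, if_pos rfl]
      exact hv₂
  -- Composition associates to the right, but the loop-free beginning is verified as one block;
  -- regrouping changes neither the execution nor its time.
  have hassoc : ∀ A B C D E : Stmt, ∀ {t Q}, Run w ((A ;; B ;; C ;; D) ;; E) σ t Q →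
      Run w (A ;; B ;; C ;; D ;; E) σ t Q := by
    intro A B C D E t Q hr s hs
    obtain ⟨s', σ', t', e, hx⟩ := hr s hs
    cases e with
    | seq e e₅ => cases e with
      | seq e₁ e => cases e with
        | seq e₂ e => cases e with
          | seq e₃ e₄ =>
            refine ⟨s', σ', _, .seq e₁ (.seq e₂ (.seq e₃ (.seq e₄ e₅))), ?_⟩
            simpa only [Nat.add_assoc] using hx
  refine (hassoc _ _ _ _ _ (Run.andThen hpre (t' := (9 + numBits k l m * (20 + 12)) +
    ((9 + m * (20 + 12)) + 4)) ?_)).mono (by omega) fun _ => id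
  rintro σ₁ - rfl
  exact h3

/-- The accepting state has its ones exactly at the lowest 2l + k positions, so its code is the
weight of the next digit minus one. -/
theorem run_answer (hB : WordOK k l n m (2 ^ w)) (h : Ctx arc T m σ) {H : Digraph (Fin k)}
    (hH : ArcList H arc) {F : Set (Fin n)} {sl : Fin m → Option (Fin n)}
    (hC : Correct arc T F sl (absTab k l m σ)) (hF : ∀ v, v ∈ F) :
    Run w answerStmt σ 60 (fun σ' => (TopologicallyContained H T → σ'.reg .k = 1) ∧
      (¬ TopologicallyContained H T → σ'.reg .k = 0)) := by
  have hB1 := hB.one_lt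
  have hb := hB.codes
  have hnb : numBits k l m = 3 * l + k + 2 * m := rfl
  have hlt := two_pow_sub_one_lt_numCodes (k := k) (l := l) (m := m)
  have hwt : σ.mem .wt (2 * l + k) = 2 ^ (2 * l + k) := by
    rw [h.wt _ (by omega), weight_radix_eq_two_pow (by omega)]
  have hiff := hC.accept_iff hH hF (d := view k l m (2 ^ (2 * l + k) - 1)) view_two_pow_sub_one
  have hmem : view k l m (2 ^ (2 * l + k) - 1) ∈ absTab k l m σ ↔
      σ.mem .tab (2 ^ (2 * l + k) - 1) ≠ 0 := by
    constructor
    · rintro ⟨c, hc, hne, hv⟩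
      rwa [← view_injOn hc hlt hv]
    · exact fun hne => ⟨_, hlt, hne, rfl⟩
  rw [hmem] at hiff
  refine (Run.of_wp (S := answerStmt) ?_).mono (by decide) fun _ => id
  simp only [answerStmt, Stmt.wp, Ex.ok_get, Ex.ok_add, Ex.ok_mul, Ex.ok_sub, Ex.ok_var, Ex.ok_one,
    Ex.ok_two, Ex.val_get, Ex.val_add, Ex.val_mul, Ex.val_sub, Ex.val_var, Ex.val_one, Ex.val_two,
    h.regl, h.regk, hwt, HState.reg_setReg, if_true, true_and]
  refine ⟨by omega, fun hne => ⟨hB1, fun _ => trivial, fun hn => absurd (hiff.1 hne) hn⟩,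
    fun hz => ⟨fun ht => absurd hz (hiff.2 ht), fun _ => hz⟩⟩

/-- The input of the algorithm is stored in the state `σ`, and the other arrays are zero. -/
structure InputRep (arc : Fin l → Fin k × Fin k) (T : Digraph (Fin n)) (r : ℕ)
    (bag : ℕ → List (Fin n)) (σ : HState) : Prop where
  regk : σ.reg .k = k
  regl : σ.reg .l = l
  regn : σ.reg .n = n
  regr : σ.reg .r = r
  tail : ∀ e : Fin l, σ.mem .arcs (2 * e) = (arc e).1
  head : ∀ e : Fin l, σ.mem .arcs (2 * e + 1) = (arc e).2
  mat : ∀ u v : Fin n, σ.mem .mat (u * n + v) ≠ 0 ↔ T.Adj u v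
  size : ∀ i, σ.mem .bags (bagPos bag i) = (bag i).length
  elt : ∀ i j (h : j < (bag i).length), σ.mem .bags (bagPos bag i + 1 + j) = (bag i)[j]
  tab : ∀ i, σ.mem .tab i = 0
  slot : ∀ i, σ.mem .slot i = 0

/-- A bound for the numbers that occur. -/
def wordBound (k l n m r : ℕ) : ℕ :=
  4 * (numCodes k l m + numBits k l m + m + k + l + 10) + (n + 1) * (n + 1) + (r + 2) * (m + 2)

/-- A bound for the running time. -/
def mainTime (k l m r N : ℕ) : ℕ :=
  200 + (r + numBits k l m + m) * 60 + (r + 1) * (bagTime k l m N + 12)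

theorem run_main {H : Digraph (Fin k)} (hH : ArcList H arc) (hT : SemiComplete T)
    (hW : IsBagSeq T r bag) (hσ : InputRep arc T r bag σ)
    (hw : wordBound k l n (maxSize r bag) r ≤ 2 ^ w) :
    Run w mainStmt σ (mainTime k l (maxSize r bag) r (numCodes k l (maxSize r bag)))
      (fun σ' => (TopologicallyContained H T → σ'.reg .k = 1) ∧
        (¬ TopologicallyContained H T → σ'.reg .k = 0)) := by
  set m := maxSize r bag with hm
  have hmle : ∀ i, (bag i).length ≤ m := by
    intro i
    by_cases hi : i < r
    · exact Finset.le_sup (f := fun i => (bag i).length) (Finset.mem_range.2 hi)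
    · rw [hW.empty i (by omega)]
      exact Nat.zero_le _
  have hB : WordOK k l n m (2 ^ w) := ⟨by unfold wordBound at hw; omega, by
    unfold wordBound at hw; omega⟩
  have hB1 := hB.one_lt
  have hprod : (r + 1) * (m + 1) + r + m + 3 ≤ 2 ^ w := by
    have : (r + 2) * (m + 2) = (r + 1) * (m + 1) + r + m + 3 := by ring
    unfold wordBound at hw
    omega
  have hpos := bagPos_le hmle (r + 1)
  have hposr := bagPos_succ bag r
  have hcodes := hB.codes
  refine (Run.andThen (t := 15 + r * 60) (t' := (80 + (numBits k l m + m) * 60) + (10 +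
    (18 + (r + 1) * (bagTime k l m (numCodes k l m) + 12) + 60)))
    (run_size hB1 (by omega) hσ.regr fun i _ => hσ.size i) fun σ₁ hs₁ hm₁ => ?_).mono
    (by unfold mainTime; omega) fun _ => id
  refine Run.andThen (run_weight hB (by rw [hs₁.reg _ rfl, hσ.regk])
    (by rw [hs₁.reg _ rfl, hσ.regl]) hm₁) ?_
  rintro σ₂ hs₂ ⟨h1, h2, h3, h4⟩
  have hmem : ∀ a ∈ [Arr.arcs, .mat, .bags, .tab, .slot], σ₂.mem a = σ.mem a := by
    intro a ha
    rw [hs₂.mem a (by revert ha; cases a <;> simp <;> rfl),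
      hs₁.mem a (by revert ha; cases a <;> simp <;> rfl)]
  have h₂ : Ctx arc T m σ₂ := by
    constructor
    · rw [hs₂.reg _ rfl, hs₁.reg _ rfl, hσ.regk]
    · rw [hs₂.reg _ rfl, hs₁.reg _ rfl, hσ.regl]
    · rw [hs₂.reg _ rfl, hs₁.reg _ rfl, hσ.regn]
    · rw [hs₂.reg _ rfl, hm₁]
    · exact h1
    · exact h3
    · exact h2
    · rw [hmem _ (by simp)]; exact hσ.tail
    · rw [hmem _ (by simp)]; exact hσ.head
    · rw [hmem _ (by simp)]; exact hσ.mat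
    · exact h4
  refine Run.andThen (t := 10) (Q := fun σ₃ => σ₃ = σ₂.setMem .tab 0 1)
    ((Run.of_wp (S := .put .tab 0 1) (by simp [Stmt.wp, hB1])).mono (by decide) fun _ => id) ?_
  rintro σ₃ - rfl
  have h₃ : Ctx arc T m (σ₂.setMem .tab 0 1) := h₂.congr (fun _ _ => rfl) fun a ha => by
    rw [HState.mem_setMem_of_ne]
    rintro rfl
    simp at ha
  -- Code 0 belongs to the zero state, so a single store prepares the initial table.
  have htab : absTab k l m (σ₂.setMem .tab 0 1) = {fun _ => 0} := by
    ext d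
    rw [Set.mem_singleton_iff]
    constructor
    · rintro ⟨c, hc, hne, rfl⟩
      by_cases hc0 : c = 0
      · rw [hc0, view_zero]
      · simp [hc0, hmem .tab (by simp), hσ.tab] at hne
    · rintro rfl
      exact ⟨0, weight_pos radix_pos _, by simp, view_zero⟩
  have hbags : (σ₂.setMem .tab 0 1).mem .bags = σ.mem .bags := by
    rw [HState.mem_setMem_of_ne _ (by simp), hmem _ (by simp)]
  refine Run.andThen (run_sweep hB hT hW hmle h₃
    (by rw [HState.reg_setMem, hs₂.reg _ rfl, hs₁.reg _ rfl, hσ.regr])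
    (pos := bagPos bag) (by simp [bagPos])
    (bagPos_succ bag) (by omega) (by omega) (fun i _ => by rw [hbags, hσ.size])
    (fun i _ j hj => by rw [hbags, hσ.elt i j hj]) (fun i => ?_) htab) ?_
  · rw [HState.mem_setMem_of_ne _ (by simp), hmem _ (by simp), hσ.slot]
  rintro σ₄ hs₄ ⟨F, sl, hC, hF⟩
  exact run_answer hB (h₃.same hs₄ rfl) hH hC hF

end

end TopDP

/-! ### Encoding of the input, and the number of bags -/

namespace TopDP

open WordRAM

theorem getD_encodeArcs {k : ℕ} (arcs : List (Fin k × Fin k)) :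
    ∀ (e : ℕ) (h : e < arcs.length), (encodeArcs arcs).getD (2 * e) 0 = arcs[e].1 ∧
      (encodeArcs arcs).getD (2 * e + 1) 0 = arcs[e].2 := by
  induction arcs with
  | nil => intro e h; simp at h
  | cons a arcs ih =>
    intro e h
    have hcons : encodeArcs (a :: arcs) = (a.1 : ℕ) :: (a.2 : ℕ) :: encodeArcs arcs := rfl
    rw [hcons]
    cases e with
    | zero => simp
    | succ e =>
      rw [show 2 * (e + 1) = 2 * e + 1 + 1 by ring]
      simpa using ih e (by simpa using h)

theorem encodeMatrix_ne_zero {n : ℕ} (T : Digraph (Fin n)) (u v : Fin n) :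
    encodeMatrix T (u * n + v) ≠ 0 ↔ T.Adj u v := by
  have hn : 0 < n := u.pos
  unfold encodeMatrix
  have : (∃ u' v' : Fin n, (u : ℕ) * n + v = u' * n + v' ∧ T.Adj u' v') ↔ T.Adj u v := by
    constructor
    · rintro ⟨u', v', h, ha⟩
      have h1 : ∀ a b : Fin n, ((a : ℕ) * n + b) / n = a ∧ ((a : ℕ) * n + b) % n = b := by
        intro a b
        rw [Nat.mul_comm, Nat.mul_add_div hn, Nat.div_eq_of_lt b.2, Nat.mul_add_mod,
          Nat.mod_eq_of_lt b.2]
        exact ⟨rfl, rfl⟩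
      obtain rfl : u = u' := Fin.ext (by rw [← (h1 u v).1, h, (h1 u' v').1])
      obtain rfl : v = v' := Fin.ext (by rw [← (h1 u v).2, h, (h1 u v').2])
      exact ha
    · exact fun ha => ⟨u, v, rfl, ha⟩
  simp [this]

/-- Bag `i`; the bags of the list are followed by empty ones. -/
def bagAt {n : ℕ} (bags : List (List (Fin n))) (i : ℕ) : List (Fin n) := bags.getD i []

theorem bagPos_cons {n : ℕ} (b : List (Fin n)) (bags : List (List (Fin n))) (i : ℕ) :
    bagPos (bagAt (b :: bags)) (i + 1) = (b.length + 1) + bagPos (bagAt bags) i := by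
  rw [bagPos, Finset.sum_range_succ', Nat.add_comm]
  rfl

theorem encodeBags_eq {n : ℕ} (bags : List (List (Fin n))) :
    encodeBags bags = bags.flatMap fun b => b.length :: b.map Fin.val := by
  simp [encodeBags, List.map_eq_flatMap]

/-- This includes indices behind the last bag: there the default value 0 is the size of an empty
bag. -/
theorem getD_encodeBags {n : ℕ} (bags : List (List (Fin n))) : ∀ i x, x ≤ (bagAt bags i).length →
    (encodeBags bags).getD (bagPos (bagAt bags) i + x) 0 =
      ((bagAt bags i).length :: (bagAt bags i).map Fin.val).getD x 0 := by
  induction bags with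
  | nil =>
    intro i x hx
    have hb : bagAt ([] : List (List (Fin n))) i = [] := by simp [bagAt]
    rw [hb] at hx ⊢
    obtain rfl : x = 0 := by simpa using hx
    simp [encodeBags]
  | cons b bags ih =>
    intro i x hx
    have hcons : encodeBags (b :: bags) = (b.length :: b.map Fin.val) ++ encodeBags bags := by
      rw [encodeBags_eq, encodeBags_eq, List.flatMap_cons]
    rw [hcons]
    cases i with
    | zero =>
      have hb : bagAt (b :: bags) 0 = b := rfl
      rw [hb] at hx ⊢
      rw [List.getD_append _ _ _ _ (by simp [bagPos]; omega)]
      simp [bagPos]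
    | succ i =>
      have hb : bagAt (b :: bags) (i + 1) = bagAt bags i := rfl
      rw [hb] at hx ⊢
      rw [bagPos_cons, List.getD_append_right _ _ _ _ (by simp; omega), ← ih i x hx]
      congr 1
      simp
      omega

/-- The visible part of a state. -/
def visible (s : State) : HState := ⟨fun x => s.reg x.num, fun a => s.mem a.num⟩

theorem sim_visible {w : ℕ} {s : State} (h : s.Fits w) : Sim w s (visible s) :=
  ⟨h, fun _ => rfl, fun _ => rfl⟩

theorem inputRep_initialState {k n : ℕ} (arcs : List (Fin k × Fin k)) (T : Digraph (Fin n))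
    (bags : List (List (Fin n))) :
    InputRep (l := arcs.length) (fun e => arcs[e]) T bags.length (bagAt bags)
      (visible (initialState arcs T bags)) where
  regk := rfl
  regl := rfl
  regn := rfl
  regr := rfl
  tail e := (getD_encodeArcs arcs e e.2).1
  head e := (getD_encodeArcs arcs e e.2).2
  mat := encodeMatrix_ne_zero T
  size i := by
    exact getD_encodeBags bags i 0 (Nat.zero_le _)
  elt i j h := by
    have := getD_encodeBags bags i (j + 1) h
    rw [Nat.add_assoc, Nat.add_comm 1 j]
    refine this.trans ?_
    simp [h]
  tab i := rfl
  slot i := rfl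

theorem fits_initialState {k n w : ℕ} (arcs : List (Fin k × Fin k)) (T : Digraph (Fin n))
    (bags : List (List (Fin n))) (hk : k < 2 ^ w) (hl : arcs.length < 2 ^ w) (hn : n < 2 ^ w)
    (hr : bags.length < 2 ^ w) (hb : ∀ b ∈ bags, b.length < 2 ^ w) (h1 : 1 < 2 ^ w) :
    (initialState arcs T bags).Fits w := by
  have key : ∀ (L : List ℕ) (i : ℕ), (∀ x ∈ L, x < 2 ^ w) → L.getD i 0 < 2 ^ w := by
    intro L i hL
    by_cases hi : i < L.length
    · rw [List.getD_eq_getElem _ _ hi]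
      exact hL _ (List.getElem_mem hi)
    · rw [List.getD_eq_default _ _ (by omega)]
      omega
  refine ⟨fun i => key _ i ?_, fun a i => ?_⟩
  · simp only [List.mem_cons, List.not_mem_nil, or_false]
    rintro x (rfl | rfl | rfl | rfl) <;> assumption
  · match a with
    | 0 =>
      refine key _ i fun x hx => ?_
      simp only [encodeArcs, List.mem_flatMap, List.mem_cons, List.not_mem_nil, or_false] at hx
      obtain ⟨e, -, rfl | rfl⟩ := hx
      · have := e.1.2; omega
      · have := e.2.2; omega
    | 1 =>
      show encodeMatrix T i < 2 ^ w
      unfold encodeMatrix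
      split_ifs <;> omega
    | 2 =>
      refine key _ i fun x hx => ?_
      simp only [encodeBags_eq, List.mem_flatMap, List.mem_cons, List.mem_map] at hx
      obtain ⟨b, hb', rfl | ⟨v, -, rfl⟩⟩ := hx
      · exact hb b hb'
      · have := v.2; omega
    | _ + 3 => exact Nat.two_pow_pos w

theorem mem_bagAt {n : ℕ} {bags : List (List (Fin n))} {i : ℕ} {v : Fin n} :
    v ∈ bagAt bags i ↔ ∃ h : i < bags.length, v ∈ bagFamily bags ⟨i, h⟩ := by
  unfold bagAt bagFamily
  by_cases h : i < bags.length
  · simp [h]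
  · simp [h]

theorem isBagSeq_bagAt {n : ℕ} {T : Digraph (Fin n)} {bags : List (List (Fin n))}
    (hnd : ∀ b ∈ bags, b.Nodup) (hW : IsPathDecomposition T (bagFamily bags)) :
    IsBagSeq T bags.length (bagAt bags) where
  nodup i := by
    by_cases h : i < bags.length
    · rw [bagAt, List.getD_eq_getElem _ _ h]
      exact hnd _ (List.getElem_mem h)
    · rw [bagAt, List.getD_eq_default _ _ (not_lt.1 h)]
      exact List.nodup_nil
  empty i h := List.getD_eq_default _ _ h
  cover v := by
    obtain ⟨i, hi⟩ := hW.cover v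
    exact ⟨i, mem_bagAt.2 ⟨i.2, hi⟩⟩
  interval i j l hij hjl v hi hl := by
    obtain ⟨h1, hi⟩ := mem_bagAt.1 hi
    obtain ⟨h2, hl⟩ := mem_bagAt.1 hl
    exact mem_bagAt.2 ⟨by omega, hW.interval ⟨i, h1⟩ ⟨j, by omega⟩ ⟨l, h2⟩ hij hjl v hi hl⟩
  arc u v h := by
    rcases hW.arc u v h with ⟨i, hu, hv⟩ | ⟨i, j, hji, hu, hv⟩
    · exact Or.inl ⟨i, mem_bagAt.2 ⟨i.2, hu⟩, mem_bagAt.2 ⟨i.2, hv⟩⟩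
    · exact Or.inr ⟨i, j, hji, mem_bagAt.2 ⟨i.2, hu⟩, mem_bagAt.2 ⟨j.2, hv⟩⟩

theorem arcList_get {k : ℕ} {H : Digraph (Fin k)} {arcs : List (Fin k × Fin k)} (hH : Simple H)
    (hnd : arcs.Nodup) (ha : ∀ u v, (u, v) ∈ arcs ↔ H.Adj u v) :
    ArcList H (fun e : Fin arcs.length => arcs[e]) where
  simple := hH
  inj e e' h := Fin.ext ((List.Nodup.getElem_inj_iff hnd).1 h)
  adj u v := by
    rw [← ha, List.mem_iff_getElem]
    constructor
    · rintro ⟨i, h, he⟩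
      exact ⟨⟨i, h⟩, he⟩
    · rintro ⟨e, he⟩
      exact ⟨e, e.2, he⟩

theorem length_le_width {n : ℕ} {bags : List (List (Fin n))} (hnd : ∀ b ∈ bags, b.Nodup)
    {b : List (Fin n)} (hb : b ∈ bags) : b.length ≤ width (bagFamily bags) + 1 := by
  obtain ⟨i, h, rfl⟩ := List.mem_iff_getElem.1 hb
  have h1 := Finset.le_sup (f := fun i => (bagFamily bags i).card - 1)
    (Finset.mem_univ (⟨i, h⟩ : Fin bags.length))
  have h2 : (bagFamily bags ⟨i, h⟩).card = bags[i].length :=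
    List.toFinset_card_of_nodup (hnd _ hb)
  rw [← h2]
  unfold width
  omega

theorem maxSize_bagAt_le {n : ℕ} {bags : List (List (Fin n))} (hnd : ∀ b ∈ bags, b.Nodup) :
    maxSize bags.length (bagAt bags) ≤ width (bagFamily bags) + 1 := by
  refine Finset.sup_le fun i hi => ?_
  have h := Finset.mem_range.1 hi
  rw [bagAt, List.getD_eq_getElem _ _ h]
  exact length_le_width hnd (List.getElem_mem h)

/-- If no two consecutive bags are equal, there are at most `2 * n + 1` of them. -/
theorem IsPathDecomposition.le_of_consecutiveDistinct {n r : ℕ} {T : Digraph (Fin n)}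
    {W : Fin r → Finset (Fin n)} (hW : IsPathDecomposition T W) (hd : ConsecutiveDistinct W) :
    r ≤ 2 * n + 1 := by
  -- A vertex that distinguishes two consecutive bags; the Boolean is `true` if it leaves and
  -- `false` if it enters.
  have hex : ∀ i : Fin (r - 1), ∃ x : Fin n × Bool,
      (x.2 = true → x.1 ∈ W ⟨i, by omega⟩ ∧ x.1 ∉ W ⟨i + 1, by omega⟩) ∧
      (x.2 = false → x.1 ∉ W ⟨i, by omega⟩ ∧ x.1 ∈ W ⟨i + 1, by omega⟩) := by
    intro i
    have hne := hd ⟨i, by omega⟩ ⟨i + 1, by omega⟩ rfl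
    by_contra! hcon
    refine hne (Finset.ext fun v => ?_)
    have h1 := hcon (v, true)
    have h2 := hcon (v, false)
    simp only [reduceCtorEq, false_imp_iff, true_imp_iff] at h1 h2
    by_contra hv
    grind
  choose f hf using hex
  have hinj : Function.Injective f := by
    -- By the interval property a vertex leaves at most once and enters at most once, so there are
    -- at most 2n changes.
    have key : ∀ i j : Fin (r - 1), i < j → f i ≠ f j := by
      intro i j hij h
      have hi := hf i
      have hj := hf j
      rw [← h] at hj
      have hij' : (i : ℕ) < j := hij
      cases hb : (f i).2 with
      | true =>
        have h1 := hi.1 hb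
        have h2 := hj.1 hb
        rcases Nat.lt_or_eq_of_le (Nat.succ_le_of_lt hij') with h3 | h3
        · exact h1.2 (hW.interval ⟨i, by omega⟩ ⟨i + 1, by omega⟩ ⟨j, by omega⟩
            (Fin.mk_lt_mk.2 (by omega)) (Fin.mk_lt_mk.2 h3) _ h1.1 h2.1)
        · refine h1.2 ?_
          convert h2.1 using 3
      | false =>
        have h1 := hi.2 hb
        have h2 := hj.2 hb
        rcases Nat.lt_or_eq_of_le (Nat.succ_le_of_lt hij') with h3 | h3
        · exact h2.1 (hW.interval ⟨i + 1, by omega⟩ ⟨j, by omega⟩ ⟨j + 1, by omega⟩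
            (Fin.mk_lt_mk.2 h3) (Fin.mk_lt_mk.2 (by omega)) _ h1.2 h2.2)
        · refine h2.1 ?_
          convert h1.2 using 3
          exact h3.symm
    intro i j h
    rcases lt_trichotomy i j with hlt | heq | hlt
    · exact absurd h (key i j hlt)
    · exact heq
    · exact absurd h.symm (key j i hlt)
  have := Fintype.card_le_of_injective f hinj
  simp only [Fintype.card_fin, Fintype.card_prod, Fintype.card_bool] at this
  omega

end TopDP

/-! ### Estimates for time and word length -/

namespace TopDP

section
variable {k l m r N : ℕ}

/-- All parameters are at most `N`. The fourth power stems from the nested loops over the elements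
of a bag, the pattern arcs, the slots and the codes. -/
theorem mainTime_le (hN : 1 ≤ N) (hkl : k + l + 1 ≤ N) (hm : m ≤ N) (hb : numBits k l m ≤ N) :
    mainTime k l m r N ≤ 4000 * N ^ 4 * (r + 1) := by
  have hl : l ≤ N := by omega
  have e1 : N ≤ N ^ 2 := Nat.le_self_pow two_ne_zero N
  have e2 : N ^ 2 ≤ N ^ 3 := Nat.pow_le_pow_right hN (by norm_num)
  have e3 : N ^ 3 ≤ N ^ 4 := Nat.pow_le_pow_right hN (by norm_num)
  have h1 : passTime N ≤ 409 * N := by unfold passTime; omega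
  have h2 : forgetTime l N ≤ 900 * N ^ 2 := by
    have : l * (passTime N + 12) ≤ N * (421 * N) := Nat.mul_le_mul hl (by omega)
    have e : N * (421 * N) = 421 * N ^ 2 := by ring
    unfold forgetTime; omega
  have h3 : slotTime N ≤ 900 * N := by unfold slotTime; omega
  have h4 : arcTime m N ≤ 1400 * N ^ 2 := by
    have : m * (slotTime N + 12) ≤ N * (912 * N) := Nat.mul_le_mul hm (by omega)
    have e : N * (912 * N) = 912 * N ^ 2 := by ring
    unfold arcTime; omega
  have h5 : introTime k l m N ≤ 2000 * N ^ 3 := by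
    have t1 : (k + l + 1) * (passTime N + 12) ≤ N * (421 * N) := Nat.mul_le_mul hkl (by omega)
    have t2 : l * (arcTime m N + 12) ≤ N * (1412 * N ^ 2) := Nat.mul_le_mul hl (by omega)
    have e : N * (421 * N) = 421 * N ^ 2 := by ring
    have e' : N * (1412 * N ^ 2) = 1412 * N ^ 3 := by ring
    unfold introTime; omega
  have h6 : forgetPhaseTime l m N ≤ 1100 * N ^ 3 := by
    have : m * (m * 60 + forgetTime l N + 50) ≤ N * (1010 * N ^ 2) :=
      Nat.mul_le_mul hm (by omega)
    have e : N * (1010 * N ^ 2) = 1010 * N ^ 3 := by ring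
    unfold forgetPhaseTime; omega
  have h7 : introPhaseTime k l m N ≤ 2200 * N ^ 4 := by
    have : m * (m * 60 + introTime k l m N + 50) ≤ N * (2110 * N ^ 3) :=
      Nat.mul_le_mul hm (by omega)
    have e : N * (2110 * N ^ 3) = 2110 * N ^ 4 := by ring
    unfold introPhaseTime; omega
  have h8 : bagTime k l m N + 12 ≤ 3400 * N ^ 4 := by unfold bagTime; omega
  have h9 : (r + 1) * (bagTime k l m N + 12) ≤ (r + 1) * (3400 * N ^ 4) :=
    Nat.mul_le_mul le_rfl h8
  have h10 : r ≤ N ^ 4 * r := Nat.le_mul_of_pos_left _ (by omega)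
  have e4 : (r + 1) * (3400 * N ^ 4) = 3400 * (N ^ 4 * r) + 3400 * N ^ 4 := by ring
  have e5 : 4000 * N ^ 4 * (r + 1) = 4000 * (N ^ 4 * r) + 4000 * N ^ 4 := by ring
  unfold mainTime
  omega

theorem numBits_lt_numCodes : numBits k l m < numCodes k l m := by
  rw [numCodes_eq]
  have h1 : numBits k l m < 2 ^ numBits k l m := Nat.lt_two_pow_self
  have h2 : 0 < (k + l + 1) ^ m := by positivity
  exact h1.trans_le (Nat.le_mul_of_pos_right _ h2)

theorem wordBound_le {n : ℕ} (hn : 0 < n) :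
    wordBound k l n m r ≤ 66 * numCodes k l m * (n + r) ^ 2 := by
  have h := numBits_lt_numCodes (k := k) (l := l) (m := m)
  have hb : numBits k l m = 3 * l + k + 2 * m := rfl
  set N := numCodes k l m
  have t1 : 4 * (N + numBits k l m + m + k + l + 10) ≤ 56 * N := by omega
  have t2 : (n + 1) * (n + 1) ≤ (2 * (n + r)) * (2 * (n + r)) :=
    Nat.mul_le_mul (by omega) (by omega)
  have t3 : (r + 2) * (m + 2) ≤ (2 * (n + r)) * (3 * N) := Nat.mul_le_mul (by omega) (by omega)
  have hs : n + r ≤ (n + r) ^ 2 := Nat.le_self_pow two_ne_zero _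
  have t4 : N * 1 ≤ N * (n + r) ^ 2 := Nat.mul_le_mul le_rfl (by omega)
  have t5 : N * (n + r) ≤ N * (n + r) ^ 2 := Nat.mul_le_mul le_rfl hs
  have t6 : 1 * (n + r) ^ 2 ≤ N * (n + r) ^ 2 := Nat.mul_le_mul (by omega) le_rfl
  unfold wordBound
  nlinarith

end

section
open Real

theorem one_le_logb (p : ℕ) : 1 ≤ logb 2 ((p : ℝ) + 2) := by
  rw [le_logb_iff_rpow_le one_lt_two (by positivity)]
  simp

theorem expFactor_one (p k l : ℕ) :
    expFactor 1 p k l = 2 ^ (((p : ℝ) + k + l) * logb 2 ((p : ℝ) + 2)) := by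
  simp [expFactor]

theorem expFactor_pow (C p k l : ℕ) : expFactor C p k l = expFactor 1 p k l ^ C := by
  rw [expFactor_one, expFactor, ← rpow_natCast, ← rpow_mul zero_le_two]
  congr 1
  ring

theorem one_le_expFactor (p k l : ℕ) : 1 ≤ expFactor 1 p k l := by
  rw [expFactor_one]
  have := one_le_logb p
  exact one_le_rpow one_le_two (by positivity)

/-- From q + 1 ≤ a(1 + q/a) ≤ a exp(q/a) and e ≤ 4. It trades the base q for the base a at the price
of a factor that is exponential in q. -/
theorem succ_pow_le (a q : ℕ) (ha : 0 < a) : ((q : ℝ) + 1) ^ a ≤ (a : ℝ) ^ a * 4 ^ q := by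
  have ha' : (1 : ℝ) ≤ a := by exact_mod_cast ha
  have hq : (0 : ℝ) ≤ q := q.cast_nonneg
  have h1 : (q : ℝ) + 1 ≤ a * rexp (q / a) := by
    have h := add_one_le_exp ((q : ℝ) / a)
    calc (q : ℝ) + 1 ≤ q + a := by linarith
      _ = a * (q / a + 1) := by field_simp
      _ ≤ a * rexp (q / a) := by gcongr
  have h2 : rexp ((q : ℝ) / a) ^ a = rexp 1 ^ q := by
    rw [← exp_nat_mul, ← exp_nat_mul]
    congr 1
    field_simp
  have h3 : rexp 1 ≤ 4 := by
    have := exp_one_lt_d9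
    linarith
  calc ((q : ℝ) + 1) ^ a ≤ (a * rexp (q / a)) ^ a := by gcongr
    _ = (a : ℝ) ^ a * rexp 1 ^ q := by rw [mul_pow, h2]
    _ ≤ (a : ℝ) ^ a * 4 ^ q := by gcongr

/-- The labels contribute (k + l + 1) ^ m, and k + l may be far larger than p. By `succ_pow_le` this
is at most (p + 1) ^ (p + 1) * 4 ^ (k + l), whose logarithm is of the required order. -/
theorem numCodes_le {k l m p : ℕ} (hm : m ≤ p + 1) :
    (numCodes k l m : ℝ) ≤ 8 * expFactor 1 p k l ^ 5 := by
  set L := logb 2 ((p : ℝ) + 2) with hL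
  have hL1 : 1 ≤ L := one_le_logb p
  have h1 : (2 : ℝ) ^ numBits k l m ≤ 2 ^ (3 * (k + l) + 2 * (p + 1)) :=
    pow_le_pow_right₀ one_le_two (by unfold numBits; omega)
  have h2 : ((k : ℝ) + l + 1) ^ m ≤ ((p : ℝ) + 2) ^ (p + 1) * 4 ^ (k + l) := by
    have hq : (1 : ℝ) ≤ (k : ℝ) + l + 1 := by
      have : (0 : ℝ) ≤ (k : ℝ) + l := by positivity
      linarith
    have h := succ_pow_le (p + 1) (k + l) (Nat.succ_pos p)
    push_cast at h
    calc ((k : ℝ) + l + 1) ^ m ≤ ((k : ℝ) + l + 1) ^ (p + 1) := pow_le_pow_right₀ hq hm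
      _ ≤ ((p : ℝ) + 1) ^ (p + 1) * 4 ^ (k + l) := h
      _ ≤ ((p : ℝ) + 2) ^ (p + 1) * 4 ^ (k + l) := by gcongr; norm_num
  have h3 : ((p : ℝ) + 2) ^ (p + 1) = 2 ^ (L * (p + 1)) := by
    rw [rpow_mul zero_le_two, hL, rpow_logb two_pos (by norm_num) (by positivity)]
    rw [← rpow_natCast]
    push_cast
    rfl
  -- This absorbs the surplus `L` in the exponent `L * (p + 1)`. The summand 1 is needed for `p =
  -- 0`, where `L = 1`.
  have hpL : L ≤ p * L + 1 := by
    rcases Nat.eq_zero_or_pos p with rfl | hp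
    · simp [hL]
    · have : (1 : ℝ) ≤ p := by exact_mod_cast hp
      nlinarith
  have hp0 : (0 : ℝ) ≤ p := p.cast_nonneg
  have hk0 : (0 : ℝ) ≤ (k : ℝ) + l := by positivity
  rw [numCodes_eq]
  push_cast
  calc (2 : ℝ) ^ numBits k l m * ((k : ℝ) + l + 1) ^ m
      ≤ 2 ^ (3 * (k + l) + 2 * (p + 1)) * (((p : ℝ) + 2) ^ (p + 1) * 4 ^ (k + l)) := by gcongr
    _ = 2 ^ (5 * ((k : ℝ) + l) + 2 * p + 2 + L * (p + 1)) := by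
      rw [h3, show (4 : ℝ) = 2 ^ 2 by norm_num, ← pow_mul, ← rpow_natCast, ← rpow_natCast,
        ← rpow_add two_pos, ← rpow_add two_pos]
      congr 1
      push_cast
      ring
    _ ≤ 2 ^ (3 + 5 * (((p : ℝ) + k + l) * L)) := by
      refine rpow_le_rpow_of_exponent_le one_le_two ?_
      nlinarith
    _ = 8 * expFactor 1 p k l ^ 5 := by
      rw [expFactor_one, rpow_add two_pos, ← rpow_natCast (2 ^ _), ← rpow_mul zero_le_two]
      congr 1
      · norm_num
      · congr 1
        push_cast
        ring

theorem log_wordBound_le {k l m n p r : ℕ} (hm : m ≤ p + 1) (hn : 0 < n) :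
    (Nat.log 2 (wordBound k l n m r) : ℝ) ≤ 10 + 5 * (((p : ℝ) + k + l) * logb 2 ((p : ℝ) + 2)) +
      2 * logb 2 ((n : ℝ) + r) := by
  have hE := one_le_expFactor p k l
  have h1 : (wordBound k l n m r : ℝ) ≤ 2 ^ 10 * expFactor 1 p k l ^ 5 * ((n : ℝ) + r) ^ 2 := by
    have h : (wordBound k l n m r : ℝ) ≤ 66 * numCodes k l m * ((n : ℝ) + r) ^ 2 := by
      exact_mod_cast wordBound_le hn
    refine h.trans ?_
    have := numCodes_le (k := k) (l := l) hm
    have hpos : (0 : ℝ) ≤ expFactor 1 p k l ^ 5 := by positivity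
    exact mul_le_mul_of_nonneg_right (by linarith) (by positivity)
  have hpos : 0 < wordBound k l n m r := by unfold wordBound; positivity
  have hnr : (0 : ℝ) < (n : ℝ) + r := by positivity
  have h2 : (Nat.log 2 (wordBound k l n m r) : ℝ) ≤ logb 2 (wordBound k l n m r) := by
    exact_mod_cast natLog_le_logb _ _
  refine h2.trans ((logb_le_logb_of_le one_lt_two (by exact_mod_cast hpos) h1).trans (le_of_eq ?_))
  have hE0 : expFactor 1 p k l ≠ 0 := by positivity
  rw [logb_mul (by positivity) (by positivity), logb_mul (by positivity) (by positivity),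
    logb_pow, logb_pow, logb_pow, expFactor_one, logb_rpow two_pos (by norm_num),
    logb_self_eq_one one_lt_two]
  push_cast
  ring

end

end TopDP

/-! ### The theorem -/

open Classical in
theorem mainTheorem12 :
    ∃ (P : WordRAM.Prog) (C : ℕ),
      ∀ (k l n p : ℕ) (H : Digraph (Fin k)) (T : Digraph (Fin n))
        (arcs : List (Fin k × Fin k)) (bags : List (List (Fin n))),
        -- `H` is a simple digraph with `k` vertices and `l` arcs, given by the list of its arcs
        TopDP.Simple H → arcs.Nodup → (∀ u v, (u, v) ∈ arcs ↔ H.Adj u v) → arcs.length = l →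
        -- `T` is a nonempty semi-complete digraph
        0 < n → TopDP.SemiComplete T →
        -- the bags form a path decomposition of `T` of width `p`
        (∀ b ∈ bags, b.Nodup) → TopDP.IsPathDecomposition T (TopDP.bagFamily bags) →
        TopDP.width (TopDP.bagFamily bags) = p →
        ∃ (w t : ℕ) (s : WordRAM.State),
          -- the word length
          (w : ℝ) ≤ C * (((p : ℝ) + k + l) * Real.logb 2 ((p : ℝ) + 2) +
            Real.logb 2 ((n : ℝ) + bags.length) + 1) ∧
          (TopDP.initialState arcs T bags).Fits w ∧
          -- the computation and its answer
          WordRAM.Exec w P (TopDP.initialState arcs T bags) s t ∧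
          s.reg 0 = (if TopDP.TopologicallyContained H T then 1 else 0) ∧
          -- the running time
          (t : ℝ) ≤ C * TopDP.expFactor C p k l * ((n : ℝ) + bags.length) ∧
          (TopDP.ConsecutiveDistinct (TopDP.bagFamily bags) →
            (t : ℝ) ≤ C * TopDP.expFactor C p k l * n) := by
  -- The constant is 4 * 4000 * 8 ^ 4: 4000 from `mainTime_le`, the fourth power of the 8 in
  -- `numCodes_le`, and 4 from r + 1 ≤ 4n. It is far more than needed for the exponent, where 20
  -- suffices, and for the word length.
  refine ⟨TopDP.mainStmt.code, 65536000, ?_⟩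
  rintro k l n p H T arcs bags hH hnd ha rfl hn hT hbnd hW rfl
  set p := TopDP.width (TopDP.bagFamily bags) with hp
  set l := arcs.length with hl
  set r := bags.length with hr
  set m := TopDP.maxSize r (TopDP.bagAt bags) with hm
  set N := TopDP.numCodes k l m with hN
  have hmp : m ≤ p + 1 := TopDP.maxSize_bagAt_le hbnd
  set w := Nat.log 2 (TopDP.wordBound k l n m r) + 1 with hw
  have hKw : TopDP.wordBound k l n m r < 2 ^ w := Nat.lt_pow_succ_log_self one_lt_two _
  have hbits : TopDP.numBits k l m < N := TopDP.numBits_lt_numCodes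
  have hbits' : TopDP.numBits k l m = 3 * l + k + 2 * m := rfl
  have hprod : (r + 2) * (m + 2) = (r + 1) * (m + 1) + r + m + 3 := by ring
  have hprod' : (n + 1) * (n + 1) = n * n + 2 * n + 1 := by ring
  have hbound := hKw
  unfold TopDP.wordBound at hbound
  have hfits : (TopDP.initialState arcs T bags).Fits w := by
    refine TopDP.fits_initialState arcs T bags (by omega) (by omega) (by omega) (by omega)
      (fun b hb => ?_) (by omega)
    have : b.length ≤ m := by
      obtain ⟨i, hi, rfl⟩ := List.mem_iff_getElem.1 hb
      have := Finset.le_sup (f := fun i => (TopDP.bagAt bags i).length) (Finset.mem_range.2 hi)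
      simpa [TopDP.bagAt, hi, hm, hr, TopDP.maxSize] using this
    omega
  obtain ⟨s, σ, t, hexec, ht, hsim, hyes, hno⟩ := TopDP.run_main (TopDP.arcList_get hH hnd ha) hT
    (TopDP.isBagSeq_bagAt hbnd hW) (TopDP.inputRep_initialState arcs T bags) hKw.le _
    (TopDP.sim_visible hfits)
  have htime : (t : ℝ) ≤ 16384000 * TopDP.expFactor 65536000 p k l * ((r : ℝ) + 1) := by
    have h1 : t ≤ 4000 * N ^ 4 * (r + 1) :=
      ht.trans (TopDP.mainTime_le (k := k) (l := l) (m := m) (N := N) (by omega)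
        (by omega) (by omega) hbits.le)
    have h2 : (t : ℝ) ≤ 4000 * (N : ℝ) ^ 4 * ((r : ℝ) + 1) := by exact_mod_cast h1
    have hE := TopDP.one_le_expFactor p k l
    have h3 : (N : ℝ) ^ 4 ≤ (8 * TopDP.expFactor 1 p k l ^ 5) ^ 4 := by
      gcongr
      exact TopDP.numCodes_le hmp
    have h4 : TopDP.expFactor 1 p k l ^ 20 ≤ TopDP.expFactor 65536000 p k l := by
      rw [TopDP.expFactor_pow 65536000]
      exact pow_le_pow_right₀ hE (by norm_num)
    have h5 : 4000 * (N : ℝ) ^ 4 ≤ 16384000 * TopDP.expFactor 65536000 p k l := by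
      have e : (8 * TopDP.expFactor 1 p k l ^ 5) ^ 4 = 4096 * TopDP.expFactor 1 p k l ^ 20 := by
        ring
      rw [e] at h3
      linarith
    exact h2.trans (mul_le_mul_of_nonneg_right h5 (by positivity))
  have hE0 : 0 ≤ TopDP.expFactor 65536000 p k l := by unfold TopDP.expFactor; positivity
  have hn1 : (1 : ℝ) ≤ n := by exact_mod_cast hn
  have hr0 : (0 : ℝ) ≤ r := r.cast_nonneg
  refine ⟨w, t, s, ?_, hfits, hexec, ?_, ?_, fun hd => ?_⟩
  · have h1 := TopDP.log_wordBound_le (k := k) (l := l) (r := r) hmp hn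
    have h2 : 0 ≤ Real.logb 2 ((n : ℝ) + r) := Real.logb_nonneg one_lt_two (by linarith)
    have h3 : 0 ≤ ((p : ℝ) + k + l) * Real.logb 2 ((p : ℝ) + 2) := by
      have := TopDP.one_le_logb p
      positivity
    rw [hw]
    push_cast
    linarith
  · have h0 : s.reg 0 = σ.reg .k := hsim.reg .k
    rw [h0]
    split_ifs with h
    · exact hyes h
    · exact hno h
  · refine htime.trans ?_
    push_cast
    have : (16384000 : ℝ) * TopDP.expFactor 65536000 p k l ≤
      65536000 * TopDP.expFactor 65536000 p k l := by linarith
    exact mul_le_mul this (by linarith) (by positivity) (by positivity)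
  · refine htime.trans ?_
    push_cast
    have h1 : r ≤ 2 * n + 1 := hW.le_of_consecutiveDistinct hd
    -- Here r + 1 ≤ 2n + 2, and n is at least 1.
    have h2 : (r : ℝ) + 1 ≤ 4 * n := by
      have : (r : ℝ) ≤ 2 * n + 1 := by exact_mod_cast h1
      linarith
    calc 16384000 * TopDP.expFactor 65536000 p k l * ((r : ℝ) + 1)
        ≤ 16384000 * TopDP.expFactor 65536000 p k l * (4 * n) := by gcongr
      _ = 65536000 * TopDP.expFactor 65536000 p k l * n := by ring
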